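/- **Theorem 1.16.** For $n\ge 1$ let $X_n=\bigvee_{i=1}^n S^1_i$ be a wedge of $n$ oriented circles with common point $b$. A continuous map is *monotone* if all its point preimages are connected; $h:X_n\to X_m$ is *piecewise monotone* if $X_n$ is a union of finitely many arcs on each of which $h$ is monotone. A point $c$ is *critical* for $h$ if $h$ is not one-to-one in any neighborhood of $c$, and $h(c)$ is then a *critical value*. Let $\mathcal M_{n,m}$ be the set of piecewise monotone continuous surjections $f:X_n\to X_m$ with $f(b)=b$, with no critical value other than $b$, and not constant on any $S^1_i$; let $\mathcal M=\bigcup_{n\ge1}\mathcal M_{n,n}$. Let $\mathcal A_n=\{a_1,\dots,a_n,\bar a_1,\dots,\bar a_n\}$, let $\mathcal W(\mathcal A_n)$ be the set of finite nonempty words in $\mathcal A_n$, and put $\overline{b_1\cdots b_k}=\bar b_k\cdots\bar b_1$, with $\bar{\bar a}_i=a_i$. All substitutions $\tau:\mathcal A_n\to\mathcal W(\mathcal A_m)$ are required to satisfy $\tau(\bar c)=\overline{\tau(c)}$, and are extended to words by concatenation. For $f\in\mathcal M_{n,m}$ the substitution $\chi_f:\mathcal A_n\to\mathcal W(\mathcal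 A_m)$ is defined by $\chi_f(a_i)=b_1\cdots b_k$, where $J_1<\dots<J_k$ are the components of $S^1_i\setminus f^{-1}(b)$ in the positive order, and $b_j=a_\ell$ (resp. $\bar a_\ell$) if $f$ maps $J_j$ homeomorphically onto $S^1_\ell\setminus\{b\}$ preserving (resp. reversing) orientation; and $\chi_f(\bar a_i)=\overline{\chi_f(a_i)}$. Substitutions $\chi:\mathcal A_n\to\mathcal W(\mathcal A_n)$ and $\psi:\mathcal A_m\to\mathcal W(\mathcal A_m)$ are *weakly equivalent*, $\chi\sim_w\psi$, if there are positive integers $n_i,m_i$ and substitutions $\sigma_i:\mathcal A_m\to\mathcal W(\mathcal A_n)$, $\tau_i:\mathcal A_n\to\mathcal W(\mathcal A_m)$ $(i=1,2,\dots)$ with $\sigma_i\circ\tau_i=\chi^{n_i}$ and $\tau_i\circ\sigma_{i+1}=\psi^{m_i}$ for all $i$. For $f\in\mathcal M_{n,n}$: $f$ *folds at $b$* if for some $i,j$ and $k\ge1$ the letters $a_j$ and $\bar a_j$ occur consecutively, in either order, in $\chi_f^k(a_i)$. Let $\mathcal E=\{e_1,\dots,e_n,\bar e_1,\dots,\bar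 e_n\}$ be the edge germs at $b$, where $e_i$ (resp. $\bar e_i$) leaves $b$ along $S^1_i$ in the positive (resp. negative) direction, and let $f_*:\mathcal E\to\mathcal E$ send the germ of a letter $x$ to the germ of the first letter of $\chi_f(x)$, where the germ of $a_i$ is $e_i$ and that of $\bar a_i$ is $\bar e_i$. Put $\mathcal R(f)=\bigcap_{k\ge0}f_*^k(\mathcal E)$. The point $b$ is *distinguished* for $f$ if $f$ folds at $b$ or $\#\mathcal R(f)\ne2$. Let $\mathcal M^*$ be the set of $f\in\mathcal M$ for which $b$ is distinguished. Let $f\in\mathcal M_{n,n}$ and $g\in\mathcal M_{m,m}$ both belong to $\mathcal M^*$. Then the inverse limits $\varprojlim f=\{(x_0,x_1,\dots)\in\prod_{k\ge0}X_n: f(x_{k+1})=x_k \text{ for all } k\ge0\}$ and $\varprojlim g$, with the topologies inherited from the products, are homeomorphic if and only if $\chi_f\sim_w\chi_g$. -/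

import Mathlib

open Set Filter Topology

/-! ### Wedges of circles -/

/-- The relation on `n` disjoint circles that identifies all the base points `(i, 0)`. -/
def wedgeSetoid (n : ℕ) : Setoid (Fin n × UnitAddCircle) where
  r x y := x = y ∨ (x.2 = 0 ∧ y.2 = 0)
  iseqv :=
    { refl := fun _ => Or.inl rfl
      symm := by
        rintro x y (h | ⟨h, h'⟩)
        · exact Or.inl h.symm
        · exact Or.inr ⟨h', h⟩
      trans := by
        rintro x y z (rfl | ⟨h, h'⟩) (rfl | ⟨k, k'⟩)
        · exact Or.inl rfl
        · exact Or.inr ⟨k, k'⟩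
        · exact Or.inr ⟨h, h'⟩
        · exact Or.inr ⟨h, k'⟩ }

/-- The wedge `X_n` of `n` circles: `n` copies of the circle `ℝ / ℤ`, joined at their base
points, with the quotient topology. -/
def Wedge (n : ℕ) : Type := Quotient (wedgeSetoid n)

instance (n : ℕ) : TopologicalSpace (Wedge n) :=
  inferInstanceAs (TopologicalSpace (Quotient (wedgeSetoid n)))

namespace Wedge

/-- The inclusion of the `i`-th circle. -/
def incl {n : ℕ} (i : Fin n) (z : UnitAddCircle) : Wedge n :=
  Quotient.mk (wedgeSetoid n) (i, z)

/-- The `i`-th circle `S_i` as a subset of the wedge. -/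
def circle {n : ℕ} (i : Fin n) : Set (Wedge n) := range (incl i)

/-- The branch point `b`. -/
def base (n : ℕ) [NeZero n] : Wedge n := incl 0 0

/-- The positively oriented parametrization of the `i`-th circle: `[0, 1]` runs once around `S_i`
from `b` to `b`, and `(0, 1)` is mapped homeomorphically onto `S_i \ {b}`. -/
def loop {n : ℕ} (i : Fin n) (t : ℝ) : Wedge n := incl i (t : UnitAddCircle)

end Wedge

/-! ### Piecewise monotone maps and the class `𝓜` -/

/-- A map is monotone (in the sense of continuum theory) if its point preimages are connected;
the empty preimage is allowed. -/
def IsMonotoneMap {X Y : Type*} [TopologicalSpace X] (f : X → Y) : Prop :=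
  ∀ y, IsPreconnected (f ⁻¹' {y})

/-- An arc: a homeomorphic copy of `[0, 1]`. -/
def IsArc {X : Type*} [TopologicalSpace X] (A : Set X) : Prop :=
  Nonempty (A ≃ₜ unitInterval)

/-- `X` is a finite union of arcs on each of which `f` is monotone. -/
def IsPiecewiseMonotone {X Y : Type*} [TopologicalSpace X] (f : X → Y) : Prop :=
  ∃ 𝒜 : Set (Set X), 𝒜.Finite ∧ ⋃₀ 𝒜 = univ ∧
    ∀ A ∈ 𝒜, IsArc A ∧ IsMonotoneMap (A.domRestrict f)

/-- `c` is a critical point of `f` if `f` is not one-to-one in any neighborhood of `c`. -/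
def IsCriticalPoint {X Y : Type*} [TopologicalSpace X] (f : X → Y) (c : X) : Prop :=
  ∀ U ∈ 𝓝 c, ¬ InjOn f U

/-- The value of `f` at some critical point. -/
def IsCriticalValue {X Y : Type*} [TopologicalSpace X] (f : X → Y) (v : Y) : Prop :=
  ∃ c, IsCriticalPoint f c ∧ f c = v

/-- Membership in the class `𝓜_{n,m}`. -/
structure MemM {n m : ℕ} [NeZero n] [NeZero m] (f : Wedge n → Wedge m) : Prop where
  continuous : Continuous f
  piecewiseMonotone : IsPiecewiseMonotone f
  map_base : f (Wedge.base n) = Wedge.base m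
  criticalValue : ∀ v, IsCriticalValue f v → v = Wedge.base m
  surjective : Function.Surjective f
  nonconstant : ∀ i, ¬ ∃ y, ∀ x ∈ Wedge.circle i, f x = y

/-! ### Words and substitutions -/

/-- The alphabet `{a_1, …, a_n, ā_1, …, ā_n}`: the letter `(i, true)` is `a_i`, and the
letter `(i, false)` is `ā_i`. -/
abbrev Letter (n : ℕ) : Type := Fin n × Bool

/-- The involution `a_i ↔ ā_i`. -/
def Letter.bar {n : ℕ} (x : Letter n) : Letter n := (x.1, !x.2)

/-- The involution `b_1 … b_k ↦ b̄_k … b̄_1` on words. -/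
def barWord {n : ℕ} (w : List (Letter n)) : List (Letter n) := (w.map Letter.bar).reverse

/-- A substitution `A_n → W(A_m)`: it sends letters to nonempty words and commutes with the
bar. -/
structure Substitution (n m : ℕ) where
  onLetter : Letter n → List (Letter m)
  ne_nil : ∀ x, onLetter x ≠ []
  map_bar : ∀ x, onLetter x.bar = barWord (onLetter x)

namespace Substitution

/-- The extension of a substitution to words by concatenation. -/
def onWord {n m : ℕ} (σ : Substitution n m) (w : List (Letter n)) : List (Letter m) :=
  w.flatMap σ.onLetter

/-- Weak equivalence of substitutions: there are positive integers `n_i`, `m_i` and substitutions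
`σ_i`, `τ_i` with `σ_i ∘ τ_i = χ ^ n_i` and `τ_i ∘ σ_{i+1} = ψ ^ m_i` on words. -/
def WeaklyEquivalent {n m : ℕ} (χ : Substitution n n) (ψ : Substitution m m) : Prop :=
  ∃ (N M : ℕ → ℕ) (σ : ℕ → Substitution m n) (τ : ℕ → Substitution n m),
    (∀ i, 0 < N i) ∧ (∀ i, 0 < M i) ∧
    (∀ i w, (σ i).onWord ((τ i).onWord w) = χ.onWord^[N i] w) ∧
    (∀ i w, (τ i).onWord ((σ (i + 1)).onWord w) = ψ.onWord^[M i] w)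

/-- The action on edge germs at `b`. The germ that leaves `b` along `a_i` (the germ `e_i`) or along
`ā_i` (the germ `ē_i`) is denoted by that letter, and it is sent to the first letter of its
image word. -/
def germMap {n m : ℕ} (χ : Substitution n m) (x : Letter n) : Letter m :=
  (χ.onLetter x).head (χ.ne_nil x)

/-- The eventual range of the action on edge germs. -/
def eventualRange {n : ℕ} (χ : Substitution n n) : Set (Letter n) :=
  ⋂ k : ℕ, range (χ.germMap^[k])

/-- Some `a_j` and `ā_j` occur consecutively, in either order, in some `χ^k(a_i)`, `k ≥ 1`. -/
def Folds {n : ℕ} (χ : Substitution n n) : Prop :=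
  ∃ (i j : Fin n) (k : ℕ), 1 ≤ k ∧
    ([(j, true), (j, false)] <:+: χ.onWord^[k] [(i, true)] ∨
      [(j, false), (j, true)] <:+: χ.onWord^[k] [(i, true)])

end Substitution

/-! ### The substitution associated with a map -/

/-- The map `f` carries the open arc `loop i '' (u, v)` homeomorphically onto `S_ℓ \ {b}`, where
`x = a_ℓ` if this preserves the orientation and `x = ā_ℓ` if it reverses it. -/
def TracesLetter {n m : ℕ} (f : Wedge n → Wedge m) (i : Fin n) (u v : ℝ) (x : Letter m) : Prop :=
  ∃ φ : ℝ → ℝ, (∀ t ∈ Ioo u v, f (Wedge.loop i t) = Wedge.loop x.1 (φ t)) ∧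
    BijOn φ (Ioo u v) (Ioo 0 1) ∧
    if x.2 = true then StrictMonoOn φ (Ioo u v) else StrictAntiOn φ (Ioo u v)

/-- The word `w = b_1 … b_k` describes `f` on the `i`-th circle: the components of
`S_i \ f⁻¹(b)` are, in the positive order, arcs `J_1 < … < J_k`, with `J_j` the image of
`(u_j, v_j)`, and `f` carries `J_j` around the circle as `b_j` says. -/
def TracesWord {n m : ℕ} [NeZero m] (f : Wedge n → Wedge m) (i : Fin n)
    (w : List (Letter m)) : Prop :=
  ∃ u v : Fin w.length → ℝ,
    (∀ j, 0 ≤ u j ∧ u j < v j ∧ v j ≤ 1) ∧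
    (∀ j k, j < k → v j ≤ u k) ∧
    (∀ t ∈ Icc (0 : ℝ) 1, f (Wedge.loop i t) ≠ Wedge.base m ↔ ∃ j, t ∈ Ioo (u j) (v j)) ∧
    ∀ j, TracesLetter f i (u j) (v j) (w.get j)

/-- `f` follows the pattern `χ`. The images of the letters `ā_i` are determined by
`Substitution.map_bar`. -/
def FollowsPattern {n m : ℕ} [NeZero m] (f : Wedge n → Wedge m) (χ : Substitution n m) : Prop :=
  ∀ i, TracesWord f i (χ.onLetter (i, true))


/-! ### The pattern of a map in `𝓜` exists and is unique -/

namespace Wedge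

/-- The retraction onto the `l`-th circle that collapses all other circles to the base point. -/
def proj {n : ℕ} (l : Fin n) : Wedge n → UnitAddCircle :=
  Quotient.lift (fun x : Fin n × UnitAddCircle => if x.1 = l then x.2 else 0) (by
    rintro x y (rfl | ⟨h, h'⟩)
    · rfl
    · simp [h, h'])

theorem proj_incl {n : ℕ} (l i : Fin n) (z : UnitAddCircle) :
    proj l (incl i z) = if i = l then z else 0 := rfl

theorem continuous_proj {n : ℕ} (l : Fin n) : Continuous (proj l) := by
  apply Continuous.quotient_lift
  refine continuous_prod_of_discrete_left.2 fun i => ?_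
  by_cases h : i = l
  · simpa [h] using continuous_id'
  · simpa [h] using continuous_const

theorem continuous_incl {n : ℕ} (i : Fin n) : Continuous (incl i) :=
  continuous_quotient_mk'.comp (Continuous.prodMk_right i)

theorem continuous_loop {n : ℕ} (i : Fin n) : Continuous (loop i) :=
  (continuous_incl i).comp (AddCircle.continuous_mk' 1)

theorem incl_zero {n : ℕ} [NeZero n] (i : Fin n) : incl i 0 = base n :=
  Quotient.sound (Or.inr ⟨rfl, rfl⟩)

theorem loop_zero {n : ℕ} [NeZero n] (i : Fin n) : loop i 0 = base n := by
  simpa [loop] using incl_zero i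

theorem loop_one {n : ℕ} [NeZero n] (i : Fin n) : loop i 1 = base n := by
  have h : ((1 : ℝ) : UnitAddCircle) = 0 := AddCircle.coe_period 1
  rw [loop, h, incl_zero]

theorem proj_base {n : ℕ} [NeZero n] (l : Fin n) : proj l (base n) = 0 := by
  simp [base, proj_incl]

theorem exists_incl {n : ℕ} (y : Wedge n) : ∃ i z, y = incl i z := by
  induction y using Quotient.inductionOn with
  | h x => exact ⟨x.1, x.2, rfl⟩

theorem eq_incl_of_proj_ne {n : ℕ} {y : Wedge n} {l : Fin n} (h : proj l y ≠ 0) :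
    y = incl l (proj l y) := by
  obtain ⟨i, z, rfl⟩ := exists_incl y
  rw [proj_incl] at h ⊢
  by_cases hi : i = l
  · subst hi; simp
  · simp [hi] at h

theorem exists_proj_ne {n : ℕ} [NeZero n] {y : Wedge n} (h : y ≠ base n) :
    ∃ l, proj l y ≠ 0 := by
  obtain ⟨i, z, rfl⟩ := exists_incl y
  refine ⟨i, fun hz => h ?_⟩
  rw [proj_incl, if_pos rfl] at hz
  rw [hz, incl_zero]

theorem proj_eq_of_ne {n : ℕ} {y : Wedge n} {l k : Fin n} (h : proj l y ≠ 0)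
    (h' : proj k y ≠ 0) : l = k := by
  rw [eq_incl_of_proj_ne h, proj_incl] at h'
  by_contra hlk
  simp [hlk] at h'

theorem coe_eq_coe {s t : ℝ} (hs : s ∈ Ico (0 : ℝ) 1) (ht : t ∈ Ico (0 : ℝ) 1) :
    (s : UnitAddCircle) = t ↔ s = t :=
  AddCircle.coe_eq_coe_iff_of_mem_Ico (p := (1 : ℝ)) (a := 0) (by simpa using hs) (by simpa using ht)

theorem coe_ne_zero {t : ℝ} (ht : t ∈ Ioo (0 : ℝ) 1) : (t : UnitAddCircle) ≠ 0 := by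
  intro h
  have := (coe_eq_coe (t := 0) ⟨ht.1.le, ht.2⟩ (by simp)).1 (by simpa using h)
  exact ht.1.ne' this

theorem loop_inj {n : ℕ} {i j : Fin n} {s t : ℝ} (hs : s ∈ Ioo (0 : ℝ) 1)
    (ht : t ∈ Ioo (0 : ℝ) 1) (h : loop i s = loop j t) : i = j ∧ s = t := by
  have h1 := congrArg (proj i) h
  simp only [loop, proj_incl, if_true] at h1
  by_cases hij : j = i
  · rw [if_pos hij] at h1
    exact ⟨hij.symm, (coe_eq_coe ⟨hs.1.le, hs.2⟩ ⟨ht.1.le, ht.2⟩).1 h1⟩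
  · rw [if_neg hij] at h1
    exact absurd h1 (coe_ne_zero hs)

theorem loop_ne_base {n : ℕ} [NeZero n] {i : Fin n} {t : ℝ} (ht : t ∈ Ioo (0 : ℝ) 1) :
    loop i t ≠ base n := by
  intro h
  have := congrArg (proj i) h
  rw [proj_base, loop, proj_incl, if_pos rfl] at this
  exact coe_ne_zero ht this

theorem isClosed_base {n : ℕ} [NeZero n] : IsClosed ({base n} : Set (Wedge n)) := by
  have : ({base n} : Set (Wedge n)) = ⋂ l, proj l ⁻¹' {0} := by
    ext y
    simp only [mem_singleton_iff, mem_iInter, mem_preimage]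
    refine ⟨fun h l => by rw [h, proj_base], fun h => ?_⟩
    by_contra hy
    obtain ⟨l, hl⟩ := exists_proj_ne hy
    exact hl (h l)
  rw [this]
  exact isClosed_iInter fun l => isClosed_singleton.preimage (continuous_proj l)

/-- The coordinate in `[0, 1)` of a point of the circle. -/
noncomputable def coord (z : UnitAddCircle) : ℝ := (AddCircle.equivIco (1 : ℝ) 0 z : ℝ)

theorem coord_mem (z : UnitAddCircle) : coord z ∈ Ico (0 : ℝ) 1 := by
  have := (AddCircle.equivIco (1 : ℝ) 0 z).2
  simpa [coord] using this

theorem coe_coord (z : UnitAddCircle) : ((coord z : ℝ) : UnitAddCircle) = z :=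
  (AddCircle.equivIco (1 : ℝ) 0).symm_apply_apply z

theorem coord_mem_Ioo {z : UnitAddCircle} (h : z ≠ 0) : coord z ∈ Ioo (0 : ℝ) 1 := by
  refine ⟨lt_of_le_of_ne (coord_mem z).1 fun h0 => h ?_, (coord_mem z).2⟩
  rw [← coe_coord z, ← h0]
  rfl

theorem continuousAt_coord {z : UnitAddCircle} (h : z ≠ 0) : ContinuousAt coord z := by
  have := AddCircle.continuousAt_equivIco (1 : ℝ) 0 (x := z) (by simpa using h)
  exact continuous_subtype_val.continuousAt.comp this

end Wedge

/-- A continuous, locally injective real function on an open interval is strictly monotone. -/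
theorem strictMonoOn_or_strictAntiOn_of_locallyInjective {u v : ℝ} {φ : ℝ → ℝ}
    (hc : ContinuousOn φ (Ioo u v)) (hinj : ∀ t ∈ Ioo u v, ∃ U ∈ 𝓝 t, InjOn φ U) :
    StrictMonoOn φ (Ioo u v) ∨ StrictAntiOn φ (Ioo u v) := by
  have hI : InjOn φ (Ioo u v) := by
    have key : ∀ x ∈ Ioo u v, ∀ y ∈ Ioo u v, x < y → φ x ≠ φ y := by
      intro x hx y hy hxy hφ
      have hsub : Icc x y ⊆ Ioo u v := fun t ht => ⟨hx.1.trans_le ht.1, ht.2.trans_lt hy.2⟩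
      obtain ⟨c, hcm, hext⟩ := exists_isLocalExtr_Ioo hxy (hc.mono hsub) hφ
      have hcI := hsub (Ioo_subset_Icc_self hcm)
      obtain ⟨U, hU, hUi⟩ := hinj c hcI
      have hn : U ∩ Ioo u v ∈ 𝓝 c := inter_mem hU (Ioo_mem_nhds hcI.1 hcI.2)
      have aux : ∀ V ∈ 𝓝 c, ∃ p q, p < c ∧ c < q ∧ Icc p q ⊆ V := by
        intro V hV
        obtain ⟨ε, hε, hb⟩ := Metric.nhds_basis_closedBall.mem_iff.1 hV
        rw [Real.closedBall_eq_Icc] at hb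
        exact ⟨c - ε, c + ε, by linarith, by linarith, hb⟩
      rcases hext with he | he
      · obtain ⟨p, q, hp, hq, hpq⟩ := aux _ (inter_mem hn he)
        have hpm : p ∈ Icc p q := ⟨le_rfl, (hp.trans hq).le⟩
        have hqm : q ∈ Icc p q := ⟨(hp.trans hq).le, le_rfl⟩
        have hcm : c ∈ Icc p q := ⟨hp.le, hq.le⟩
        have e1 : φ c ≤ φ p := (hpq hpm).2
        have e2 : φ c ≤ φ q := (hpq hqm).2
        rcases ContinuousOn.strictMonoOn_of_injOn_Icc' (hp.trans hq).le
          (hc.mono fun t ht => (hpq ht).1.2) (hUi.mono fun t ht => (hpq ht).1.1) with h | h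
        · exact absurd (h hpm hcm hp) (not_lt.2 e1)
        · exact absurd (h hcm hqm hq) (not_lt.2 e2)
      · obtain ⟨p, q, hp, hq, hpq⟩ := aux _ (inter_mem hn he)
        have hpm : p ∈ Icc p q := ⟨le_rfl, (hp.trans hq).le⟩
        have hqm : q ∈ Icc p q := ⟨(hp.trans hq).le, le_rfl⟩
        have hcm : c ∈ Icc p q := ⟨hp.le, hq.le⟩
        have e1 : φ p ≤ φ c := (hpq hpm).2
        have e2 : φ q ≤ φ c := (hpq hqm).2
        rcases ContinuousOn.strictMonoOn_of_injOn_Icc' (hp.trans hq).le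
          (hc.mono fun t ht => (hpq ht).1.2) (hUi.mono fun t ht => (hpq ht).1.1) with h | h
        · exact absurd (h hcm hqm hq) (not_lt.2 e2)
        · exact absurd (h hpm hcm hp) (not_lt.2 e1)
    intro x hx y hy hxy
    rcases lt_trichotomy x y with h | h | h
    · exact absurd hxy (key x hx y hy h)
    · exact h
    · exact absurd hxy.symm (key y hy x hx h)
  by_contra hcon
  rw [not_or] at hcon
  obtain ⟨h1, h2⟩ := hcon
  simp only [StrictMonoOn, StrictAntiOn, not_forall, not_lt] at h1 h2
  obtain ⟨a, ha, b, hb, hab, hle⟩ := h1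
  obtain ⟨c, hc', d, hd, hcd, hle'⟩ := h2
  have hsub : Icc (min a c) (max b d) ⊆ Ioo u v := fun t ht =>
    ⟨(lt_min ha.1 hc'.1).trans_le ht.1, ht.2.trans_lt (max_lt hb.2 hd.2)⟩
  have ma : a ∈ Icc (min a c) (max b d) := ⟨min_le_left _ _, hab.le.trans (le_max_left _ _)⟩
  have mb : b ∈ Icc (min a c) (max b d) := ⟨(min_le_left _ _).trans hab.le, le_max_left _ _⟩
  have mc : c ∈ Icc (min a c) (max b d) := ⟨min_le_right _ _, hcd.le.trans (le_max_right _ _)⟩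
  have md : d ∈ Icc (min a c) (max b d) := ⟨(min_le_right _ _).trans hcd.le, le_max_right _ _⟩
  rcases ContinuousOn.strictMonoOn_of_injOn_Icc' (ma.1.trans ma.2)
    (hc.mono hsub) (hI.mono hsub) with h | h
  · exact absurd (h ma mb hab) (not_lt.2 hle)
  · exact absurd (h mc md hcd) (not_lt.2 hle')

/-- `(u, v)` is a component of the set where the path `g` avoids the base point. -/
structure IsGap {m : ℕ} [NeZero m] (g : ℝ → Wedge m) (u v : ℝ) : Prop where
  lt : u < v
  left : g u = Wedge.base m
  right : g v = Wedge.base m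
  ne : ∀ t ∈ Ioo u v, g t ≠ Wedge.base m

/-- The path `g` runs over `(u, v)` once around a circle, as the letter `x` says. -/
def PathTraces {m : ℕ} (g : ℝ → Wedge m) (u v : ℝ) (x : Letter m) : Prop :=
  ∃ φ : ℝ → ℝ, (∀ t ∈ Ioo u v, g t = Wedge.loop x.1 (φ t)) ∧
    BijOn φ (Ioo u v) (Ioo 0 1) ∧
    if x.2 = true then StrictMonoOn φ (Ioo u v) else StrictAntiOn φ (Ioo u v)

theorem IsGap.eq_of_mem {m : ℕ} [NeZero m] {g : ℝ → Wedge m} {u v u' v' t : ℝ}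
    (h : IsGap g u v) (h' : IsGap g u' v') (ht : t ∈ Ioo u v) (ht' : t ∈ Ioo u' v') :
    u = u' ∧ v = v' := by
  constructor
  · rcases lt_trichotomy u u' with hl | hl | hl
    · exact absurd h'.left (h.ne u' ⟨hl, ht'.1.trans ht.2⟩)
    · exact hl
    · exact absurd h.left (h'.ne u ⟨hl, ht.1.trans ht'.2⟩)
  · rcases lt_trichotomy v v' with hl | hl | hl
    · exact absurd h.right (h'.ne v ⟨ht'.1.trans ht.2, hl⟩)
    · exact hl
    · exact absurd h'.right (h.ne v' ⟨ht.1.trans ht'.2, hl⟩)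

theorem exists_isGap {m : ℕ} [NeZero m] {g : ℝ → Wedge m} (hg : Continuous g)
    (h0 : g 0 = Wedge.base m) (h1 : g 1 = Wedge.base m) {t : ℝ} (ht : t ∈ Icc (0 : ℝ) 1)
    (hne : g t ≠ Wedge.base m) :
    ∃ u v, 0 ≤ u ∧ v ≤ 1 ∧ t ∈ Ioo u v ∧ IsGap g u v := by
  have hcl : IsClosed (g ⁻¹' {Wedge.base m}) := Wedge.isClosed_base.preimage hg
  obtain ⟨u, hu, hum⟩ := (isCompact_Icc.inter_right hcl : IsCompact (Icc 0 t ∩ _)).exists_isGreatest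
    ⟨0, ⟨le_rfl, ht.1⟩, h0⟩
  obtain ⟨v, hv, hvm⟩ := (isCompact_Icc.inter_right hcl : IsCompact (Icc t 1 ∩ _)).exists_isLeast
    ⟨1, ⟨ht.2, le_rfl⟩, h1⟩
  have hut : u < t := lt_of_le_of_ne hu.1.2 fun h => hne (h ▸ hu.2)
  have hvt : t < v := lt_of_le_of_ne hv.1.1 fun h => hne (h ▸ hv.2)
  refine ⟨u, v, hu.1.1, hv.1.2, ⟨hut, hvt⟩, hut.trans hvt, hu.2, hv.2, fun s hs hsb => ?_⟩
  rcases le_total s t with h | h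
  · exact absurd (hum ⟨⟨hu.1.1.trans hs.1.le, h⟩, hsb⟩) (not_le.2 hs.1)
  · exact absurd (hvm ⟨⟨h, hs.2.le.trans hv.1.2⟩, hsb⟩) (not_le.2 hs.2)

theorem IsGap.exists_pathTraces {m : ℕ} [NeZero m] {g : ℝ → Wedge m} {u v : ℝ}
    (h : IsGap g u v) (hg : Continuous g)
    (hinj : ∀ t ∈ Ioo u v, ∃ U ∈ 𝓝 t, InjOn g U) : ∃ x, PathTraces g u v x := by
  obtain ⟨t₀, ht₀⟩ := nonempty_Ioo.2 h.lt
  obtain ⟨l, hl⟩ := Wedge.exists_proj_ne (h.ne t₀ ht₀)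
  have hall : ∀ t ∈ Ioo u v, Wedge.proj l (g t) ≠ 0 := by
    have hop : ∀ k, IsOpen {t | Wedge.proj k (g t) ≠ 0} := fun k =>
      isOpen_ne.preimage ((Wedge.continuous_proj k).comp hg)
    show Ioo u v ⊆ {t | Wedge.proj l (g t) ≠ 0}
    refine isPreconnected_Ioo.subset_left_of_subset_union (hop l)
      (v := ⋃ k, ⋃ _ : k ≠ l, {t | Wedge.proj k (g t) ≠ 0})
      (isOpen_iUnion fun k => isOpen_iUnion fun _ => hop k) ?_ ?_ ⟨t₀, ht₀, hl⟩
    · rw [Set.disjoint_left]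
      intro t ht ht'
      simp only [mem_iUnion] at ht'
      obtain ⟨k, hk, hk'⟩ := ht'
      exact hk (Wedge.proj_eq_of_ne hk' ht)
    · intro t ht
      obtain ⟨k, hk⟩ := Wedge.exists_proj_ne (h.ne t ht)
      by_cases hkl : k = l
      · exact Or.inl (hkl ▸ hk)
      · exact Or.inr (mem_iUnion.2 ⟨k, mem_iUnion.2 ⟨hkl, hk⟩⟩)
  set φ : ℝ → ℝ := fun t => Wedge.coord (Wedge.proj l (g t)) with hφ
  have hcoe : ∀ t, ((φ t : ℝ) : UnitAddCircle) = Wedge.proj l (g t) := fun t =>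
    Wedge.coe_coord _
  have hgφ : ∀ t ∈ Ioo u v, g t = Wedge.loop l (φ t) := fun t ht => by
    rw [Wedge.loop, hcoe]
    exact Wedge.eq_incl_of_proj_ne (hall t ht)
  have hmaps : ∀ t ∈ Ioo u v, φ t ∈ Ioo (0 : ℝ) 1 := fun t ht => Wedge.coord_mem_Ioo (hall t ht)
  have hcont : ContinuousOn φ (Ioo u v) := fun t ht =>
    (ContinuousAt.comp (f := fun t => Wedge.proj l (g t)) (Wedge.continuousAt_coord (hall t ht))
      ((Wedge.continuous_proj l).comp hg).continuousAt).continuousWithinAt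
  have hmono : StrictMonoOn φ (Ioo u v) ∨ StrictAntiOn φ (Ioo u v) := by
    refine strictMonoOn_or_strictAntiOn_of_locallyInjective hcont fun t ht => ?_
    obtain ⟨U, hU, hUi⟩ := hinj t ht
    refine ⟨U ∩ Ioo u v, inter_mem hU (Ioo_mem_nhds ht.1 ht.2), fun x hx y hy hxy => ?_⟩
    refine hUi hx.1 hy.1 ?_
    rw [hgφ x hx.2, hgφ y hy.2, hxy]
  -- near an endpoint, `φ` leaves every compact subinterval of `(0, 1)`
  have hend : ∀ e, g e = Wedge.base m → ∀ c d : ℝ, 0 < c → d < 1 →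
      ∀ᶠ t in 𝓝 e, φ t ∉ Icc c d := by
    intro e he c d hc hd
    have hK : IsClosed ((fun s : ℝ => (s : UnitAddCircle)) '' Icc c d) :=
      (isCompact_Icc.image (AddCircle.continuous_mk' 1)).isClosed
    have hne : Wedge.proj l (g e) ∉ (fun s : ℝ => (s : UnitAddCircle)) '' Icc c d := by
      rw [he, Wedge.proj_base]
      rintro ⟨s, hs, hs0⟩
      exact Wedge.coe_ne_zero ⟨hc.trans_le hs.1, hs.2.trans_lt hd⟩ hs0
    have := (((Wedge.continuous_proj l).comp hg).continuousAt (x := e)).eventually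
      (hK.isOpen_compl.mem_nhds hne)
    filter_upwards [this] with t ht hmem
    exact ht ⟨φ t, hmem, hcoe t⟩
  have hright : ∀ p : ℝ → Prop, (∀ᶠ t in 𝓝 u, p t) → ∃ t ∈ Ioo u t₀, p t := by
    intro p hp
    obtain ⟨t, h1, h2⟩ := ((hp.filter_mono nhdsWithin_le_nhds).and
      (Ioo_mem_nhdsGT ht₀.1)).exists
    exact ⟨t, h2, h1⟩
  have hleft : ∀ p : ℝ → Prop, (∀ᶠ t in 𝓝 v, p t) → ∃ t ∈ Ioo t₀ v, p t := by
    intro p hp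
    obtain ⟨t, h1, h2⟩ := ((hp.filter_mono nhdsWithin_le_nhds).and
      (Ioo_mem_nhdsLT ht₀.2)).exists
    exact ⟨t, h2, h1⟩
  have hm₀ := hmaps t₀ ht₀
  have hsurj : SurjOn φ (Ioo u v) (Ioo 0 1) := by
    intro c hc
    have hlo : 0 < min c (φ t₀) := lt_min hc.1 hm₀.1
    have hhi : max c (φ t₀) < 1 := max_lt hc.2 hm₀.2
    obtain ⟨a, ha, hac⟩ := hright _ ((hend u h.left _ _ hlo hm₀.2).and
      (hend u h.left _ _ hm₀.1 hhi))
    obtain ⟨b, hb, hbc⟩ := hleft _ ((hend v h.right _ _ hlo hm₀.2).and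
      (hend v h.right _ _ hm₀.1 hhi))
    have ha' : a ∈ Ioo u v := ⟨ha.1, ha.2.trans ht₀.2⟩
    have hb' : b ∈ Ioo u v := ⟨ht₀.1.trans hb.1, hb.2⟩
    have himg := (isPreconnected_Ioo.image φ hcont).ordConnected
    rcases hmono with hs | hs
    · have h1 := hs ha' ht₀ ha.2
      have h2 := hs ht₀ hb' hb.1
      have hac' : φ a < c := by
        by_contra hcon
        exact hac.1 ⟨(min_le_left _ _).trans (not_lt.1 hcon), h1.le⟩
      have hbc' : c < φ b := by
        by_contra hcon
        exact hbc.2 ⟨h2.le, (not_lt.1 hcon).trans (le_max_left _ _)⟩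
      exact himg.out ⟨a, ha', rfl⟩ ⟨b, hb', rfl⟩ ⟨hac'.le, hbc'.le⟩
    · have h1 := hs ha' ht₀ ha.2
      have h2 := hs ht₀ hb' hb.1
      have hac' : c < φ a := by
        by_contra hcon
        exact hac.2 ⟨h1.le, (not_lt.1 hcon).trans (le_max_left _ _)⟩
      have hbc' : φ b < c := by
        by_contra hcon
        exact hbc.1 ⟨(min_le_left _ _).trans (not_lt.1 hcon), h2.le⟩
      exact himg.out ⟨b, hb', rfl⟩ ⟨a, ha', rfl⟩ ⟨hbc'.le, hac'.le⟩
  rcases hmono with hs | hs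
  · exact ⟨(l, true), φ, hgφ, ⟨hmaps, hs.injOn, hsurj⟩, by simpa using hs⟩
  · exact ⟨(l, false), φ, hgφ, ⟨hmaps, hs.injOn, hsurj⟩, by simpa using hs⟩

theorem PathTraces.unique {m : ℕ} {g : ℝ → Wedge m} {u v u' v' t : ℝ} {x x' : Letter m}
    (h : PathTraces g u v x) (h' : PathTraces g u' v' x') (ht : t ∈ Ioo u v)
    (ht' : t ∈ Ioo u' v') : x = x' := by
  obtain ⟨φ, h1, h2, h3⟩ := h
  obtain ⟨φ', h1', h2', h3'⟩ := h'
  have key : ∀ s ∈ Ioo u v, s ∈ Ioo u' v' → x.1 = x'.1 ∧ φ s = φ' s := fun s hs hs' =>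
    Wedge.loop_inj (h2.mapsTo hs) (h2'.mapsTo hs') ((h1 s hs).symm.trans (h1' s hs'))
  obtain ⟨s, hs⟩ := exists_between (lt_min ht.2 ht'.2)
  have hsm : s ∈ Ioo u v := ⟨ht.1.trans hs.1, hs.2.trans_le (min_le_left _ _)⟩
  have hsm' : s ∈ Ioo u' v' := ⟨ht'.1.trans hs.1, hs.2.trans_le (min_le_right _ _)⟩
  have e1 := (key t ht ht').2
  have e2 := (key s hsm hsm').2
  refine Prod.ext (key t ht ht').1 ?_
  rcases hx : x.2 with _ | _ <;> rcases hx' : x'.2 with _ | _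
  · rfl
  · rw [hx] at h3
    rw [hx'] at h3'
    have a1 := (by simpa using h3 : StrictAntiOn φ (Ioo u v)) ht hsm hs.1
    have a2 := (by simpa using h3' : StrictMonoOn φ' (Ioo u' v')) ht' hsm' hs.1
    linarith
  · rw [hx] at h3
    rw [hx'] at h3'
    have a1 := (by simpa using h3 : StrictMonoOn φ (Ioo u v)) ht hsm hs.1
    have a2 := (by simpa using h3' : StrictAntiOn φ' (Ioo u' v')) ht' hsm' hs.1
    linarith
  · rfl

/-- The points at which the path `g` passes through the midpoint of some circle. -/
def midSet {m : ℕ} (g : ℝ → Wedge m) : Set ℝ :=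
  {t | t ∈ Icc (0 : ℝ) 1 ∧ ∃ l, g t = Wedge.loop l (1 / 2)}

theorem PathTraces.existsUnique_mid {m : ℕ} {g : ℝ → Wedge m} {u v : ℝ} {x : Letter m}
    (h : PathTraces g u v x) (hu : 0 ≤ u) (hv : v ≤ 1) :
    ∃ t ∈ Ioo u v, t ∈ midSet g ∧ ∀ s ∈ Ioo u v, s ∈ midSet g → s = t := by
  obtain ⟨φ, h1, h2, -⟩ := h
  have hhalf : (1 / 2 : ℝ) ∈ Ioo (0 : ℝ) 1 := by norm_num
  obtain ⟨t, ht, htφ⟩ := h2.surjOn hhalf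
  refine ⟨t, ht, ⟨⟨hu.trans ht.1.le, ht.2.le.trans hv⟩, x.1, by rw [h1 t ht, htφ]⟩, ?_⟩
  rintro s hs ⟨-, l, hl⟩
  refine h2.injOn hs ht ?_
  rw [htφ]
  exact (Wedge.loop_inj (h2.mapsTo hs) hhalf ((h1 s hs).symm.trans hl)).2

theorem midSet_ne_base {m : ℕ} [NeZero m] {g : ℝ → Wedge m} {t : ℝ} (ht : t ∈ midSet g) :
    g t ≠ Wedge.base m := by
  obtain ⟨-, l, hl⟩ := ht
  rw [hl]
  exact Wedge.loop_ne_base (by norm_num)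

theorem isClosed_midSet {m : ℕ} {g : ℝ → Wedge m} (hg : Continuous g) : IsClosed (midSet g) := by
  have : midSet g = Icc (0 : ℝ) 1 ∩
      ⋃ l, (fun t => Wedge.proj l (g t)) ⁻¹' {((1 / 2 : ℝ) : UnitAddCircle)} := by
    ext t
    simp only [midSet, mem_ofPred_eq, mem_inter_iff, mem_iUnion, mem_preimage, mem_singleton_iff]
    refine and_congr_right fun _ => exists_congr fun l => ⟨fun h => ?_, fun h => ?_⟩
    · rw [h, Wedge.loop, Wedge.proj_incl, if_pos rfl]
    · have hne : Wedge.proj l (g t) ≠ 0 := by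
        rw [h]
        exact Wedge.coe_ne_zero (by norm_num)
      rw [Wedge.eq_incl_of_proj_ne hne, h]
      rfl
  rw [this]
  exact isClosed_Icc.inter (isClosed_iUnion_of_finite fun l =>
    isClosed_singleton.preimage ((Wedge.continuous_proj l).comp hg))

/-- The description of a path by a word. -/
def PathTracesWord {m : ℕ} [NeZero m] (g : ℝ → Wedge m) (w : List (Letter m)) : Prop :=
  ∃ u v : Fin w.length → ℝ,
    (∀ j, 0 ≤ u j ∧ u j < v j ∧ v j ≤ 1) ∧
    (∀ j k, j < k → v j ≤ u k) ∧
    (∀ t ∈ Icc (0 : ℝ) 1, g t ≠ Wedge.base m ↔ ∃ j, t ∈ Ioo (u j) (v j)) ∧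
    ∀ j, PathTraces g (u j) (v j) (w.get j)

theorem exists_pathTracesWord {m : ℕ} [NeZero m] {g : ℝ → Wedge m} (hg : Continuous g)
    (h0 : g 0 = Wedge.base m) (h1 : g 1 = Wedge.base m)
    (hinj : ∀ t ∈ Ioo (0 : ℝ) 1, g t ≠ Wedge.base m → ∃ U ∈ 𝓝 t, InjOn g U) :
    ∃ w, PathTracesWord g w := by
  have htr : ∀ u v, 0 ≤ u → v ≤ 1 → IsGap g u v → ∃ x, PathTraces g u v x := by
    intro u v hu hv hgap
    exact hgap.exists_pathTraces hg fun t ht =>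
      hinj t ⟨hu.trans_lt ht.1, ht.2.trans_le hv⟩ (hgap.ne t ht)
  have hcomp : ∀ t, ∃ u v x, t ∈ midSet g → 0 ≤ u ∧ v ≤ 1 ∧ t ∈ Ioo u v ∧ IsGap g u v ∧
      PathTraces g u v x := by
    intro t
    by_cases ht : t ∈ midSet g
    · obtain ⟨u, v, hu, hv, htm, hgap⟩ := exists_isGap hg h0 h1 ht.1 (midSet_ne_base ht)
      obtain ⟨x, hx⟩ := htr u v hu hv hgap
      exact ⟨u, v, x, fun _ => ⟨hu, hv, htm, hgap, hx⟩⟩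
    · exact ⟨0, 0, (0, true), fun h => absurd h ht⟩
  choose u v x hcomp using hcomp
  have hsingle : ∀ t ∈ midSet g, ∀ s ∈ midSet g, s ∈ Ioo (u t) (v t) → s = t := by
    intro t ht s hs hst
    obtain ⟨hu, hv, htm, hgap, hx⟩ := hcomp t ht
    obtain ⟨r, -, -, hr⟩ := hx.existsUnique_mid hu hv
    rw [hr s hst hs, hr t htm ht]
  have hfin : (midSet g).Finite := by
    have hK : IsCompact (midSet g) :=
      isCompact_Icc.of_isClosed_subset (isClosed_midSet hg) fun t ht => ht.1
    obtain ⟨T, hT, hTc⟩ := hK.elim_nhds_subcover (fun t => Ioo (u t) (v t)) fun t ht =>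
      Ioo_mem_nhds (hcomp t ht).2.2.1.1 (hcomp t ht).2.2.1.2
    refine T.finite_toSet.subset fun s hs => ?_
    obtain ⟨t, ht, hst⟩ := mem_iUnion₂.1 (hTc hs)
    rw [hsingle t (hT t ht) s hs hst]
    exact ht
  set H := hfin.toFinset with hH
  let e : Fin H.card → ℝ := H.orderEmbOfFin rfl
  have hemono : StrictMono e := (H.orderEmbOfFin rfl).strictMono
  have heM : ∀ j, e j ∈ midSet g := fun j =>
    hfin.mem_toFinset.1 (H.orderEmbOfFin_mem rfl j)
  have hsurj : ∀ t ∈ midSet g, ∃ j, e j = t := by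
    intro t ht
    have : t ∈ range (H.orderEmbOfFin rfl) := by
      rw [Finset.range_orderEmbOfFin]
      exact hfin.mem_toFinset.2 ht
    exact this
  have hlen : (List.ofFn fun j => x (e j)).length = H.card := List.length_ofFn
  refine ⟨List.ofFn fun j => x (e j), fun j => u (e (j.cast hlen)), fun j => v (e (j.cast hlen)),
    fun j => ?_, fun j k hjk => ?_, fun t ht => ⟨fun hne => ?_, ?_⟩, fun j => ?_⟩
  · obtain ⟨hu, hv, -, hgap, -⟩ := hcomp _ (heM (j.cast hlen))
    exact ⟨hu, hgap.lt, hv⟩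
  · have hlt : e (j.cast hlen) < e (k.cast hlen) := hemono hjk
    obtain ⟨-, -, hmj, hgj, -⟩ := hcomp _ (heM (j.cast hlen))
    obtain ⟨-, -, hmk, hgk, -⟩ := hcomp _ (heM (k.cast hlen))
    by_contra hcon
    rw [not_le] at hcon
    rcases lt_or_ge (v (e (j.cast hlen))) (v (e (k.cast hlen))) with h | h
    · exact hgk.ne _ ⟨hcon, h⟩ hgj.right
    · exact hlt.ne' (hsingle _ (heM _) _ (heM _) ⟨hmj.1.trans hlt, hmk.2.trans_le h⟩)
  · obtain ⟨a, b, ha, hb, htab, hgap⟩ := exists_isGap hg h0 h1 ht hne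
    obtain ⟨y, hy⟩ := htr a b ha hb hgap
    obtain ⟨s, hs, hsM, -⟩ := hy.existsUnique_mid ha hb
    obtain ⟨j, hj⟩ := hsurj s hsM
    obtain ⟨-, -, hm, hgap', -⟩ := hcomp s hsM
    obtain ⟨e1, e2⟩ := hgap.eq_of_mem hgap' hs hm
    refine ⟨j.cast hlen.symm, ?_⟩
    show t ∈ Ioo (u (e j)) (v (e j))
    rw [hj, ← e1, ← e2]
    exact htab
  · rintro ⟨j, hj⟩
    exact (hcomp _ (heM (j.cast hlen))).2.2.2.1.ne t hj
  · have := (hcomp _ (heM (j.cast hlen))).2.2.2.2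
    rw [List.get_ofFn]
    exact this

theorem PathTracesWord.unique {m : ℕ} [NeZero m] {g : ℝ → Wedge m} {w w' : List (Letter m)}
    (h : PathTracesWord g w) (h' : PathTracesWord g w') : w = w' := by
  have main : ∀ w, PathTracesWord g w → ∃ e : Fin w.length → ℝ, StrictMono e ∧
      range e = midSet g ∧ ∀ j, ∃ a b, e j ∈ Ioo a b ∧ PathTraces g a b (w.get j) := by
    rintro w ⟨u, v, h1, h2, h3, h4⟩
    choose e he heM heu using fun j => (h4 j).existsUnique_mid (h1 j).1 (h1 j).2.2
    refine ⟨e, fun j k hjk => ((he j).2.trans_le (h2 j k hjk)).trans (he k).1, ?_,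
      fun j => ⟨u j, v j, he j, h4 j⟩⟩
    refine Subset.antisymm (range_subset_iff.2 heM) fun t ht => ?_
    obtain ⟨j, hj⟩ := (h3 t ht.1).1 (midSet_ne_base ht)
    exact ⟨j, (heu j t hj ht).symm⟩
  obtain ⟨e, hmono, hr, hl⟩ := main w h
  obtain ⟨e', hmono', hr', hl'⟩ := main w' h'
  have hlen : w.length = w'.length := by
    have c1 := Nat.card_range_of_injective hmono.injective
    have c2 := Nat.card_range_of_injective hmono'.injective
    rw [hr] at c1
    rw [hr'] at c2
    simpa using c1.symm.trans c2
  have hee : e = fun j => e' (j.cast hlen) := by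
    refine (StrictMono.range_inj hmono (fun j k hjk => hmono' hjk)).1 ?_
    rw [hr, ← hr']
    ext t
    constructor
    · rintro ⟨j, rfl⟩
      exact ⟨j.cast hlen.symm, rfl⟩
    · rintro ⟨j, rfl⟩
      exact ⟨j.cast hlen, rfl⟩
  refine List.ext_get hlen fun k hk hk' => ?_
  obtain ⟨a, b, hm, ht⟩ := hl ⟨k, hk⟩
  obtain ⟨a', b', hm', ht'⟩ := hl' ⟨k, hk'⟩
  rw [hee] at hm
  exact ht.unique ht' hm hm'

theorem MemM.injOn_nhds {n m : ℕ} [NeZero n] [NeZero m] {f : Wedge n → Wedge m} (hf : MemM f)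
    (i : Fin n) {t : ℝ} (ht : t ∈ Ioo (0 : ℝ) 1) (hne : f (Wedge.loop i t) ≠ Wedge.base m) :
    ∃ U ∈ 𝓝 t, InjOn (fun s => f (Wedge.loop i s)) U := by
  have hnc : ¬ IsCriticalPoint f (Wedge.loop i t) := fun h =>
    hne (hf.criticalValue _ ⟨_, h, rfl⟩)
  simp only [IsCriticalPoint, not_forall, not_not] at hnc
  obtain ⟨U, hU, hUi⟩ := hnc
  refine ⟨Wedge.loop i ⁻¹' U ∩ Ioo 0 1,
    inter_mem ((Wedge.continuous_loop i).continuousAt hU) (Ioo_mem_nhds ht.1 ht.2),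
    fun a ha b hb hab => ?_⟩
  exact (Wedge.loop_inj ha.2 hb.2 (hUi ha.1 hb.1 hab)).2

/-- Every map in `𝓜_{n,m}` follows exactly one pattern. -/
theorem MemM.existsUnique_followsPattern {n m : ℕ} [NeZero n] [NeZero m]
    {f : Wedge n → Wedge m} (hf : MemM f) : ∃! χ : Substitution n m, FollowsPattern f χ := by
  have hex : ∀ i, ∃ w, TracesWord f i w := fun i =>
    exists_pathTracesWord (g := fun t => f (Wedge.loop i t))
      (hf.continuous.comp (Wedge.continuous_loop i))
      (by simp only [Wedge.loop_zero, hf.map_base]) (by simp only [Wedge.loop_one, hf.map_base])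
      fun t ht hne => hf.injOn_nhds i ht hne
  choose w hw using hex
  have hne : ∀ i, w i ≠ [] := by
    intro i hwi
    obtain ⟨u, v, -, -, h3, -⟩ := hw i
    refine hf.nonconstant i ⟨Wedge.base m, ?_⟩
    rintro - ⟨z, rfl⟩
    by_contra hcon
    have hz : f (Wedge.loop i (Wedge.coord z)) ≠ Wedge.base m := by
      rwa [Wedge.loop, Wedge.coe_coord]
    obtain ⟨j, -⟩ := (h3 _ ⟨(Wedge.coord_mem z).1, (Wedge.coord_mem z).2.le⟩).1 hz
    have := j.2
    simp [hwi] at this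
  have hbb : ∀ v : List (Letter m), barWord (barWord v) = v := by
    intro v
    simp [barWord, List.map_reverse, Function.comp_def, Letter.bar]
  refine ⟨⟨fun x => if x.2 = true then w x.1 else barWord (w x.1), ?_, ?_⟩, ?_, ?_⟩
  · rintro ⟨i, _ | _⟩
    · simpa [barWord] using hne i
    · simpa using hne i
  · rintro ⟨i, _ | _⟩
    · simp [Letter.bar, hbb]
    · simp [Letter.bar]
  · intro i
    exact hw i
  · rintro ⟨on, hnil, hbar⟩ hχ
    have htrue : ∀ i, on (i, true) = w i := fun i => PathTracesWord.unique (hχ i) (hw i)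
    have : on = fun x => if x.2 = true then w x.1 else barWord (w x.1) := by
      funext x
      obtain ⟨i, _ | _⟩ := x
      · have := hbar (i, true)
        simpa [Letter.bar, htrue] using this
      · simpa using htrue i
    subst this
    rfl

/-- The substitution `χ_f` associated with a map `f` in `𝓜_{n,m}`: the unique pattern that `f`
follows. -/
noncomputable def MemM.chi {n m : ℕ} [NeZero n] [NeZero m] {f : Wedge n → Wedge m}
    (hf : MemM f) : Substitution n m :=
  hf.existsUnique_followsPattern.choose

/-- The branch point is distinguished for `f`: either `f` folds at `b`, or the eventual range of
its action on edge germs does not have exactly two elements. -/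
def MemM.IsDistinguished {n : ℕ} [NeZero n] {f : Wedge n → Wedge n} (hf : MemM f) : Prop :=
  hf.chi.Folds ∨ hf.chi.eventualRange.ncard ≠ 2

/-! ### Inverse limits -/

/-- The inverse limit of `f`, with the topology inherited from the product. -/
def InverseLimit {X : Type*} (f : X → X) : Type _ := {x : ℕ → X // ∀ k, f (x (k + 1)) = x k}

instance {X : Type*} [TopologicalSpace X] (f : X → X) : TopologicalSpace (InverseLimit f) :=
  inferInstanceAs (TopologicalSpace {x : ℕ → X // ∀ k, f (x (k + 1)) = x k})

/-!
Every map `f` in the class is, up to a monotone change of parameter on each circle, the linear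
model `linMap χ` of its substitution `χ`: the map that runs along the word `χ x` with constant
speed while its argument runs along the letter `x` (`FollowsPattern.factorsThrough`). Changes of
parameter can be moved past linear models and are limits of homeomorphisms, so that the inverse
limit depends on the substitutions only (`FactorsThrough.seqLimit_homeomorph`).

*A weak equivalence yields a homeomorphism.* The inverse limit of `f` is that of any sequence of
powers of `f`. Since `σᵢ ∘ τᵢ` and `τᵢ ∘ σᵢ₊₁` are powers of the two substitutions, the inverse limit
of the alternating sequence of the linear models of `σᵢ` and `τᵢ` can be read in two ways, as the
one of `f` and as the one of `g` (`nonempty_homeomorph_of_weaklyEquivalent`).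

*A homeomorphism maps the base point to the base point.* If `b` is distinguished, the point
`(b, b, …)` differs topologically from every point that has a coordinate other than `b`. Around a
point of the latter kind, connected sets project injectively into an open arc
(`InverseLimit.injOn_val`). If at least three germs survive, then `(b, b, …)` is the center of a
triod (`InverseLimit.map_basePoint_of_two_lt`). If `f` folds at `b`, then there are arcs whose ends
converge to one point `p` while an intermediate point converges to `(b, b, …) ≠ p`; in a coordinate
arc the intermediate point would be squeezed between the ends
(`InverseLimit.map_basePoint_of_folds`). If a single germ survives, then `f` folds
(`Substitution.folds_of_eventualRange_eq_singleton`).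

*A homeomorphism that respects the base points yields a weak equivalence.* Let `h` be such a
homeomorphism. A path that runs along a letter `x` at a high level `k` of the source is mapped to a
path that, at a level `N` of the target, starts and ends near the base point, and reads a word
`τ x`: the sequence of the midpoints of circles that it crosses. Tautness (a path is locally
injective where it avoids the base point) makes this word the same for all such paths, since
uniformly close taut paths read the same word (`Reads.of_close`). The word maps obtained in this
way from `h` and from its inverse at alternating levels compose to powers of the two substitutions
(`weaklyEquivalent_of_homeomorph`).
-/

/-! ### The wedge as a metric space, and maps out of it -/

namespace Wedge

theorem incl_coord {n : ℕ} (x : Wedge n) : ∃ i z, x = loop i (coord z) := by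
  obtain ⟨i, z, rfl⟩ := exists_incl x
  exact ⟨i, z, by rw [loop, coe_coord]⟩

theorem exists_loop {n : ℕ} (x : Wedge n) : ∃ i, ∃ t ∈ Ico (0 : ℝ) 1, x = loop i t := by
  obtain ⟨i, z, rfl⟩ := incl_coord x
  exact ⟨i, _, coord_mem z, rfl⟩

theorem exists_loop_of_ne_base {n : ℕ} [NeZero n] {x : Wedge n} (hx : x ≠ base n) :
    ∃ i, ∃ t ∈ Ioo (0 : ℝ) 1, x = loop i t := by
  obtain ⟨i, t, ht, rfl⟩ := exists_loop x
  refine ⟨i, t, ⟨lt_of_le_of_ne ht.1 ?_, ht.2⟩, rfl⟩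
  rintro rfl
  exact hx (loop_zero i)

theorem proj_loop {n : ℕ} (l i : Fin n) (t : ℝ) :
    proj l (loop i t) = if i = l then (t : UnitAddCircle) else 0 := rfl

theorem coord_coe {t : ℝ} (ht : t ∈ Ico (0 : ℝ) 1) : coord (t : UnitAddCircle) = t :=
  (coe_eq_coe (coord_mem _) ht).1 (coe_coord _)

instance (n : ℕ) : CompactSpace (Wedge n) :=
  inferInstanceAs (CompactSpace (Quotient (wedgeSetoid n)))

/-- All the retractions onto the circles together. -/
def projAll {n : ℕ} (x : Wedge n) : Fin n → UnitAddCircle := fun l => proj l x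

theorem injective_projAll {n : ℕ} : Function.Injective (projAll (n := n)) := by
  intro x y h
  have h' : ∀ l, proj l x = proj l y := fun l => congrFun h l
  by_cases hx : ∃ l, proj l x ≠ 0
  · obtain ⟨l, hl⟩ := hx
    have hl' : proj l y ≠ 0 := h' l ▸ hl
    rw [eq_incl_of_proj_ne hl, eq_incl_of_proj_ne hl', h' l]
  · obtain ⟨i, z, rfl⟩ := exists_incl x
    have : NeZero n := ⟨fun h => by subst h; exact i.elim0⟩
    have e : ∀ w : Wedge n, (¬ ∃ l, proj l w ≠ 0) → w = base n := fun w hw => by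
      by_contra hne
      exact hw (exists_proj_ne hne)
    rw [e _ hx, e y (fun ⟨l, hl⟩ => hx ⟨l, (h' l).symm ▸ hl⟩)]

theorem continuous_projAll {n : ℕ} : Continuous (projAll (n := n)) :=
  continuous_pi fun l => continuous_proj l

theorem isEmbedding_projAll {n : ℕ} : IsEmbedding (projAll (n := n)) :=
  (continuous_projAll.isClosedEmbedding injective_projAll).isEmbedding

/-- The metric of the wedge as a subspace of the torus. -/
noncomputable instance (n : ℕ) : MetricSpace (Wedge n) :=
  (isEmbedding_projAll (n := n)).comapMetricSpace projAll

theorem dist_lt_iff {n : ℕ} {x y : Wedge n} {r : ℝ} (hr : 0 < r) :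
    dist x y < r ↔ ∀ l, dist (proj l x) (proj l y) < r :=
  dist_pi_lt_iff (f := projAll x) (g := projAll y) hr

/-- The map that is given by the path `p i` on the `i`-th circle. -/
noncomputable def lift {n : ℕ} {Y : Type*} (p : Fin n → ℝ → Y) (x : Wedge n) : Y :=
  p (Quotient.out x).1 (coord (Quotient.out x).2)

theorem coord_zero : coord 0 = 0 := by
  simpa using coord_coe (t := 0) (by simp)

theorem lift_incl {n : ℕ} {Y : Type*} {p : Fin n → ℝ → Y} {y : Y} (h0 : ∀ i, p i 0 = y)
    (i : Fin n) (z : UnitAddCircle) : lift p (incl i z) = p i (coord z) := by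
  have h : (wedgeSetoid n).r (Quotient.out (incl i z)) (i, z) :=
    Quotient.exact (s := wedgeSetoid n) (Quotient.out_eq _)
  rw [lift]
  rcases h with h | ⟨h, h'⟩
  · rw [h]
  · simp only at h'
    rw [h, h', coord_zero, h0, h0]

theorem lift_loop {n : ℕ} {Y : Type*} {p : Fin n → ℝ → Y} {y : Y} (h0 : ∀ i, p i 0 = y)
    (h1 : ∀ i, p i 1 = y) (i : Fin n) {t : ℝ} (ht : t ∈ Icc (0 : ℝ) 1) :
    lift p (loop i t) = p i t := by
  rw [loop, lift_incl h0]
  rcases ht.2.lt_or_eq with h | rfl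
  · rw [coord_coe ⟨ht.1, h⟩]
  · have h : ((1 : ℝ) : UnitAddCircle) = 0 := AddCircle.coe_period 1
    rw [h, coord_zero, h0, h1]

theorem continuous_lift {n : ℕ} {Y : Type*} [TopologicalSpace Y] {p : Fin n → ℝ → Y} {y : Y}
    (h0 : ∀ i, p i 0 = y) (h1 : ∀ i, p i 1 = y) (hp : ∀ i, Continuous (p i)) :
    Continuous (lift p) := by
  have hq : IsQuotientMap (Quotient.mk (wedgeSetoid n)) := isQuotientMap_quotient_mk'
  refine hq.continuous_iff.2 (continuous_prod_of_discrete_left.2 fun i => ?_)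
  refine (AddCircle.liftIco_continuous (p := (1 : ℝ)) (a := 0) (f := p i) ?_
    (hp i).continuousOn).congr fun z => (lift_incl h0 i z).symm
  rw [zero_add, h0, h1]

theorem ext_loop {n : ℕ} {Y : Type*} {F G : Wedge n → Y}
    (h : ∀ i, ∀ t ∈ Icc (0 : ℝ) 1, F (loop i t) = G (loop i t)) : F = G := by
  funext x
  obtain ⟨i, t, ht, rfl⟩ := exists_loop x
  exact h i t (Ico_subset_Icc_self ht)

/-- The circle of the letter `x`, run through in the direction of `x`. -/
def loopL {n : ℕ} (x : Letter n) (t : ℝ) : Wedge n := loop x.1 (if x.2 = true then t else 1 - t)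

theorem loopL_true {n : ℕ} (i : Fin n) (t : ℝ) : loopL (i, true) t = loop i t := by
  simp [loopL]

theorem loopL_bar {n : ℕ} (x : Letter n) (t : ℝ) : loopL x.bar t = loopL x (1 - t) := by
  obtain ⟨i, _ | _⟩ := x <;> simp [loopL, Letter.bar]

theorem continuous_loopL {n : ℕ} (x : Letter n) : Continuous (loopL x) := by
  refine (continuous_loop x.1).comp ?_
  split_ifs <;> fun_prop

theorem loopL_zero {n : ℕ} [NeZero n] (x : Letter n) : loopL x 0 = base n := by
  rw [loopL]
  split_ifs
  · exact loop_zero _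
  · simpa using loop_one x.1

theorem loopL_one {n : ℕ} [NeZero n] (x : Letter n) : loopL x 1 = base n := by
  rw [loopL]
  split_ifs
  · exact loop_one _
  · simpa using loop_zero x.1

theorem loopL_ne_base {n : ℕ} [NeZero n] {x : Letter n} {t : ℝ} (ht : t ∈ Ioo (0 : ℝ) 1) :
    loopL x t ≠ base n := by
  rw [loopL]
  split_ifs
  · exact loop_ne_base ht
  · exact loop_ne_base ⟨by linarith [ht.2], by linarith [ht.1]⟩

theorem loopL_inj {n : ℕ} {x : Letter n} {s t : ℝ} (hs : s ∈ Ioo (0 : ℝ) 1)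
    (ht : t ∈ Ioo (0 : ℝ) 1) (h : loopL x s = loopL x t) : s = t := by
  rw [loopL, loopL] at h
  split_ifs at h
  · exact (loop_inj hs ht h).2
  · have := (loop_inj ⟨by linarith [hs.2], by linarith [hs.1]⟩
      ⟨by linarith [ht.2], by linarith [ht.1]⟩ h).2
    linarith

end Wedge

theorem Letter.bar_bar {n : ℕ} (x : Letter n) : x.bar.bar = x := by
  simp [Letter.bar]

theorem barWord_append {n : ℕ} (v w : List (Letter n)) :
    barWord (v ++ w) = barWord w ++ barWord v := by
  simp [barWord]

theorem barWord_cons {n : ℕ} (x : Letter n) (w : List (Letter n)) :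
    barWord (x :: w) = barWord w ++ [x.bar] := by
  simp [barWord]

theorem length_barWord {n : ℕ} (w : List (Letter n)) : (barWord w).length = w.length := by
  simp [barWord]

/-! ### Paths that spell a word -/

/-- The retraction of the line onto `[0, 1]`. -/
noncomputable def clamp (t : ℝ) : ℝ := max 0 (min 1 t)

theorem clamp_mem (t : ℝ) : clamp t ∈ Icc (0 : ℝ) 1 :=
  ⟨le_max_left _ _, max_le zero_le_one (min_le_left _ _)⟩

theorem clamp_of_mem {t : ℝ} (ht : t ∈ Icc (0 : ℝ) 1) : clamp t = t := by
  rw [clamp, min_eq_right ht.2, max_eq_right ht.1]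

theorem clamp_of_le {t : ℝ} (ht : t ≤ 0) : clamp t = 0 :=
  max_eq_left ((min_le_right _ _).trans ht)

theorem clamp_of_ge {t : ℝ} (ht : 1 ≤ t) : clamp t = 1 := by
  rw [clamp, min_eq_left ht, max_eq_right zero_le_one]

theorem continuous_clamp : Continuous clamp := by
  unfold clamp
  fun_prop

theorem monotone_clamp : Monotone clamp := fun _ _ h => max_le_max le_rfl (min_le_min le_rfl h)

/-- The path that runs through the letters of a word with unit speed, the `j`-th letter during
`[j, j + 1]`; it rests at the base point before and after. -/
noncomputable def wordPath {n : ℕ} [NeZero n] : List (Letter n) → ℝ → Wedge n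
  | [], _ => Wedge.base n
  | x :: w, s => if s ≤ 1 then Wedge.loopL x (clamp s) else wordPath w (s - 1)

section wordPath

variable {n : ℕ} [NeZero n]

theorem wordPath_of_nonpos (w : List (Letter n)) {s : ℝ} (hs : s ≤ 0) :
    wordPath w s = Wedge.base n := by
  cases w with
  | nil => rfl
  | cons x w => rw [wordPath, if_pos (hs.trans zero_le_one), clamp_of_le hs, Wedge.loopL_zero]

theorem wordPath_cons_of_le (x : Letter n) (w : List (Letter n)) {s : ℝ} (hs : s ≤ 1) :
    wordPath (x :: w) s = Wedge.loopL x (clamp s) := by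
  rw [wordPath, if_pos hs]

theorem wordPath_cons_of_ge (x : Letter n) (w : List (Letter n)) {s : ℝ} (hs : 1 ≤ s) :
    wordPath (x :: w) s = wordPath w (s - 1) := by
  rcases hs.lt_or_eq with h | rfl
  · rw [wordPath, if_neg (not_le.2 h)]
  · rw [wordPath, if_pos le_rfl, clamp_of_ge le_rfl, Wedge.loopL_one, sub_self,
      wordPath_of_nonpos _ le_rfl]

theorem continuous_wordPath (w : List (Letter n)) : Continuous (wordPath w) := by
  induction w with
  | nil => exact continuous_const
  | cons x w ih =>
    refine Continuous.if_le ((Wedge.continuous_loopL x).comp continuous_clamp)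
      (ih.comp (by fun_prop)) continuous_id continuous_const ?_
    rintro s rfl
    rw [sub_self, wordPath_of_nonpos _ le_rfl]
    exact (congrArg _ (clamp_of_ge le_rfl)).trans (Wedge.loopL_one x)

theorem wordPath_append_of_le (v w : List (Letter n)) {s : ℝ} (hs : s ≤ v.length) :
    wordPath (v ++ w) s = wordPath v s := by
  induction v generalizing s with
  | nil => exact wordPath_of_nonpos w (by simpa using hs)
  | cons x v ih =>
    rw [List.cons_append, wordPath, wordPath]
    refine if_congr Iff.rfl rfl (ih ?_)
    rw [List.length_cons] at hs
    push_cast at hs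
    linarith

theorem wordPath_append_of_ge (v w : List (Letter n)) {s : ℝ} (hs : v.length ≤ s) :
    wordPath (v ++ w) s = wordPath w (s - v.length) := by
  induction v generalizing s with
  | nil => simp
  | cons x v ih =>
    rw [List.length_cons] at hs ⊢
    push_cast at hs ⊢
    have h0 : (0 : ℝ) ≤ v.length := Nat.cast_nonneg _
    rw [List.cons_append, wordPath_cons_of_ge _ _ (by linarith), ih (by linarith)]
    congr 1
    ring

theorem wordPath_of_length_le (w : List (Letter n)) {s : ℝ} (hs : w.length ≤ s) :
    wordPath w s = Wedge.base n := by
  have := wordPath_append_of_ge w [] hs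
  simpa [wordPath] using this

theorem wordPath_singleton (x : Letter n) {s : ℝ} (hs : s ∈ Icc (0 : ℝ) 1) :
    wordPath [x] s = Wedge.loopL x s := by
  rw [wordPath_cons_of_le _ _ hs.2, clamp_of_mem hs]

theorem wordPath_barWord (w : List (Letter n)) (s : ℝ) :
    wordPath (barWord w) s = wordPath w (w.length - s) := by
  induction w generalizing s with
  | nil => rfl
  | cons x w ih =>
    rw [barWord_cons, List.length_cons]
    push_cast
    rcases le_total s w.length with h | h
    · rw [wordPath_append_of_le _ _ (by rwa [length_barWord]), ih,
        wordPath_cons_of_ge _ _ (by linarith)]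
      congr 1
      ring
    · rw [wordPath_append_of_ge _ _ (by rwa [length_barWord]), length_barWord,
        wordPath_cons_of_le x w (by linarith)]
      rcases le_total s (w.length + 1) with h' | h'
      · rw [wordPath_singleton _ ⟨by linarith, by linarith⟩, Wedge.loopL_bar,
          clamp_of_mem ⟨by linarith, by linarith⟩]
        congr 1
        ring
      · rw [wordPath_of_length_le _ (by simp; linarith), clamp_of_le (by linarith),
          Wedge.loopL_zero]

theorem wordPath_natCast (w : List (Letter n)) (j : ℕ) : wordPath w j = Wedge.base n := by
  induction w generalizing j with
  | nil => rfl
  | cons x w ih =>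
    rcases Nat.eq_zero_or_pos j with rfl | hj
    · exact wordPath_of_nonpos _ (by simp)
    · rw [wordPath_cons_of_ge _ _ (by exact_mod_cast hj)]
      have := ih (j - 1)
      rwa [Nat.cast_sub hj, Nat.cast_one] at this

theorem wordPath_get (w : List (Letter n)) (j : Fin w.length) {r : ℝ} (hr : r ∈ Icc (0 : ℝ) 1) :
    wordPath w (j + r) = Wedge.loopL (w.get j) r := by
  induction w with
  | nil => exact j.elim0
  | cons x w ih =>
    refine Fin.cases ?_ (fun j => ?_) j
    · simp only [Fin.val_zero, Nat.cast_zero, zero_add]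
      rw [wordPath_cons_of_le _ _ hr.2, clamp_of_mem hr]
      rfl
    · have hj : (0 : ℝ) ≤ (j : ℕ) := Nat.cast_nonneg _
      rw [Fin.val_succ, wordPath_cons_of_ge _ _ (by push_cast; linarith [hr.1])]
      have := ih j
      have e : (x :: w).get j.succ = w.get j := rfl
      rw [e, ← this]
      congr 1
      push_cast
      ring

end wordPath

/-! ### Monotone changes of parameter along words -/

/-- The sum of the functions `ℓ x`, each on `[0, 1]`, along the letters of a word. -/
noncomputable def stair {n : ℕ} (ℓ : Letter n → ℝ → ℝ) : List (Letter n) → ℝ → ℝ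
  | [], _ => 0
  | x :: w, s => ℓ x (clamp s) + stair ℓ w (s - 1)

section stair

variable {n : ℕ} {ℓ : Letter n → ℝ → ℝ}

theorem stair_of_nonpos (h0 : ∀ x, ℓ x 0 = 0) (w : List (Letter n)) {s : ℝ} (hs : s ≤ 0) :
    stair ℓ w s = 0 := by
  induction w generalizing s with
  | nil => rfl
  | cons x w ih => rw [stair, clamp_of_le hs, h0, ih (by linarith), add_zero]

theorem stair_cons_of_le (h0 : ∀ x, ℓ x 0 = 0) (x : Letter n) (w : List (Letter n)) {s : ℝ}
    (hs : s ≤ 1) : stair ℓ (x :: w) s = ℓ x (clamp s) := by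
  rw [stair, stair_of_nonpos h0 w (by linarith), add_zero]

theorem stair_cons_of_ge (x : Letter n) (w : List (Letter n)) {s : ℝ} (hs : 1 ≤ s) :
    stair ℓ (x :: w) s = ℓ x 1 + stair ℓ w (s - 1) := by
  rw [stair, clamp_of_ge hs]

theorem continuous_stair (hc : ∀ x, Continuous (ℓ x)) (w : List (Letter n)) :
    Continuous (stair ℓ w) := by
  induction w with
  | nil => exact continuous_const
  | cons x w ih =>
    exact ((hc x).comp continuous_clamp).add (ih.comp (by fun_prop))

theorem monotone_stair (hm : ∀ x, Monotone (ℓ x)) (w : List (Letter n)) :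
    Monotone (stair ℓ w) := by
  induction w with
  | nil => exact monotone_const
  | cons x w ih =>
    intro s t hst
    exact add_le_add (hm x (monotone_clamp hst)) (ih (by linarith))

theorem stair_length (w : List (Letter n)) :
    stair ℓ w w.length = (w.map fun x => ℓ x 1).sum := by
  induction w with
  | nil => simp [stair]
  | cons x w ih =>
    have h0 : (0 : ℝ) ≤ w.length := Nat.cast_nonneg _
    rw [List.length_cons, stair_cons_of_ge _ _ (by push_cast; linarith)]
    simp [ih]

theorem strictMonoOn_stair (hm : ∀ x, Monotone (ℓ x)) (hs : ∀ x, StrictMonoOn (ℓ x) (Icc 0 1))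
    (w : List (Letter n)) : StrictMonoOn (stair ℓ w) (Icc 0 w.length) := by
  induction w with
  | nil =>
    intro s hs t ht hst
    have h1 := hs.1
    have h2 := ht.2
    simp at h2
    linarith
  | cons x w ih =>
    intro s hs' t ht hst
    rw [stair, stair]
    rcases lt_or_ge s 1 with h | h
    · refine add_lt_add_of_lt_of_le (hs x (clamp_mem _) (clamp_mem _) ?_)
        (monotone_stair hm w (by linarith))
      rw [clamp_of_mem ⟨hs'.1, h.le⟩, clamp]
      exact lt_max_of_lt_right (lt_min h hst)
    · refine add_lt_add_of_le_of_lt (hm x (monotone_clamp hst.le)) (ih ?_ ?_ (by linarith))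
      · have := hs'.2
        simp at this
        exact ⟨by linarith, by linarith⟩
      · have := ht.2
        simp at this
        exact ⟨by linarith, by linarith⟩

end stair

/-! ### The linear model of a substitution -/

namespace Substitution

variable {k n m : ℕ}

theorem ext_onLetter {σ τ : Substitution n m} (h : ∀ x, σ.onLetter x = τ.onLetter x) : σ = τ := by
  cases σ
  cases τ
  congr
  exact funext h

theorem onWord_cons (σ : Substitution n m) (x : Letter n) (w : List (Letter n)) :
    σ.onWord (x :: w) = σ.onLetter x ++ σ.onWord w := rfl

theorem onWord_append (σ : Substitution n m) (v w : List (Letter n)) :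
    σ.onWord (v ++ w) = σ.onWord v ++ σ.onWord w := by
  simp [onWord]

theorem onWord_singleton (σ : Substitution n m) (x : Letter n) :
    σ.onWord [x] = σ.onLetter x := by
  simp [onWord]

theorem onWord_barWord (σ : Substitution n m) (w : List (Letter n)) :
    σ.onWord (barWord w) = barWord (σ.onWord w) := by
  induction w with
  | nil => rfl
  | cons x w ih =>
    rw [barWord_cons, onWord_append, ih, onWord_singleton, map_bar, onWord_cons, barWord_append]

theorem onWord_ne_nil (σ : Substitution n m) {w : List (Letter n)} (hw : w ≠ []) :
    σ.onWord w ≠ [] := by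
  cases w with
  | nil => exact absurd rfl hw
  | cons x w => simp [onWord_cons, σ.ne_nil x]

/-- The composition of substitutions. -/
def comp (σ : Substitution n m) (τ : Substitution k n) : Substitution k m where
  onLetter x := σ.onWord (τ.onLetter x)
  ne_nil x := σ.onWord_ne_nil (τ.ne_nil x)
  map_bar x := by rw [τ.map_bar, onWord_barWord]

theorem onWord_comp (σ : Substitution n m) (τ : Substitution k n) (w : List (Letter k)) :
    (σ.comp τ).onWord w = σ.onWord (τ.onWord w) := by
  induction w with
  | nil => rfl
  | cons x w ih => rw [onWord_cons, ih, onWord_cons, onWord_append]; rfl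

/-- The identity substitution. -/
protected def id (n : ℕ) : Substitution n n where
  onLetter x := [x]
  ne_nil x := List.cons_ne_nil _ _
  map_bar x := by simp [barWord]

theorem onWord_id (w : List (Letter n)) : (Substitution.id n).onWord w = w := by
  simp [onWord, Substitution.id]

/-- The powers of a substitution. -/
def iter (χ : Substitution n n) : ℕ → Substitution n n
  | 0 => Substitution.id n
  | N + 1 => (χ.iter N).comp χ

theorem onWord_iter (χ : Substitution n n) (N : ℕ) (w : List (Letter n)) :
    (χ.iter N).onWord w = χ.onWord^[N] w := by
  induction N generalizing w with
  | zero => exact onWord_id w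
  | succ N ih => rw [iter, onWord_comp, ih, Function.iterate_succ_apply]

end Substitution

/-- A monotone reparametrization of `[0, 1]`, extended to the line. -/
structure IsReparam (μ : ℝ → ℝ) : Prop where
  mono : Monotone μ
  cont : Continuous μ
  zero : μ 0 = 0
  one : μ 1 = 1

theorem IsReparam.mem_Icc {μ : ℝ → ℝ} (h : IsReparam μ) {t : ℝ} (ht : t ∈ Icc (0 : ℝ) 1) :
    μ t ∈ Icc (0 : ℝ) 1 :=
  ⟨h.zero ▸ h.mono ht.1, h.one ▸ h.mono ht.2⟩

theorem isReparam_id : IsReparam id := ⟨monotone_id, continuous_id, rfl, rfl⟩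

theorem IsReparam.comp {μ ν : ℝ → ℝ} (hμ : IsReparam μ) (hν : IsReparam ν) :
    IsReparam (μ ∘ ν) :=
  ⟨hμ.mono.comp hν.mono, hμ.cont.comp hν.cont, by simp [hμ.zero, hν.zero],
    by simp [hμ.one, hν.one]⟩

/-- A sum along a word, rescaled to `[0, 1]` in the domain and in the range. -/
noncomputable def normStair {n : ℕ} (ℓ : Letter n → ℝ → ℝ) (w : List (Letter n)) (s : ℝ) : ℝ :=
  stair ℓ w (w.length * s) / stair ℓ w w.length

theorem isReparam_normStair {n : ℕ} {ℓ : Letter n → ℝ → ℝ} {w : List (Letter n)}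
    (h0 : ∀ x, ℓ x 0 = 0) (hc : ∀ x, Continuous (ℓ x)) (hm : ∀ x, Monotone (ℓ x))
    (hpos : 0 < stair ℓ w w.length) : IsReparam (normStair ℓ w) where
  mono s t hst := div_le_div_of_nonneg_right
    (monotone_stair hm w (mul_le_mul_of_nonneg_left hst (Nat.cast_nonneg _))) hpos.le
  cont := ((continuous_stair hc w).comp (by fun_prop)).div_const _
  zero := by rw [normStair, mul_zero, stair_of_nonpos h0 w le_rfl, zero_div]
  one := by rw [normStair, mul_one, div_self hpos.ne']

section models

set_option linter.unusedSectionVars false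

variable {k n m : ℕ} [NeZero k] [NeZero n] [NeZero m]

/-- The map of wedges that runs with constant speed along `χ(a_i)` on the `i`-th circle. -/
noncomputable def linMap (χ : Substitution n m) : Wedge n → Wedge m :=
  Wedge.lift fun i s => wordPath (χ.onLetter (i, true)) ((χ.onLetter (i, true)).length * s)

theorem linMap_loop (χ : Substitution n m) (i : Fin n) {t : ℝ} (ht : t ∈ Icc (0 : ℝ) 1) :
    linMap χ (Wedge.loop i t) =
      wordPath (χ.onLetter (i, true)) ((χ.onLetter (i, true)).length * t) :=
  Wedge.lift_loop
    (p := fun i s => wordPath (χ.onLetter (i, true)) ((χ.onLetter (i, true)).length * s))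
    (fun i => wordPath_of_nonpos _ (by simp)) (fun i => wordPath_of_length_le _ (by simp)) i ht

theorem continuous_linMap (χ : Substitution n m) : Continuous (linMap χ) :=
  Wedge.continuous_lift (fun i => wordPath_of_nonpos _ (by simp))
    (fun i => wordPath_of_length_le _ (by simp))
    fun i => (continuous_wordPath _).comp (by fun_prop)

theorem linMap_base (χ : Substitution n m) : linMap χ (Wedge.base n) = Wedge.base m := by
  rw [← Wedge.loop_zero 0, linMap_loop χ 0 (by simp), wordPath_of_nonpos _ (by simp)]

theorem linMap_loopL (χ : Substitution n m) (x : Letter n) {t : ℝ} (ht : t ∈ Icc (0 : ℝ) 1) :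
    linMap χ (Wedge.loopL x t) = wordPath (χ.onLetter x) ((χ.onLetter x).length * t) := by
  obtain ⟨i, _ | _⟩ := x
  · have h1 : χ.onLetter (i, false) = barWord (χ.onLetter (i, true)) := χ.map_bar (i, true)
    have h2 : Wedge.loopL (i, false) t = Wedge.loop i (1 - t) := by simp [Wedge.loopL]
    rw [h1, h2, linMap_loop χ i ⟨by linarith [ht.2], by linarith [ht.1]⟩, wordPath_barWord,
      length_barWord]
    congr 1
    ring
  · rw [Wedge.loopL_true, linMap_loop χ i ht]

/-- On a letter `x`, the factor by which `χ` increases the length. -/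
def stretch (χ : Substitution n m) (x : Letter n) (r : ℝ) : ℝ := (χ.onLetter x).length * r

theorem stretch_pos (χ : Substitution n m) (x : Letter n) : (0 : ℝ) < (χ.onLetter x).length := by
  exact_mod_cast List.length_pos_of_ne_nil (χ.ne_nil x)

theorem monotone_stretch (χ : Substitution n m) (x : Letter n) : Monotone (stretch χ x) :=
  fun _ _ h => mul_le_mul_of_nonneg_left h (Nat.cast_nonneg _)

theorem continuous_stretch (χ : Substitution n m) (x : Letter n) : Continuous (stretch χ x) :=
  continuous_const.mul continuous_id

theorem stretch_zero (χ : Substitution n m) (x : Letter n) : stretch χ x 0 = 0 := mul_zero _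

theorem stair_stretch_length (χ : Substitution n m) (w : List (Letter n)) :
    stair (stretch χ) w w.length = (χ.onWord w).length := by
  induction w with
  | nil => simp [stair, Substitution.onWord]
  | cons x w ih =>
    have h0 : (0 : ℝ) ≤ w.length := Nat.cast_nonneg _
    rw [Substitution.onWord_cons, List.length_cons, stair_cons_of_ge _ _ (by push_cast; linarith),
      List.length_append]
    push_cast
    rw [add_sub_cancel_right, ih, stretch, mul_one]

theorem linMap_wordPath (χ : Substitution n m) (w : List (Letter n)) (s : ℝ) :
    linMap χ (wordPath w s) = wordPath (χ.onWord w) (stair (stretch χ) w s) := by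
  induction w generalizing s with
  | nil => exact linMap_base χ
  | cons x w ih =>
    rw [Substitution.onWord_cons]
    rcases le_total s 1 with h | h
    · rw [wordPath_cons_of_le _ _ h, stair_cons_of_le (stretch_zero χ) _ _ h,
        linMap_loopL _ _ (clamp_mem s), wordPath_append_of_le]
      · rfl
      · exact mul_le_of_le_one_right (Nat.cast_nonneg _) (clamp_mem s).2
    · rw [wordPath_cons_of_ge _ _ h, stair_cons_of_ge _ _ h, ih, stretch, mul_one,
        wordPath_append_of_ge, add_sub_cancel_left]
      refine le_add_of_nonneg_right ?_
      rw [← stair_of_nonpos (stretch_zero χ) w le_rfl]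
      exact monotone_stair (monotone_stretch χ) w (by linarith)

/-- The self-map of the wedge that reparametrizes the `i`-th circle by `μ i`. -/
noncomputable def reparamMap (μ : Fin n → ℝ → ℝ) : Wedge n → Wedge n :=
  Wedge.lift fun i s => Wedge.loop i (μ i s)

theorem reparamMap_loop {μ : Fin n → ℝ → ℝ} (hμ : ∀ i, IsReparam (μ i)) (i : Fin n) {t : ℝ}
    (ht : t ∈ Icc (0 : ℝ) 1) : reparamMap μ (Wedge.loop i t) = Wedge.loop i (μ i t) :=
  Wedge.lift_loop (p := fun i s => Wedge.loop i (μ i s))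
    (fun i => by rw [(hμ i).zero, Wedge.loop_zero])
    (fun i => by rw [(hμ i).one, Wedge.loop_one]) i ht

theorem continuous_reparamMap {μ : Fin n → ℝ → ℝ} (hμ : ∀ i, IsReparam (μ i)) :
    Continuous (reparamMap μ) :=
  Wedge.continuous_lift (fun i => by rw [(hμ i).zero, Wedge.loop_zero])
    (fun i => by rw [(hμ i).one, Wedge.loop_one])
    fun i => (Wedge.continuous_loop i).comp (hμ i).cont

theorem reparamMap_base {μ : Fin n → ℝ → ℝ} (hμ : ∀ i, IsReparam (μ i)) :
    reparamMap μ (Wedge.base n) = Wedge.base n := by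
  rw [← Wedge.loop_zero 0, reparamMap_loop hμ 0 (by simp), (hμ 0).zero]

theorem reparamMap_comp {μ ν : Fin n → ℝ → ℝ} (hμ : ∀ i, IsReparam (μ i))
    (hν : ∀ i, IsReparam (ν i)) :
    reparamMap μ ∘ reparamMap ν = reparamMap fun i => μ i ∘ ν i :=
  Wedge.ext_loop fun i t ht => by
    rw [Function.comp_apply, reparamMap_loop hν i ht, reparamMap_loop hμ i ((hν i).mem_Icc ht),
      reparamMap_loop (fun i => (hμ i).comp (hν i)) i ht]
    rfl

theorem reparamMap_id : reparamMap (n := n) (fun _ => id) = id :=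
  Wedge.ext_loop fun i t ht => by
    rw [reparamMap_loop (fun _ => isReparam_id) i ht]
    rfl

/-- The reparametrization of a letter by a reparametrization of its circle. -/
noncomputable def orient (μ : Fin n → ℝ → ℝ) (x : Letter n) (r : ℝ) : ℝ :=
  if x.2 = true then μ x.1 r else 1 - μ x.1 (1 - r)

theorem isReparam_orient {μ : Fin n → ℝ → ℝ} (hμ : ∀ i, IsReparam (μ i)) (x : Letter n) :
    IsReparam (orient μ x) := by
  obtain ⟨i, _ | _⟩ := x
  · have h : orient μ (i, false) = fun r => 1 - μ i (1 - r) := by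
      funext r
      simp [orient]
    rw [h]
    refine ⟨fun s t hst => ?_, ?_, ?_, ?_⟩
    · have := (hμ i).mono (show 1 - t ≤ 1 - s by linarith)
      show 1 - μ i (1 - s) ≤ 1 - μ i (1 - t)
      linarith
    · exact continuous_const.sub ((hμ i).cont.comp (by fun_prop))
    · simp [(hμ i).one]
    · simp [(hμ i).zero]
  · have h : orient μ (i, true) = μ i := by
      funext r
      simp [orient]
    rw [h]
    exact hμ i

theorem reparamMap_loopL {μ : Fin n → ℝ → ℝ} (hμ : ∀ i, IsReparam (μ i)) (x : Letter n) {t : ℝ}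
    (ht : t ∈ Icc (0 : ℝ) 1) :
    reparamMap μ (Wedge.loopL x t) = Wedge.loopL x (orient μ x t) := by
  obtain ⟨i, _ | _⟩ := x
  · have h2 : ∀ s, Wedge.loopL (i, false) s = Wedge.loop i (1 - s) := by simp [Wedge.loopL]
    rw [h2, h2, reparamMap_loop hμ i ⟨by linarith [ht.2], by linarith [ht.1]⟩]
    simp [orient]
  · rw [Wedge.loopL_true, Wedge.loopL_true, reparamMap_loop hμ i ht]
    simp [orient]

theorem reparamMap_wordPath {μ : Fin n → ℝ → ℝ} (hμ : ∀ i, IsReparam (μ i))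
    (w : List (Letter n)) (s : ℝ) :
    reparamMap μ (wordPath w s) = wordPath w (stair (orient μ) w s) := by
  have hμ' := isReparam_orient hμ
  induction w generalizing s with
  | nil => exact reparamMap_base hμ
  | cons x w ih =>
    rcases le_total s 1 with h | h
    · rw [wordPath_cons_of_le _ _ h, stair_cons_of_le (fun x => (hμ' x).zero) _ _ h,
        reparamMap_loopL hμ _ (clamp_mem s)]
      have := (hμ' x).mem_Icc (clamp_mem s)
      rw [wordPath_cons_of_le _ _ this.2, clamp_of_mem this]
    · rw [wordPath_cons_of_ge _ _ h, stair_cons_of_ge _ _ h, ih, (hμ' x).one,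
        wordPath_cons_of_ge, add_sub_cancel_left]
      refine le_add_of_nonneg_right ?_
      rw [← stair_of_nonpos (fun x => (hμ' x).zero) w le_rfl]
      exact monotone_stair (fun x => (hμ' x).mono) w (by linarith)

/-- Reparametrizations of the target lift through the linear model. -/
theorem exists_reparamMap_comp_linMap (χ : Substitution n m) {μ : Fin m → ℝ → ℝ}
    (hμ : ∀ i, IsReparam (μ i)) : ∃ ν : Fin n → ℝ → ℝ, (∀ i, IsReparam (ν i)) ∧
      reparamMap μ ∘ linMap χ = linMap χ ∘ reparamMap ν := by
  have hμ' := isReparam_orient hμ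
  have hlen : ∀ w : List (Letter m), stair (orient μ) w w.length = w.length := by
    intro w
    rw [stair_length]
    simp [(hμ' _).one]
  have hpos := fun i => stretch_pos χ (i, true)
  have hν : ∀ i, IsReparam (normStair (orient μ) (χ.onLetter (i, true))) := fun i =>
    isReparam_normStair (fun x => (hμ' x).zero) (fun x => (hμ' x).cont) (fun x => (hμ' x).mono)
      (by rw [hlen]; exact hpos i)
  refine ⟨fun i => normStair (orient μ) (χ.onLetter (i, true)), hν,
    Wedge.ext_loop fun i t ht => ?_⟩
  rw [Function.comp_apply, Function.comp_apply, linMap_loop χ i ht, reparamMap_wordPath hμ,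
    reparamMap_loop hν i ht, linMap_loop χ i ((hν i).mem_Icc ht), normStair, hlen,
    mul_div_cancel₀ _ (hpos i).ne']

/-- The composition of linear models is a linear model up to a change of parameter. -/
theorem exists_linMap_comp_linMap (σ : Substitution n m) (τ : Substitution k n) :
    ∃ ν : Fin k → ℝ → ℝ, (∀ i, IsReparam (ν i)) ∧
      linMap σ ∘ linMap τ = linMap (σ.comp τ) ∘ reparamMap ν := by
  have hpos : ∀ i, 0 < stair (stretch σ) (τ.onLetter (i, true)) (τ.onLetter (i, true)).length := by
    intro i
    rw [stair_stretch_length]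
    exact stretch_pos (σ.comp τ) (i, true)
  have hν : ∀ i, IsReparam (normStair (stretch σ) (τ.onLetter (i, true))) := fun i =>
    isReparam_normStair (stretch_zero σ) (continuous_stretch σ) (monotone_stretch σ) (hpos i)
  refine ⟨fun i => normStair (stretch σ) (τ.onLetter (i, true)), hν,
    Wedge.ext_loop fun i t ht => ?_⟩
  have e : (σ.comp τ).onLetter (i, true) = σ.onWord (τ.onLetter (i, true)) := rfl
  rw [Function.comp_apply, Function.comp_apply, linMap_loop τ i ht, linMap_wordPath,
    reparamMap_loop hν i ht, linMap_loop _ i ((hν i).mem_Icc ht), normStair, e,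
    ← stair_stretch_length, mul_div_cancel₀ _ (hpos i).ne']

/-! ### Maps that follow a pattern factor through its linear model -/

/-- The map `F` is the linear model of `χ` after a monotone change of parameter on each circle. -/
def FactorsThrough (F : Wedge n → Wedge m) (χ : Substitution n m) : Prop :=
  ∃ μ : Fin n → ℝ → ℝ, (∀ i, IsReparam (μ i)) ∧ F = linMap χ ∘ reparamMap μ

theorem factorsThrough_linMap (χ : Substitution n m) : FactorsThrough (linMap χ) χ :=
  ⟨fun _ => id, fun _ => isReparam_id, by rw [reparamMap_id]; rfl⟩

theorem FactorsThrough.comp {F : Wedge n → Wedge m} {G : Wedge k → Wedge n}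
    {σ : Substitution n m} {τ : Substitution k n} (hF : FactorsThrough F σ)
    (hG : FactorsThrough G τ) : FactorsThrough (F ∘ G) (σ.comp τ) := by
  obtain ⟨μ, hμ, rfl⟩ := hF
  obtain ⟨ν, hν, rfl⟩ := hG
  obtain ⟨μ', hμ', h⟩ := exists_reparamMap_comp_linMap τ hμ
  obtain ⟨ρ, hρ, h'⟩ := exists_linMap_comp_linMap σ τ
  refine ⟨fun i => ρ i ∘ (μ' i ∘ ν i), fun i => (hρ i).comp ((hμ' i).comp (hν i)), ?_⟩
  rw [← reparamMap_comp hρ fun i => (hμ' i).comp (hν i), ← reparamMap_comp hμ' hν,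
    ← Function.comp_assoc (linMap _), ← h', Function.comp_assoc, ← Function.comp_assoc _ (linMap τ),
    h]
  rfl

theorem FactorsThrough.iterate {F : Wedge n → Wedge n} {χ : Substitution n n}
    (hF : FactorsThrough F χ) (N : ℕ) : FactorsThrough F^[N] (χ.iter N) := by
  induction N with
  | zero =>
    refine ⟨fun _ => id, fun _ => isReparam_id, Wedge.ext_loop fun i t ht => ?_⟩
    rw [Function.comp_apply, reparamMap_loop (fun _ => isReparam_id) i ht, id, linMap_loop _ i ht]
    have : (χ.iter 0).onLetter (i, true) = [(i, true)] := rfl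
    simp only [this, List.length_singleton, Nat.cast_one, one_mul]
    rw [wordPath_singleton _ ht, Wedge.loopL_true]
    rfl
  | succ N ih => exact ih.comp hF

theorem FactorsThrough.continuous {F : Wedge n → Wedge m} {χ : Substitution n m}
    (hF : FactorsThrough F χ) : Continuous F := by
  obtain ⟨μ, hμ, rfl⟩ := hF
  exact (continuous_linMap χ).comp (continuous_reparamMap hμ)

/-- A passage over a letter, extended by the constants `0` and `1`. -/
theorem TracesLetter.exists_monotone {f : Wedge n → Wedge m} {i : Fin n} {u v : ℝ} {x : Letter m}
    (huv : u < v) (h : TracesLetter f i u v x) : ∃ φ : ℝ → ℝ, Monotone φ ∧ Continuous φ ∧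
      (∀ t ≤ u, φ t = 0) ∧ (∀ t, v ≤ t → φ t = 1) ∧ ∀ t ∈ Ioo u v,
        φ t ∈ Ioo (0 : ℝ) 1 ∧ f (Wedge.loop i t) = Wedge.loopL x (φ t) := by
  have hψ : ∃ ψ : ℝ → ℝ, (∀ t ∈ Ioo u v, f (Wedge.loop i t) = Wedge.loopL x (ψ t)) ∧
      BijOn ψ (Ioo u v) (Ioo 0 1) ∧ StrictMonoOn ψ (Ioo u v) := by
    obtain ⟨φ, h1, h2, h3⟩ := h
    obtain ⟨l, _ | _⟩ := x
    · have h3 : StrictAntiOn φ (Ioo u v) := by simpa using h3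
      have hm : StrictMonoOn (fun t => 1 - φ t) (Ioo u v) := fun a ha b hb hab => by
        have := h3 ha hb hab
        show 1 - φ a < 1 - φ b
        linarith
      refine ⟨fun t => 1 - φ t, fun t ht => ?_, ⟨fun t ht => ?_, hm.injOn, fun c hc => ?_⟩, hm⟩
      · rw [h1 t ht]
        simp [Wedge.loopL]
      · have := h2.mapsTo ht
        exact ⟨by linarith [this.2], by linarith [this.1]⟩
      · obtain ⟨t, ht, htc⟩ := h2.surjOn (show 1 - c ∈ Ioo (0 : ℝ) 1 from
          ⟨by linarith [hc.2], by linarith [hc.1]⟩)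
        exact ⟨t, ht, by show 1 - φ t = c; linarith⟩
    · refine ⟨φ, fun t ht => ?_, h2, by simpa using h3⟩
      rw [h1 t ht, Wedge.loopL_true]
  obtain ⟨ψ, h1, h2, h3⟩ := hψ
  set φ : ℝ → ℝ := fun t => if t ≤ u then 0 else if v ≤ t then 1 else ψ t with hφ
  have e1 : ∀ t ≤ u, φ t = 0 := fun t ht => if_pos ht
  have e2 : ∀ t, v ≤ t → φ t = 1 := fun t ht => by
    show (if t ≤ u then (0 : ℝ) else if v ≤ t then 1 else ψ t) = 1
    rw [if_neg (by linarith), if_pos ht]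
  have e3 : ∀ t ∈ Ioo u v, φ t = ψ t := fun t ht => by
    show (if t ≤ u then (0 : ℝ) else if v ≤ t then 1 else ψ t) = ψ t
    rw [if_neg (not_le.2 ht.1), if_neg (not_le.2 ht.2)]
  have hmem : ∀ t, φ t ∈ Icc (0 : ℝ) 1 := fun t => by
    rcases le_or_gt t u with h | h
    · rw [e1 t h]; simp
    · rcases le_or_gt v t with h' | h'
      · rw [e2 t h']; simp
      · rw [e3 t ⟨h, h'⟩]
        exact Ioo_subset_Icc_self (h2.mapsTo ⟨h, h'⟩)
  have hmono : Monotone φ := by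
    intro s t hst
    rcases le_or_gt s u with h | h
    · rw [e1 s h]
      exact (hmem t).1
    · rcases le_or_gt v t with h' | h'
      · rw [e2 t h']
        exact (hmem s).2
      · have hs : s ∈ Ioo u v := ⟨h, hst.trans_lt h'⟩
        have ht : t ∈ Ioo u v := ⟨h.trans_le hst, h'⟩
        rw [e3 s hs, e3 t ht]
        exact h3.monotoneOn hs ht hst
  have hcont : Continuous φ := by
    have hsurj : Function.Surjective fun t => (⟨φ t, hmem t⟩ : Icc (0 : ℝ) 1) := by
      rintro ⟨c, hc⟩
      rcases hc.1.eq_or_lt with rfl | h0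
      · exact ⟨u, Subtype.ext (e1 u le_rfl)⟩
      · rcases hc.2.eq_or_lt with rfl | h1'
        · exact ⟨v, Subtype.ext (e2 v le_rfl)⟩
        · obtain ⟨t, ht, htc⟩ := h2.surjOn ⟨h0, h1'⟩
          exact ⟨t, Subtype.ext ((e3 t ht).trans htc)⟩
    have hm : Monotone fun t => (⟨φ t, hmem t⟩ : Icc (0 : ℝ) 1) := fun s t hst => hmono hst
    exact continuous_subtype_val.comp (hm.continuous_of_surjective hsurj)
  refine ⟨φ, hmono, hcont, e1, e2, fun t ht => ?_⟩
  rw [e3 t ht]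
  exact ⟨h2.mapsTo ht, h1 t ht⟩

/-- A path that is described by a word is the unit speed path along this word, up to a change of
parameter: the sum of the passages over the single letters. -/
theorem TracesWord.exists_reparam {f : Wedge n → Wedge m} {i : Fin n} {w : List (Letter m)}
    (hw : w ≠ []) (h : TracesWord f i w) : ∃ μ : ℝ → ℝ, IsReparam μ ∧
      ∀ t ∈ Icc (0 : ℝ) 1, f (Wedge.loop i t) = wordPath w (w.length * μ t) := by
  obtain ⟨u, v, h1, h2, h3, h4⟩ := h
  choose φ hm hc hl hr hφ using fun j => (h4 j).exists_monotone (h1 j).2.1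
  have hpos : (0 : ℝ) < w.length := by exact_mod_cast List.length_pos_of_ne_nil hw
  refine ⟨fun t => (∑ j, φ j t) / w.length, ⟨fun s t hst => ?_, ?_, ?_, ?_⟩, fun t ht => ?_⟩
  · exact div_le_div_of_nonneg_right (Finset.sum_le_sum fun j _ => hm j hst) hpos.le
  · exact (continuous_finsetSum _ fun j _ => hc j).div_const _
  · simp [hl _ _ (h1 _).1]
  · simp [hr _ _ (h1 _).2.2, hpos.ne']
  · show _ = wordPath w (w.length * ((∑ j, φ j t) / w.length))
    rw [mul_div_cancel₀ _ hpos.ne']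
    by_cases hb : f (Wedge.loop i t) = Wedge.base m
    -- at the base point no passage is under way, so that all of them contribute `0` or `1`
    · have hN : ∀ j, ∃ c : ℕ, φ j t = c := by
        intro j
        rcases le_or_gt t (u j) with h | h
        · exact ⟨0, by simpa using hl j t h⟩
        · rcases le_or_gt (v j) t with h' | h'
          · exact ⟨1, by simpa using hr j t h'⟩
          · exact absurd hb ((h3 t ht).2 ⟨j, h, h'⟩)
      choose c hc' using hN
      rw [hb, Finset.sum_congr rfl fun j _ => hc' j, ← Nat.cast_sum, wordPath_natCast]
    · obtain ⟨j, hj⟩ := (h3 t ht).1 hb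
      have hsum : ∑ k, φ k t = (j : ℕ) + φ j t := by
        have : ∀ k, φ k t = (if k < j then 1 else 0) + if k = j then φ j t else 0 := by
          intro k
          rcases lt_trichotomy k j with hk | rfl | hk
          · rw [if_pos hk, if_neg hk.ne, hr k t ((h2 k j hk).trans hj.1.le), add_zero]
          · simp
          · rw [if_neg hk.not_gt, if_neg hk.ne', hl k t (hj.2.le.trans (h2 j k hk)), add_zero]
        rw [Finset.sum_congr rfl fun k _ => this k, Finset.sum_add_distrib]
        have hcard : (Finset.univ.filter (· < j)).card = (j : ℕ) := by
          rw [Finset.filter_gt_eq_Iio, Fin.card_Iio]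
        simp [hcard]
      rw [hsum, wordPath_get w j (Ioo_subset_Icc_self (hφ j t hj).1), (hφ j t hj).2]

/-- A map that follows a pattern is the linear model of this pattern after a change of parameter. -/
theorem FollowsPattern.factorsThrough {f : Wedge n → Wedge m} {χ : Substitution n m}
    (h : FollowsPattern f χ) : FactorsThrough f χ := by
  choose μ hμ hf using fun i => (h i).exists_reparam (χ.ne_nil (i, true))
  refine ⟨μ, hμ, Wedge.ext_loop fun i t ht => ?_⟩
  rw [Function.comp_apply, reparamMap_loop hμ i ht, linMap_loop χ i ((hμ i).mem_Icc ht), hf i t ht]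

end models

/-! ### Inverse limits of sequences of maps -/

/-- The inverse limit of a sequence of self-maps of `X`. -/
def SeqLimit {X : Type*} (F : ℕ → X → X) : Type _ := {x : ℕ → X // ∀ k, F k (x (k + 1)) = x k}

instance {X : Type*} [TopologicalSpace X] (F : ℕ → X → X) : TopologicalSpace (SeqLimit F) :=
  inferInstanceAs (TopologicalSpace {x : ℕ → X // ∀ k, F k (x (k + 1)) = x k})

theorem SeqLimit.continuous_val {X : Type*} [TopologicalSpace X] {F : ℕ → X → X} (k : ℕ) :
    Continuous fun z : SeqLimit F => z.1 k :=
  (continuous_apply k).comp continuous_subtype_val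

theorem SeqLimit.continuous_of_val {X Y : Type*} [TopologicalSpace X] [TopologicalSpace Y]
    {F : ℕ → X → X} {Φ : Y → SeqLimit F} (h : ∀ k, Continuous fun y => (Φ y).1 k) :
    Continuous Φ :=
  continuous_induced_rng.2 (continuous_pi h)

theorem InverseLimit.continuous_val {X : Type*} [TopologicalSpace X] {f : X → X} (k : ℕ) :
    Continuous fun z : InverseLimit f => z.1 k :=
  (continuous_apply k).comp continuous_subtype_val

theorem InverseLimit.continuous_of_val {X Y : Type*} [TopologicalSpace X] [TopologicalSpace Y]
    {f : X → X} {Φ : Y → InverseLimit f} (h : ∀ k, Continuous fun y => (Φ y).1 k) :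
    Continuous Φ :=
  continuous_induced_rng.2 (continuous_pi h)

/-- The composition `F k ∘ F (k + 1) ∘ ⋯ ∘ F (k + d - 1)`. -/
def seqComp {X : Type*} (F : ℕ → X → X) (k : ℕ) : ℕ → X → X
  | 0 => id
  | d + 1 => seqComp F k d ∘ F (k + d)

theorem seqComp_succ' {X : Type*} (F : ℕ → X → X) (k d : ℕ) :
    seqComp F k (d + 1) = F k ∘ seqComp F (k + 1) d := by
  induction d with
  | zero => rfl
  | succ d ih =>
    have e : k + (d + 1) = k + 1 + d := by omega
    rw [seqComp, ih, seqComp, Function.comp_assoc, e]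

theorem continuous_seqComp {X : Type*} [TopologicalSpace X] {F : ℕ → X → X}
    (hF : ∀ k, Continuous (F k)) (k d : ℕ) : Continuous (seqComp F k d) := by
  induction d with
  | zero => exact continuous_id
  | succ d ih => exact ih.comp (hF _)

theorem SeqLimit.seqComp_apply {X : Type*} {F : ℕ → X → X} (z : SeqLimit F) (k d : ℕ) :
    seqComp F k d (z.1 (k + d)) = z.1 k := by
  induction d with
  | zero => rfl
  | succ d ih =>
    rw [seqComp, Function.comp_apply]
    exact (congrArg _ (z.2 (k + d))).trans ih

section Brown

set_option linter.unusedSectionVars false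

variable {X : Type*} [MetricSpace X] [CompactSpace X] {F G : ℕ → X → X} {H K : ℕ → X → X}

/-- Maps `H k` that commute with the bonding maps up to a summable error, measured after projection
to each level, induce a map of the limits. -/
theorem SeqLimit.exists_map (hG : ∀ k, Continuous (G k))
    (hH : ∀ k, Continuous (H k))
    (hFG : ∀ k d x, dist (seqComp G k d (H (k + d) (F (k + d) x)))
      (seqComp G k d (G (k + d) (H (k + d + 1) x))) ≤ (1 / 2) ^ (k + d)) :
    ∃ Φ : SeqLimit F → SeqLimit G, Continuous Φ ∧ ∀ z k d,
      dist (seqComp G k d (H (k + d) (z.1 (k + d)))) ((Φ z).1 k) ≤ 2 * (1 / 2) ^ (k + d) := by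
  let u : ℕ → SeqLimit F → ℕ → X := fun k z d => seqComp G k d (H (k + d) (z.1 (k + d)))
  have hu : ∀ k z d, dist (u k z d) (u k z (d + 1)) ≤ (1 / 2) ^ k * (1 / 2) ^ d := by
    intro k z d
    rw [← pow_add]
    have := hFG k d (z.1 (k + d + 1))
    rw [z.2 (k + d)] at this
    exact this
  choose Φ hΦ using fun k z => cauchySeq_tendsto_of_complete
    (cauchySeq_of_le_geometric (1 / 2) _ (by norm_num) (hu k z))
  have hd : ∀ k z d, dist (u k z d) (Φ k z) ≤ 2 * (1 / 2) ^ (k + d) := by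
    intro k z d
    have := dist_le_of_le_geometric_of_tendsto (1 / 2) _ (by norm_num) (hu k z) (hΦ k z) d
    refine this.trans_eq ?_
    rw [pow_add]
    ring
  have hcomp : ∀ z k, G k (Φ (k + 1) z) = Φ k z := by
    intro z k
    refine tendsto_nhds_unique (((hG k).tendsto _).comp (hΦ (k + 1) z)) ?_
    refine ((tendsto_add_atTop_iff_nat 1).2 (hΦ k z)).congr fun d => ?_
    have e : k + (d + 1) = k + 1 + d := by omega
    show seqComp G k (d + 1) (H (k + (d + 1)) (z.1 (k + (d + 1)))) = _
    rw [seqComp_succ', e]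
    rfl
  refine ⟨fun z => ⟨fun k => Φ k z, hcomp z⟩, ?_, fun z k d => hd k z d⟩
  refine SeqLimit.continuous_of_val fun k => ?_
  have hlim : TendstoUniformly (fun d z => u k z d) (Φ k) atTop := by
    rw [Metric.tendstoUniformly_iff]
    intro ε hε
    have ht : Tendsto (fun d : ℕ => 2 * (1 / 2 : ℝ) ^ (k + d)) atTop (𝓝 0) := by
      have h0 := tendsto_pow_atTop_nhds_zero_of_lt_one (r := (1 / 2 : ℝ)) (by norm_num) (by norm_num)
      have h1 : Tendsto (fun d : ℕ => (1 / 2 : ℝ) ^ (k + d)) atTop (𝓝 0) :=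
        h0.comp (tendsto_atTop_mono (fun d => Nat.le_add_left d k) tendsto_id)
      simpa using h1.const_mul 2
    filter_upwards [ht.eventually_lt_const hε] with d hd' z
    rw [dist_comm]
    exact (hd k z d).trans_lt hd'
  refine hlim.continuous (Eventually.frequently (Eventually.of_forall fun d => ?_))
  exact (continuous_seqComp hG k d).comp
    ((hH _).comp (SeqLimit.continuous_val (k + d)))

/-- If the maps `K k` are left inverse to the maps `H k`, then the map of limits induced by the `K k`
is left inverse to the one induced by the `H k`. -/
theorem SeqLimit.leftInverse_of_close {Φ : SeqLimit F → SeqLimit G} {Ψ : SeqLimit G → SeqLimit F}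
    (hF : ∀ k, Continuous (F k)) (hK : ∀ k, Continuous (K k))
    (hKH : ∀ k x, K k (H k x) = x)
    (hΦ : ∀ z k d, dist (seqComp G k d (H (k + d) (z.1 (k + d)))) ((Φ z).1 k) ≤
      2 * (1 / 2) ^ (k + d))
    (hGF : ∀ k d x, dist (seqComp F k d (K (k + d) (G (k + d) x)))
      (seqComp F k d (F (k + d) (K (k + d + 1) x))) ≤ (1 / 2) ^ (k + d))
    (hΨ : ∀ z k d, dist (seqComp F k d (K (k + d) (z.1 (k + d)))) ((Ψ z).1 k) ≤
      2 * (1 / 2) ^ (k + d)) : Function.LeftInverse Ψ Φ := by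
  intro z
  refine Subtype.ext (funext fun k => ?_)
  have h0 := tendsto_pow_atTop_nhds_zero_of_lt_one (r := (1 / 2 : ℝ)) (by norm_num) (by norm_num)
  have hp : ∀ j : ℕ, Tendsto (fun d : ℕ => (1 / 2 : ℝ) ^ (j + d)) atTop (𝓝 0) := fun j =>
    h0.comp (tendsto_atTop_mono (fun d => Nat.le_add_left d j) tendsto_id)
  -- moving `K` from level `k + d` to level `k + d + i` costs at most a geometric sum
  have htel : ∀ d i x, dist (seqComp F k d (K (k + d) (seqComp G (k + d) i x)))
      (seqComp F k (d + i) (K (k + (d + i)) x)) ≤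
        2 * (1 / 2) ^ (k + d) - 2 * (1 / 2) ^ (k + (d + i)) := by
    intro d i
    induction i with
    | zero =>
      intro x
      simp [seqComp]
    | succ i ih =>
      intro x
      have h1 := ih (G (k + (d + i)) x)
      have h2 := hGF k (d + i) x
      have e : G (k + (d + i)) = G (k + d + i) := by rw [add_assoc]
      have h3 : seqComp G (k + d) (i + 1) x = seqComp G (k + d) i (G (k + (d + i)) x) := by
        rw [e]; rfl
      rw [h3]
      refine (dist_triangle _ _ _).trans ((add_le_add h1 h2).trans_eq ?_)
      rw [show k + (d + (i + 1)) = k + (d + i) + 1 by omega, pow_succ]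
      ring
  have hd : ∀ d, dist (z.1 k) ((Ψ (Φ z)).1 k) ≤ 4 * (1 / 2) ^ (k + d) := by
    intro d
    have h1 := hΨ (Φ z) k d
    have h2 : dist (seqComp F k d (K (k + d) ((Φ z).1 (k + d)))) (z.1 k) ≤
        2 * (1 / 2) ^ (k + d) := by
      have hlim : Tendsto (fun i => seqComp G (k + d) i (H (k + d + i) (z.1 (k + d + i)))) atTop
          (𝓝 ((Φ z).1 (k + d))) := by
        rw [tendsto_iff_dist_tendsto_zero]
        refine squeeze_zero (fun _ => dist_nonneg) (fun i => hΦ z (k + d) i) ?_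
        simpa using (hp (k + d)).const_mul 2
      have hlim' := ((((continuous_seqComp hF k d).comp (hK (k + d))).tendsto _).comp hlim)
      refine le_of_tendsto (hlim'.dist tendsto_const_nhds) (Eventually.of_forall fun i => ?_)
      have h := htel d i (H (k + d + i) (z.1 (k + d + i)))
      have e : k + d + i = k + (d + i) := by omega
      rw [e, hKH, z.seqComp_apply] at h
      simp only [Function.comp_apply]
      rw [e]
      have : (0 : ℝ) ≤ (1 / 2) ^ (k + (d + i)) := by positivity
      linarith
    have := dist_triangle_left (z.1 k) ((Ψ (Φ z)).1 k)
      (seqComp F k d (K (k + d) ((Φ z).1 (k + d))))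
    linarith
  have : dist (z.1 k) ((Ψ (Φ z)).1 k) ≤ 0 :=
    ge_of_tendsto (by simpa using (hp k).const_mul 4) (Eventually.of_forall hd)
  exact (dist_le_zero.1 this).symm

/-- A form of Brown's approximation theorem: homeomorphisms that commute sufficiently well with
the bonding maps, in both directions, induce a homeomorphism of the inverse limits. -/
theorem SeqLimit.nonempty_homeomorph (hF : ∀ k, Continuous (F k)) (hG : ∀ k, Continuous (G k))
    (e : ℕ → X ≃ₜ X)
    (hFG : ∀ k d x, dist (seqComp G k d (e (k + d) (F (k + d) x)))
      (seqComp G k d (G (k + d) (e (k + d + 1) x))) ≤ (1 / 2) ^ (k + d))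
    (hGF : ∀ k d x, dist (seqComp F k d ((e (k + d)).symm (G (k + d) x)))
      (seqComp F k d (F (k + d) ((e (k + d + 1)).symm x))) ≤ (1 / 2) ^ (k + d)) :
    Nonempty (SeqLimit F ≃ₜ SeqLimit G) := by
  obtain ⟨Φ, hΦc, hΦ⟩ := SeqLimit.exists_map (H := fun k => e k) hG
    (fun k => (e k).continuous) hFG
  obtain ⟨Ψ, hΨc, hΨ⟩ := SeqLimit.exists_map (H := fun k => (e k).symm) hF
    (fun k => (e k).symm.continuous) hGF
  exact ⟨{
    toFun := Φ
    invFun := Ψ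
    left_inv := SeqLimit.leftInverse_of_close (K := fun k => (e k).symm) hF
      (fun k => (e k).symm.continuous) (fun k x => (e k).symm_apply_apply x) hΦ hGF hΨ
    right_inv := SeqLimit.leftInverse_of_close (K := fun k => e k) hG
      (fun k => (e k).continuous) (fun k x => (e k).apply_symm_apply x) hΨ hFG hΦ
    continuous_toFun := hΦc
    continuous_invFun := hΨc }⟩

theorem exists_uniform_modulus {ι : Type*} [Finite ι] {C : ι → X → X} (hC : ∀ i, Continuous (C i))
    {ε : ℝ} (hε : 0 < ε) :
    ∃ δ > 0, ∀ x y, dist x y < δ → ∀ i, dist (C i x) (C i y) < ε := by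
  have := Fintype.ofFinite ι
  have hu := CompactSpace.uniformContinuous_of_continuous (continuous_pi hC)
  obtain ⟨δ, hδ, h⟩ := Metric.uniformContinuous_iff.1 hu ε hε
  exact ⟨δ, hδ, fun x y hxy => (dist_pi_lt_iff hε).1 (h hxy)⟩

end Brown

/-! ### The inverse limit depends only on the pattern -/

section pattern

variable {n : ℕ} [NeZero n]

/-- A monotone change of parameter is a uniform limit of strictly monotone ones, which are obtained
by mixing in a small multiple of the identity. -/
theorem exists_strict_reparam {μ : Fin n → ℝ → ℝ} (hμ : ∀ i, IsReparam (μ i)) {ε : ℝ}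
    (hε : 0 < ε) : ∃ ν : Fin n → ℝ → ℝ, (∀ i, IsReparam (ν i)) ∧ (∀ i, StrictMono (ν i)) ∧
      ∀ x, dist (reparamMap μ x) (reparamMap ν x) < ε := by
  set r : ℝ := min (ε / 2) 1 with hr
  have hr0 : 0 < r := lt_min (by linarith) one_pos
  have hr1 : r ≤ 1 := min_le_right _ _
  have hν : ∀ i, IsReparam fun t => (1 - r) * μ i t + r * t := fun i => by
    refine ⟨fun s t hst => ?_, ?_, ?_, ?_⟩
    · exact add_le_add (mul_le_mul_of_nonneg_left ((hμ i).mono hst) (by linarith))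
        (mul_le_mul_of_nonneg_left hst hr0.le)
    · exact (continuous_const.mul (hμ i).cont).add (by fun_prop)
    · simp [(hμ i).zero]
    · simp [(hμ i).one]
  refine ⟨fun i t => (1 - r) * μ i t + r * t, hν, fun i s t hst => ?_, fun x => ?_⟩
  · exact add_lt_add_of_le_of_lt
      (mul_le_mul_of_nonneg_left ((hμ i).mono hst.le) (by linarith))
      (mul_lt_mul_of_pos_left hst hr0)
  · obtain ⟨i, t, ht, rfl⟩ := Wedge.exists_loop x
    have ht' := Ico_subset_Icc_self ht
    rw [reparamMap_loop hμ i ht', reparamMap_loop hν i ht', Wedge.dist_lt_iff hε]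
    intro l
    rw [Wedge.proj_loop, Wedge.proj_loop]
    split_ifs
    · rw [dist_eq_norm, ← AddCircle.coe_sub]
      have h0 := round_le (μ i t - ((1 - r) * μ i t + r * t)) 0
      rw [← UnitAddCircle.norm_eq, Int.cast_zero, sub_zero] at h0
      refine h0.trans_lt ?_
      have h1 := (hμ i).mem_Icc ht'
      have : μ i t - ((1 - r) * μ i t + r * t) = r * (μ i t - t) := by ring
      rw [this, abs_mul, abs_of_pos hr0]
      have h2 : |μ i t - t| ≤ 1 := abs_le.2 ⟨by linarith [h1.1, ht.2], by linarith [h1.2, ht.1]⟩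
      have h3 : r ≤ ε / 2 := min_le_left _ _
      nlinarith [abs_nonneg (μ i t - t)]
    · simpa using hε

theorem exists_homeomorph_of_strictMono {ν : Fin n → ℝ → ℝ} (hν : ∀ i, IsReparam (ν i))
    (hs : ∀ i, StrictMono (ν i)) : ∃ e : Wedge n ≃ₜ Wedge n, ⇑e = reparamMap ν := by
  have hbij : Function.Bijective (reparamMap ν) := by
    have hI : ∀ i, ∀ t ∈ Ioo (0 : ℝ) 1, ν i t ∈ Ioo (0 : ℝ) 1 := fun i t ht =>
      ⟨(hν i).zero ▸ hs i ht.1, (hν i).one ▸ hs i ht.2⟩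
    constructor
    · intro x y hxy
      by_cases hx : x = Wedge.base n
      · by_cases hy : y = Wedge.base n
        · rw [hx, hy]
        · obtain ⟨i, t, ht, rfl⟩ := Wedge.exists_loop_of_ne_base hy
          rw [hx, reparamMap_base hν, reparamMap_loop hν i (Ioo_subset_Icc_self ht)] at hxy
          exact absurd hxy.symm (Wedge.loop_ne_base (hI i t ht))
      · obtain ⟨i, t, ht, rfl⟩ := Wedge.exists_loop_of_ne_base hx
        by_cases hy : y = Wedge.base n
        · rw [hy, reparamMap_base hν, reparamMap_loop hν i (Ioo_subset_Icc_self ht)] at hxy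
          exact absurd hxy (Wedge.loop_ne_base (hI i t ht))
        · obtain ⟨j, s, hs', rfl⟩ := Wedge.exists_loop_of_ne_base hy
          rw [reparamMap_loop hν i (Ioo_subset_Icc_self ht),
            reparamMap_loop hν j (Ioo_subset_Icc_self hs')] at hxy
          obtain ⟨rfl, h⟩ := Wedge.loop_inj (hI i t ht) (hI j s hs') hxy
          rw [(hs i).injective h]
    · intro y
      obtain ⟨i, t, ht, rfl⟩ := Wedge.exists_loop y
      have : t ∈ ν i '' Icc 0 1 := by
        refine intermediate_value_Icc zero_le_one (hν i).cont.continuousOn ?_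
        rw [(hν i).zero, (hν i).one]
        exact Ico_subset_Icc_self ht
      obtain ⟨s, hs', rfl⟩ := this
      exact ⟨Wedge.loop i s, reparamMap_loop hν i hs'⟩
  exact ⟨Continuous.homeoOfEquivCompactToT2 (f := Equiv.ofBijective _ hbij)
    (continuous_reparamMap hν), rfl⟩

/-- Inverse limits of maps that follow the same patterns are homeomorphic: the linear models are
approximated through homeomorphisms that reparametrize the circles. -/
theorem FactorsThrough.seqLimit_homeomorph {F : ℕ → Wedge n → Wedge n}
    {χ : ℕ → Substitution n n} (h : ∀ k, FactorsThrough (F k) (χ k)) :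
    Nonempty (SeqLimit F ≃ₜ SeqLimit fun k => linMap (χ k)) := by
  set L : ℕ → Wedge n → Wedge n := fun k => linMap (χ k) with hL
  have hF : ∀ k, Continuous (F k) := fun k => (h k).continuous
  have hLc : ∀ k, Continuous (L k) := fun k => continuous_linMap (χ k)
  let 𝓗 := {e : Wedge n ≃ₜ Wedge n // ∃ μ : Fin n → ℝ → ℝ, (∀ i, IsReparam (μ i)) ∧
    ⇑e = reparamMap μ}
  -- Some reparametrization `r` satisfies `e ∘ F j = L j ∘ r` exactly, but need not be injective; the
  -- next homeomorphism `e'` is taken so close to `r` that the errors at the levels `k ≤ j` are small.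
  have step : ∀ (j : ℕ) (e : 𝓗), ∃ e' : 𝓗, ∀ k d, k + d = j →
      (∀ x, dist (seqComp L k d (e.1 (F j x))) (seqComp L k d (L j (e'.1 x))) ≤ (1 / 2) ^ j) ∧
      ∀ x, dist (seqComp F k d (e.1.symm (L j x))) (seqComp F k d (F j (e'.1.symm x))) ≤
        (1 / 2) ^ j := by
    rintro j ⟨e, μ, hμ, heμ⟩
    obtain ⟨m, hm, hFm⟩ := h j
    obtain ⟨ν, hν, hμν⟩ := exists_reparamMap_comp_linMap (χ j) hμ
    have hνm : ∀ i, IsReparam (ν i ∘ m i) := fun i => (hν i).comp (hm i)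
    have key : ∀ x, e (F j x) = L j (reparamMap (fun i => ν i ∘ m i) x) := by
      intro x
      rw [← reparamMap_comp hν hm, heμ, hFm]
      exact congrFun hμν (reparamMap m x)
    let C : Fin (j + 1) ⊕ Fin (j + 1) → Wedge n → Wedge n := Sum.elim
      (fun k => seqComp L k (j - k) ∘ L j) fun k => seqComp F k (j - k) ∘ e.symm ∘ L j
    have hC : ∀ i, Continuous (C i) := by
      rintro (k | k)
      · exact (continuous_seqComp hLc _ _).comp (hLc j)
      · exact (continuous_seqComp hF _ _).comp (e.symm.continuous.comp (hLc j))
    obtain ⟨δ, hδ, hδC⟩ := exists_uniform_modulus hC (show (0 : ℝ) < (1 / 2) ^ j by positivity)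
    obtain ⟨ρ, hρ, hρs, hρd⟩ := exists_strict_reparam hνm hδ
    obtain ⟨e', he'⟩ := exists_homeomorph_of_strictMono hρ hρs
    refine ⟨⟨e', ρ, hρ, he'⟩, fun k d hkd => ?_⟩
    have hk : k < j + 1 := by omega
    obtain rfl : d = j - k := by omega
    have hclose : ∀ x, dist (reparamMap (fun i => ν i ∘ m i) x) (e' x) < δ := fun x => by
      rw [he']
      exact hρd x
    constructor
    · intro x
      simp only
      rw [key]
      exact (hδC _ _ (hclose x) (Sum.inl ⟨k, hk⟩)).le
    · intro x
      simp only
      have h1 := (hδC _ _ (hclose (e'.symm x)) (Sum.inr ⟨k, hk⟩)).le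
      simp only [C, Sum.elim_inr, Function.comp_apply, ← key, e'.apply_symm_apply,
        e.symm_apply_apply] at h1
      rw [dist_comm]
      exact h1
  choose next hnext using step
  let e : ℕ → 𝓗 := fun k => Nat.rec
    ⟨Homeomorph.refl _, fun _ => id, fun _ => isReparam_id, reparamMap_id.symm⟩ next k
  have he : ∀ j, e (j + 1) = next j (e j) := fun j => rfl
  refine SeqLimit.nonempty_homeomorph hF hLc (fun k => (e k).1) (fun k d x => ?_) fun k d x => ?_
  · have := (hnext (k + d) (e (k + d)) k d rfl).1 x
    rwa [← he] at this
  · have := (hnext (k + d) (e (k + d)) k d rfl).2 x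
    rwa [← he] at this

theorem FactorsThrough.seqLimit_homeomorph_of_same {F G : ℕ → Wedge n → Wedge n}
    {χ : ℕ → Substitution n n} (hF : ∀ k, FactorsThrough (F k) (χ k))
    (hG : ∀ k, FactorsThrough (G k) (χ k)) : Nonempty (SeqLimit F ≃ₜ SeqLimit G) := by
  obtain ⟨e⟩ := FactorsThrough.seqLimit_homeomorph hF
  obtain ⟨e'⟩ := FactorsThrough.seqLimit_homeomorph hG
  exact ⟨e.trans e'.symm⟩

end pattern

/-! ### Weakly equivalent patterns have homeomorphic inverse limits -/

theorem InverseLimit.iterate_apply {X : Type*} {f : X → X} (z : InverseLimit f) (k d : ℕ) :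
    f^[d] (z.1 (k + d)) = z.1 k := by
  induction d with
  | zero => rfl
  | succ d ih => rw [Function.iterate_succ_apply, ← ih, ← z.2 (k + d), add_assoc]

/-- Passing to powers of the bonding map does not change the inverse limit. -/
theorem InverseLimit.nonempty_homeomorph_iterate {X : Type*} [TopologicalSpace X] {f : X → X}
    (hf : Continuous f) {N : ℕ → ℕ} (hN : ∀ i, 0 < N i) :
    Nonempty (InverseLimit f ≃ₜ SeqLimit fun i => f^[N i]) := by
  let s : ℕ → ℕ := fun i => ∑ j ∈ Finset.range i, N j
  have hs : ∀ i, s (i + 1) = s i + N i := fun i => Finset.sum_range_succ _ _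
  have hle : ∀ i, i ≤ s i := by
    intro i
    induction i with
    | zero => exact Nat.zero_le _
    | succ i ih =>
      rw [hs]
      have := hN i
      omega
  have hiter : ∀ (y : SeqLimit fun i => f^[N i]) (i d : ℕ),
      f^[s (i + d) - s i] (y.1 (i + d)) = y.1 i := by
    intro y i d
    induction d with
    | zero => simp
    | succ d ih =>
      have hm : s i ≤ s (i + d) := Finset.sum_le_sum_of_subset (by
        intro a ha
        rw [Finset.mem_range] at ha ⊢
        omega)
      rw [← add_assoc, hs, show s (i + d) + N (i + d) - s i = s (i + d) - s i + N (i + d) by omega,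
        Function.iterate_add_apply]
      exact (congrArg _ (y.2 (i + d))).trans ih
  refine ⟨{
    toFun := fun z => ⟨fun i => z.1 (s i), fun i => by
      have h := z.iterate_apply (s i) (N i)
      rw [← hs] at h
      exact h⟩
    invFun := fun y => ⟨fun k => f^[s k - k] (y.1 k), fun k => by
      have h := congrArg f^[s k - k] (y.2 k)
      refine Eq.trans ?_ h
      show f (f^[s (k + 1) - (k + 1)] (y.1 (k + 1))) = f^[s k - k] (f^[N k] (y.1 (k + 1)))
      rw [← Function.iterate_succ_apply' f, ← Function.iterate_add_apply]
      congr 2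
      have := hs k
      have := hle k
      have := hle (k + 1)
      omega⟩
    left_inv := fun z => Subtype.ext (funext fun k => by
      have := z.iterate_apply k (s k - k)
      rwa [Nat.add_sub_cancel' (hle k)] at this)
    right_inv := fun y => Subtype.ext (funext fun i => by
      obtain ⟨d, hd⟩ := Nat.exists_eq_add_of_le (hle i)
      have h1 := hiter y i d
      show f^[s (s i) - s i] (y.1 (s i)) = y.1 i
      rw [← hd] at h1
      exact h1)
    continuous_toFun := SeqLimit.continuous_of_val fun i => InverseLimit.continuous_val (s i)
    continuous_invFun := InverseLimit.continuous_of_val fun k =>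
      (hf.iterate _).comp (SeqLimit.continuous_val k) }⟩

/-- Shifting the brackets in `(A 0 ∘ B 0) ∘ (A 1 ∘ B 1) ∘ ⋯` does not change the inverse limit. -/
theorem SeqLimit.nonempty_homeomorph_interleave {X Y : Type*} [TopologicalSpace X]
    [TopologicalSpace Y] {A : ℕ → Y → X} {B : ℕ → X → Y} (hA : ∀ i, Continuous (A i))
    (hB : ∀ i, Continuous (B i)) :
    Nonempty (SeqLimit (fun i => A i ∘ B i) ≃ₜ SeqLimit fun i => B i ∘ A (i + 1)) :=
  ⟨{
    toFun := fun z => ⟨fun i => B i (z.1 (i + 1)), fun i => congrArg (B i) (z.2 (i + 1))⟩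
    invFun := fun y => ⟨fun i => A i (y.1 i), fun i => congrArg (A i) (y.2 i)⟩
    left_inv := fun z => Subtype.ext (funext fun i => z.2 i)
    right_inv := fun y => Subtype.ext (funext fun i => y.2 i)
    continuous_toFun := SeqLimit.continuous_of_val fun i =>
      (hB i).comp (SeqLimit.continuous_val (i + 1))
    continuous_invFun := SeqLimit.continuous_of_val fun i =>
      (hA i).comp (SeqLimit.continuous_val i) }⟩

theorem nonempty_homeomorph_of_weaklyEquivalent {n m : ℕ} [NeZero n] [NeZero m]
    {f : Wedge n → Wedge n} {g : Wedge m → Wedge m} {χ : Substitution n n}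
    {ψ : Substitution m m} (hf : FactorsThrough f χ) (hg : FactorsThrough g ψ)
    (h : χ.WeaklyEquivalent ψ) : Nonempty (InverseLimit f ≃ₜ InverseLimit g) := by
  obtain ⟨N, M, σ, τ, hN, hM, h1, h2⟩ := h
  have e1 : ∀ i, (σ i).comp (τ i) = χ.iter (N i) := fun i =>
    Substitution.ext_onLetter fun x => by
      rw [← Substitution.onWord_singleton, ← Substitution.onWord_singleton,
        Substitution.onWord_comp, h1, Substitution.onWord_iter]
  have e2 : ∀ i, (τ i).comp (σ (i + 1)) = ψ.iter (M i) := fun i =>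
    Substitution.ext_onLetter fun x => by
      rw [← Substitution.onWord_singleton, ← Substitution.onWord_singleton,
        Substitution.onWord_comp, h2, Substitution.onWord_iter]
  obtain ⟨a⟩ := InverseLimit.nonempty_homeomorph_iterate hf.continuous hN
  obtain ⟨b⟩ := FactorsThrough.seqLimit_homeomorph_of_same (fun i => hf.iterate (N i)) fun i =>
    e1 i ▸ (factorsThrough_linMap (σ i)).comp (factorsThrough_linMap (τ i))
  obtain ⟨c⟩ := SeqLimit.nonempty_homeomorph_interleave (fun i => continuous_linMap (σ i))
    fun i => continuous_linMap (τ i)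
  obtain ⟨d⟩ := FactorsThrough.seqLimit_homeomorph_of_same (fun i => e2 i ▸
    (factorsThrough_linMap (τ i)).comp (factorsThrough_linMap (σ (i + 1)))) fun i =>
      hg.iterate (M i)
  obtain ⟨e⟩ := InverseLimit.nonempty_homeomorph_iterate hg.continuous hM
  exact ⟨a.trans (b.trans (c.trans (d.trans e.symm)))⟩

/-! ### Middle parts of the circles -/

namespace Wedge

variable {n : ℕ}

/-- A connected set that avoids the base point lies in one circle. -/
theorem exists_proj_ne_zero_of_isPreconnected [NeZero n] {D : Set (Wedge n)}
    (hD : IsPreconnected D) (hb : base n ∉ D) (hne : D.Nonempty) :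
    ∃ l, ∀ x ∈ D, proj l x ≠ 0 := by
  obtain ⟨x₀, hx₀⟩ := hne
  obtain ⟨l, hl⟩ := exists_proj_ne (fun h : x₀ = base n => hb (h ▸ hx₀))
  have hop : ∀ k, IsOpen {x : Wedge n | proj k x ≠ 0} := fun k =>
    isOpen_ne.preimage (continuous_proj k)
  refine ⟨l, ?_⟩
  show D ⊆ {x : Wedge n | proj l x ≠ 0}
  refine hD.subset_left_of_subset_union (hop l)
    (v := ⋃ k, ⋃ _ : k ≠ l, {x : Wedge n | proj k x ≠ 0})
    (isOpen_iUnion fun k => isOpen_iUnion fun _ => hop k) ?_ ?_ ⟨x₀, hx₀, hl⟩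
  · rw [Set.disjoint_left]
    intro t ht ht'
    simp only [mem_iUnion] at ht'
    obtain ⟨k, hk, hk'⟩ := ht'
    exact hk (proj_eq_of_ne hk' ht)
  · intro t ht
    obtain ⟨k, hk⟩ := exists_proj_ne (fun h : t = base n => hb (h ▸ ht))
    by_cases hkl : k = l
    · exact Or.inl (hkl ▸ hk)
    · exact Or.inr (mem_iUnion.2 ⟨k, mem_iUnion.2 ⟨hkl, hk⟩⟩)

/-- The union of the open middle parts `(e, 1 - e)` of the circles. -/
def zone (n : ℕ) (e : ℝ) : Set (Wedge n) := {x | ∃ l, ∃ s ∈ Ioo e (1 - e), x = loop l s}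

/-- The midpoints of the circles. -/
def mid (n : ℕ) : Set (Wedge n) := {x | ∃ l, x = loop l (1 / 2)}

theorem mid_subset_zone {e : ℝ} (he : e < 1 / 2) : mid n ⊆ zone n e := by
  rintro x ⟨l, rfl⟩
  exact ⟨l, 1 / 2, ⟨he, by linarith⟩, rfl⟩

theorem zone_anti {e e' : ℝ} (h : e ≤ e') : zone n e' ⊆ zone n e := by
  rintro x ⟨l, s, hs, rfl⟩
  exact ⟨l, s, ⟨h.trans_lt hs.1, hs.2.trans_le (by linarith)⟩, rfl⟩

theorem eq_loop_of_proj_eq {x : Wedge n} {l : Fin n} {s : ℝ} (hs : s ∈ Ioo (0 : ℝ) 1)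
    (h : proj l x = s) : x = loop l s := by
  have hne : proj l x ≠ 0 := h ▸ coe_ne_zero hs
  rw [eq_incl_of_proj_ne hne, h]
  rfl

theorem isOpen_zone {e : ℝ} (he : 0 ≤ e) : IsOpen (zone n e) := by
  have : zone n e = ⋃ l, proj l ⁻¹' ((fun s : ℝ => (s : UnitAddCircle)) '' Ioo e (1 - e)) := by
    ext x
    simp only [mem_iUnion, mem_preimage, mem_image]
    constructor
    · rintro ⟨l, s, hs, rfl⟩
      exact ⟨l, s, hs, by rw [proj_loop, if_pos rfl]⟩
    · rintro ⟨l, s, hs, h⟩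
      exact ⟨l, s, hs, eq_loop_of_proj_eq ⟨he.trans_lt hs.1, hs.2.trans_le (by linarith)⟩ h.symm⟩
  rw [this]
  exact isOpen_iUnion fun l =>
    (QuotientAddGroup.isOpenMap_coe _ isOpen_Ioo).preimage (continuous_proj l)

theorem exists_loop_of_mem_closure_zone {e : ℝ} (he : 0 < e) {x : Wedge n}
    (hx : x ∈ closure (zone n e)) : ∃ l, ∃ s ∈ Icc e (1 - e), x = loop l s := by
  have hcl : IsClosed (⋃ l : Fin n,
      proj l ⁻¹' ((fun s : ℝ => (s : UnitAddCircle)) '' Icc e (1 - e))) :=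
    isClosed_iUnion_of_finite fun l =>
      ((isCompact_Icc.image (AddCircle.continuous_mk' 1)).isClosed).preimage (continuous_proj l)
  have hsub : zone n e ⊆ ⋃ l : Fin n,
      proj l ⁻¹' ((fun s : ℝ => (s : UnitAddCircle)) '' Icc e (1 - e)) := by
    rintro x ⟨l, s, hs, rfl⟩
    exact mem_iUnion.2 ⟨l, s, Ioo_subset_Icc_self hs, by rw [proj_loop, if_pos rfl]⟩
  obtain ⟨l, s, hs, h⟩ := mem_iUnion.1 (closure_minimal hsub hcl hx)
  exact ⟨l, s, hs, eq_loop_of_proj_eq ⟨he.trans_le hs.1, hs.2.trans_lt (by linarith)⟩ h.symm⟩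

theorem loopL_eq_loop {x : Letter n} {l : Fin n} {r s : ℝ} (hr : r ∈ Ioo (0 : ℝ) 1)
    (hs : s ∈ Ioo (0 : ℝ) 1) (h : loopL x r = loop l s) : x.1 = l ∧ (r = s ∨ r = 1 - s) := by
  rw [loopL] at h
  split_ifs at h
  · obtain ⟨h1, h2⟩ := loop_inj hr hs h
    exact ⟨h1, Or.inl h2⟩
  · obtain ⟨h1, h2⟩ := loop_inj ⟨by linarith [hr.2], by linarith [hr.1]⟩ hs h
    exact ⟨h1, Or.inr (by linarith)⟩

theorem loopL_mem_zone {x : Letter n} {e r : ℝ} (he : 0 ≤ e) (hr : r ∈ Ioo (0 : ℝ) 1) :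
    loopL x r ∈ zone n e ↔ r ∈ Ioo e (1 - e) := by
  constructor
  · rintro ⟨l, s, hs, h⟩
    obtain ⟨-, rfl | rfl⟩ := loopL_eq_loop hr
      ⟨he.trans_lt hs.1, hs.2.trans_le (by linarith)⟩ h
    · exact hs
    · exact ⟨by linarith [hs.2], by linarith [hs.1]⟩
  · intro hr'
    rw [loopL]
    split_ifs
    · exact ⟨_, r, hr', rfl⟩
    · exact ⟨_, 1 - r, ⟨by linarith [hr'.2], by linarith [hr'.1]⟩, rfl⟩

theorem loopL_mem_mid {x : Letter n} {r : ℝ} (hr : r ∈ Ioo (0 : ℝ) 1) :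
    loopL x r ∈ mid n ↔ r = 1 / 2 := by
  constructor
  · rintro ⟨l, h⟩
    obtain ⟨-, h | h⟩ := loopL_eq_loop hr (by norm_num) h
    · exact h
    · linarith
  · rintro rfl
    refine ⟨x.1, ?_⟩
    rw [loopL]
    split_ifs
    · rfl
    · norm_num

theorem base_notMem_zone [NeZero n] {e : ℝ} (he : 0 ≤ e) : base n ∉ zone n e := by
  rintro ⟨l, s, hs, h⟩
  exact loop_ne_base ⟨he.trans_lt hs.1, hs.2.trans_le (by linarith)⟩ h.symm

theorem dist_coe_eq {s t : ℝ} (h : |s - t| ≤ 1 / 2) :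
    dist (s : UnitAddCircle) (t : UnitAddCircle) = |s - t| := by
  rw [dist_eq_norm, ← AddCircle.coe_sub,
    (AddCircle.norm_coe_eq_abs_iff (1 : ℝ) one_ne_zero).2 (by simpa using h)]

/-- A point at distance less than `1/4` from a midpoint lies in the middle half of its circle. -/
theorem mem_zone_of_dist_mid {x y : Wedge n} (hy : y ∈ mid n) (h : dist x y < 1 / 4) :
    x ∈ zone n (1 / 4) := by
  obtain ⟨l, rfl⟩ := hy
  have h1 := (dist_lt_iff (by norm_num)).1 h l
  rw [proj_loop, if_pos rfl, ← coe_coord (proj l x)] at h1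
  have h2 := coord_mem (proj l x)
  rw [dist_coe_eq (abs_le.2 ⟨by linarith [h2.1], by linarith [h2.2]⟩), abs_lt] at h1
  refine ⟨l, coord (proj l x), ⟨by linarith, by linarith⟩, eq_loop_of_proj_eq
    ⟨by linarith, by linarith⟩ (coe_coord _).symm⟩

theorem abs_sub_lt_of_dist_coe {s t : ℝ} (hs : s ∈ Icc (1 / 4 : ℝ) (3 / 4))
    (ht : t ∈ Ico (0 : ℝ) 1) (h : dist (s : UnitAddCircle) (t : UnitAddCircle) < 1 / 8) :
    |s - t| < 1 / 8 := by
  rw [dist_eq_norm, ← AddCircle.coe_sub, UnitAddCircle.norm_eq] at h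
  have h0 : round (s - t) = 0 := by
    have h' := abs_lt.1 h
    by_contra hne
    rcases lt_or_gt_of_ne hne with hlt | hgt
    · have : (round (s - t) : ℝ) ≤ -1 := by exact_mod_cast (by omega : round (s - t) ≤ -1)
      linarith [hs.1, ht.2]
    · have : (1 : ℝ) ≤ round (s - t) := by exact_mod_cast hgt
      linarith [hs.2, ht.1]
  rwa [h0, Int.cast_zero, sub_zero] at h

theorem loopL_close {x z : Letter n} {r r' : ℝ} (hr : r ∈ Icc (1 / 4 : ℝ) (3 / 4))
    (hr' : r' ∈ Ioo (0 : ℝ) 1) (h : dist (loopL x r) (loopL z r') < 1 / 8) :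
    (z = x ∧ |r - r'| < 1 / 8) ∨ (z = x.bar ∧ |r - (1 - r')| < 1 / 8) := by
  have h1 := (dist_lt_iff (by norm_num)).1 h x.1
  obtain ⟨i, o⟩ := x
  obtain ⟨j, o'⟩ := z
  simp only [loopL, proj_loop, if_true] at h1
  have hρ : (if o = true then r else 1 - r) ∈ Icc (1 / 4 : ℝ) (3 / 4) := by
    split_ifs
    · exact hr
    · exact ⟨by linarith [hr.2], by linarith [hr.1]⟩
  by_cases hij : j = i
  · subst hij
    simp only [if_true] at h1
    have h2 := abs_sub_lt_of_dist_coe hρ (t := if o' = true then r' else 1 - r') (by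
      split_ifs
      · exact ⟨hr'.1.le, hr'.2⟩
      · exact ⟨by linarith [hr'.2], by linarith [hr'.1]⟩) h1
    cases o <;> cases o' <;> simp only [Bool.false_eq_true, if_false, if_true] at h2
    · left
      refine ⟨rfl, ?_⟩
      rw [abs_sub_comm] at h2
      have : r - r' = 1 - r' - (1 - r) := by ring
      rwa [this]
    · right
      refine ⟨rfl, ?_⟩
      rw [abs_sub_comm] at h2
      have : r - (1 - r') = r' - (1 - r) := by ring
      rwa [this]
    · right
      exact ⟨rfl, h2⟩
    · left
      exact ⟨rfl, h2⟩
  · rw [if_neg hij, ← AddCircle.coe_zero] at h1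
    have h2 := abs_lt.1 (abs_sub_lt_of_dist_coe hρ (by simp) h1)
    linarith [hρ.1, h2.2]

end Wedge

/-! ### Taut paths -/

/-- A path in the wedge that can turn only at the base point while its parameter is in `(a, b)`. -/
structure IsTaut {n : ℕ} [NeZero n] (P : ℝ → Wedge n) (a b : ℝ) : Prop where
  cont : Continuous P
  inj : ∀ t ∈ Ioo a b, P t ≠ Wedge.base n → ∃ U ∈ 𝓝 t, InjOn P U

theorem StrictMonoOn.Icc_of_Ioo {φ : ℝ → ℝ} {p q : ℝ} (hc : ContinuousOn φ (Icc p q))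
    (h : StrictMonoOn φ (Ioo p q)) : StrictMonoOn φ (Icc p q) := by
  have h1 : ∀ s ∈ Ioo p q, φ p ≤ φ s := by
    intro s hs
    have hcl : ContinuousWithinAt φ (Ioo p s) p :=
      (hc p ⟨le_rfl, (hs.1.trans hs.2).le⟩).mono fun t ht => ⟨ht.1.le, (ht.2.trans hs.2).le⟩
    have hne : (𝓝[Ioo p s] p).NeBot := by
      rw [← mem_closure_iff_nhdsWithin_neBot, closure_Ioo hs.1.ne]
      exact ⟨le_rfl, hs.1.le⟩
    exact le_of_tendsto hcl (eventually_nhdsWithin_of_forall fun t ht =>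
      (h ⟨ht.1, ht.2.trans hs.2⟩ hs ht.2).le)
  have h2 : ∀ s ∈ Ioo p q, φ s ≤ φ q := by
    intro s hs
    have hcl : ContinuousWithinAt φ (Ioo s q) q :=
      (hc q ⟨(hs.1.trans hs.2).le, le_rfl⟩).mono fun t ht => ⟨(hs.1.trans ht.1).le, ht.2.le⟩
    have hne : (𝓝[Ioo s q] q).NeBot := by
      rw [← mem_closure_iff_nhdsWithin_neBot, closure_Ioo hs.2.ne]
      exact ⟨hs.2.le, le_rfl⟩
    exact ge_of_tendsto hcl (eventually_nhdsWithin_of_forall fun t ht =>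
      (h hs ⟨hs.1.trans ht.1, ht.2⟩ ht.1).le)
  intro s hs t ht hst
  obtain ⟨c, hc1, hc2⟩ := exists_between hst
  obtain ⟨d, hd1, hd2⟩ := exists_between hc2
  have mc : c ∈ Ioo p q := ⟨hs.1.trans_lt hc1, hc2.trans_le ht.2⟩
  have md : d ∈ Ioo p q := ⟨mc.1.trans hd1, hd2.trans_le ht.2⟩
  have e1 : φ s ≤ φ c := by
    rcases hs.1.eq_or_lt with rfl | h'
    · exact h1 c mc
    · exact (h ⟨h', hc1.trans mc.2⟩ mc hc1).le
  have e2 : φ d ≤ φ t := by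
    rcases ht.2.eq_or_lt with rfl | h'
    · exact h2 d md
    · exact (h md ⟨md.1.trans hd2, h'⟩ hd2).le
  exact e1.trans_lt ((h mc md hd1).trans_le e2)

section taut

variable {n : ℕ} [NeZero n] {P Q R : ℝ → Wedge n} {a b : ℝ}

theorem IsTaut.mono {a' b' : ℝ} (h : IsTaut P a b) (ha : a ≤ a') (hb : b' ≤ b) :
    IsTaut P a' b' :=
  ⟨h.cont, fun t ht => h.inj t ⟨ha.trans_lt ht.1, ht.2.trans_le hb⟩⟩

/-- While a taut path avoids the base point, it runs along one letter. -/
theorem IsTaut.exists_segment (h : IsTaut P a b) {p q : ℝ} (hap : a ≤ p) (hpq : p < q)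
    (hqb : q ≤ b) (hne : ∀ t ∈ Icc p q, P t ≠ Wedge.base n) :
    ∃ (x : Letter n) (φ : ℝ → ℝ), Continuous φ ∧ StrictMonoOn φ (Icc p q) ∧
      ∀ t ∈ Icc p q, φ t ∈ Ioo (0 : ℝ) 1 ∧ P t = Wedge.loopL x (φ t) := by
  suffices hs : ∃ (x : Letter n) (φ : ℝ → ℝ), ContinuousOn φ (Icc p q) ∧
      StrictMonoOn φ (Icc p q) ∧
      ∀ t ∈ Icc p q, φ t ∈ Ioo (0 : ℝ) 1 ∧ P t = Wedge.loopL x (φ t) by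
    obtain ⟨x, φ, h1, h2, h3⟩ := hs
    have e : ∀ t ∈ Icc p q, (projIcc p q hpq.le t : ℝ) = t := fun t ht => by
      rw [projIcc_of_mem _ ht]
    refine ⟨x, fun t => φ (projIcc p q hpq.le t), ?_, fun s hs t ht hst => ?_, fun t ht => ?_⟩
    · exact h1.comp_continuous (continuous_subtype_val.comp continuous_projIcc)
        fun t => (projIcc p q hpq.le t).2
    · simp only [e s hs, e t ht]
      exact h2 hs ht hst
    · simp only [e t ht]
      exact h3 t ht
  obtain ⟨l, hl⟩ := Wedge.exists_proj_ne_zero_of_isPreconnected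
    (isPreconnected_Icc.image P h.cont.continuousOn) (D := P '' Icc p q)
    (by rintro ⟨t, ht, hb⟩; exact hne t ht hb) ⟨P p, p, ⟨le_rfl, hpq.le⟩, rfl⟩
  have hl : ∀ t ∈ Icc p q, Wedge.proj l (P t) ≠ 0 := fun t ht => hl _ ⟨t, ht, rfl⟩
  set φ : ℝ → ℝ := fun t => Wedge.coord (Wedge.proj l (P t)) with hφ
  have hPφ : ∀ t ∈ Icc p q, P t = Wedge.loop l (φ t) := fun t ht => by
    rw [Wedge.loop, Wedge.coe_coord]
    exact Wedge.eq_incl_of_proj_ne (hl t ht)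
  have hmaps : ∀ t ∈ Icc p q, φ t ∈ Ioo (0 : ℝ) 1 := fun t ht => Wedge.coord_mem_Ioo (hl t ht)
  have hcont : ContinuousOn φ (Icc p q) := fun t ht =>
    (ContinuousAt.comp (f := fun t => Wedge.proj l (P t)) (Wedge.continuousAt_coord (hl t ht))
      ((Wedge.continuous_proj l).comp h.cont).continuousAt).continuousWithinAt
  have hmono : StrictMonoOn φ (Ioo p q) ∨ StrictAntiOn φ (Ioo p q) := by
    refine strictMonoOn_or_strictAntiOn_of_locallyInjective (hcont.mono Ioo_subset_Icc_self)
      fun t ht => ?_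
    obtain ⟨U, hU, hUi⟩ := h.inj t ⟨hap.trans_lt ht.1, ht.2.trans_le hqb⟩
      (hne t (Ioo_subset_Icc_self ht))
    refine ⟨U ∩ Ioo p q, inter_mem hU (Ioo_mem_nhds ht.1 ht.2), fun x hx y hy hxy => ?_⟩
    refine hUi hx.1 hy.1 ?_
    rw [hPφ x (Ioo_subset_Icc_self hx.2), hPφ y (Ioo_subset_Icc_self hy.2), hxy]
  rcases hmono with hs | hs
  · exact ⟨(l, true), φ, hcont, StrictMonoOn.Icc_of_Ioo hcont hs, fun t ht =>
      ⟨hmaps t ht, by rw [Wedge.loopL_true, hPφ t ht]⟩⟩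
  · have hc' : ContinuousOn (fun t => 1 - φ t) (Icc p q) := continuousOn_const.sub hcont
    refine ⟨(l, false), fun t => 1 - φ t, hc', StrictMonoOn.Icc_of_Ioo hc' ?_, fun t ht => ?_⟩
    · intro s hs' t ht hst
      have := hs hs' ht hst
      show 1 - φ s < 1 - φ t
      linarith
    · have := hmaps t ht
      refine ⟨⟨by linarith [this.2], by linarith [this.1]⟩, ?_⟩
      rw [hPφ t ht]
      simp [Wedge.loopL]

/-- A taut path that enters the middle part of a circle and leaves it again crosses it. -/
theorem IsTaut.exists_passage (h : IsTaut P a b) {e t : ℝ} (he : 0 < e)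
    (ht : t ∈ Icc a b) (htz : P t ∈ Wedge.zone n e) (ha : P a ∉ Wedge.zone n e)
    (hb : P b ∉ Wedge.zone n e) :
    ∃ (u v : ℝ) (x : Letter n) (φ : ℝ → ℝ), a ≤ u ∧ u < t ∧ t < v ∧ v ≤ b ∧ Continuous φ ∧
      StrictMonoOn φ (Icc u v) ∧ φ u = e ∧ φ v = 1 - e ∧
      (∀ s ∈ Icc u v, P s = Wedge.loopL x (φ s)) ∧
      P u ∉ Wedge.zone n e ∧ P v ∉ Wedge.zone n e := by
  have hcl : IsClosed (P ⁻¹' (Wedge.zone n e)ᶜ) :=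
    (Wedge.isOpen_zone he.le).isClosed_compl.preimage h.cont
  obtain ⟨u, hu, hum⟩ := (isCompact_Icc.inter_right hcl : IsCompact (Icc a t ∩ _)).exists_isGreatest
    ⟨a, ⟨le_rfl, ht.1⟩, ha⟩
  obtain ⟨v, hv, hvm⟩ := (isCompact_Icc.inter_right hcl : IsCompact (Icc t b ∩ _)).exists_isLeast
    ⟨b, ⟨ht.2, le_rfl⟩, hb⟩
  have hut : u < t := lt_of_le_of_ne hu.1.2 fun h => hu.2 (h ▸ htz)
  have htv : t < v := lt_of_le_of_ne hv.1.1 fun h => hv.2 (h ▸ htz)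
  have huv := hut.trans htv
  have hin : ∀ s ∈ Ioo u v, P s ∈ Wedge.zone n e := by
    intro s hs
    by_contra hsz
    rcases le_total s t with h' | h'
    · exact absurd (hum ⟨⟨hu.1.1.trans hs.1.le, h'⟩, hsz⟩) (not_le.2 hs.1)
    · exact absurd (hvm ⟨⟨h', hs.2.le.trans hv.1.2⟩, hsz⟩) (not_le.2 hs.2)
  have hclos : ∀ s ∈ Icc u v, P s ∈ closure (Wedge.zone n e) := by
    intro s hs
    rw [← closure_Ioo huv.ne] at hs
    exact closure_mono (show P '' Ioo u v ⊆ Wedge.zone n e from image_subset_iff.2 hin)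
      (image_closure_subset_closure_image h.cont ⟨s, hs, rfl⟩)
  have he2 : e < 1 - e := by
    obtain ⟨l, s, hs, -⟩ := htz
    exact hs.1.trans hs.2
  have hne : ∀ s ∈ Icc u v, P s ≠ Wedge.base n := by
    intro s hs
    obtain ⟨l, r, hr, hrs⟩ := Wedge.exists_loop_of_mem_closure_zone he (hclos s hs)
    rw [hrs]
    exact Wedge.loop_ne_base ⟨he.trans_le hr.1, hr.2.trans_lt (by linarith)⟩
  obtain ⟨x, φ, hφc, hφm, hφ⟩ := h.exists_segment hu.1.1 huv hv.1.2 hne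
  have hend : ∀ s ∈ Icc u v, P s ∉ Wedge.zone n e → φ s = e ∨ φ s = 1 - e := by
    intro s hs hsz
    obtain ⟨l, r, hr, hrs⟩ := Wedge.exists_loop_of_mem_closure_zone he (hclos s hs)
    have hr' : r = e ∨ r = 1 - e := by
      by_contra hcon
      rw [not_or] at hcon
      exact hsz ⟨l, r, ⟨lt_of_le_of_ne hr.1 (Ne.symm hcon.1), lt_of_le_of_ne hr.2 hcon.2⟩, hrs⟩
    obtain ⟨-, h' | h'⟩ := Wedge.loopL_eq_loop (hφ s hs).1
      ⟨he.trans_le hr.1, hr.2.trans_lt (by linarith)⟩ ((hφ s hs).2.symm.trans hrs)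
    · rwa [h']
    · rcases hr' with rfl | rfl
      · exact Or.inr h'
      · exact Or.inl (by linarith)
  have hum' : u ∈ Icc u v := ⟨le_rfl, huv.le⟩
  have hvm' : v ∈ Icc u v := ⟨huv.le, le_rfl⟩
  have hlt := hφm hum' hvm' huv
  have hφu : φ u = e := by
    rcases hend u hum' hu.2 with h' | h'
    · exact h'
    · rcases hend v hvm' hv.2 with h'' | h'' <;> linarith
  have hφv : φ v = 1 - e := by
    rcases hend v hvm' hv.2 with h' | h'
    · linarith
    · exact h'
  exact ⟨u, v, x, φ, hu.1.1, hut, htv, hv.1.2, hφc, hφm, hφu, hφv,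
    fun s hs => (hφ s hs).2, hu.2, hv.2⟩

end taut

/-! ### The word that a path reads -/

section reads

set_option linter.unusedSectionVars false

variable {n : ℕ} [NeZero n] {P Q R : ℝ → Wedge n} {a b : ℝ}

/-- At time `t` the path crosses the midpoint of the letter `x`, in the direction of `x`. -/
def CrossesAt (P : ℝ → Wedge n) (t : ℝ) (x : Letter n) : Prop :=
  P t = Wedge.loopL x (1 / 2) ∧
    (∀ᶠ s in 𝓝[<] t, ∃ r ∈ Ioo (0 : ℝ) (1 / 2), P s = Wedge.loopL x r) ∧
    ∀ᶠ s in 𝓝[>] t, ∃ r ∈ Ioo (1 / 2 : ℝ) 1, P s = Wedge.loopL x r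

/-- Between the times `a` and `b` the path crosses the midpoints of the letters of the word, in
this order, and no other midpoints. -/
def Reads (P : ℝ → Wedge n) (b : ℝ) : List (Letter n) → ℝ → Prop
  | [], a => ∀ t ∈ Ioc a b, P t ∉ Wedge.mid n
  | x :: w, a => ∃ t ∈ Ioo a b, (∀ s ∈ Ioo a t, P s ∉ Wedge.mid n) ∧ CrossesAt P t x ∧
      Reads P b w t

theorem CrossesAt.mem_mid {t : ℝ} {x : Letter n} (h : CrossesAt P t x) : P t ∈ Wedge.mid n := by
  rw [h.1]
  exact (Wedge.loopL_mem_mid (by norm_num)).2 rfl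

theorem CrossesAt.unique {t : ℝ} {x y : Letter n} (h : CrossesAt P t x) (h' : CrossesAt P t y) :
    x = y := by
  obtain ⟨s, ⟨r, hr, hs⟩, r', hr', hs'⟩ := (h.2.2.and h'.2.2).exists
  have h1 : (0 : ℝ) < r := by linarith [hr.1]
  have h2 : (0 : ℝ) < r' := by linarith [hr'.1]
  obtain ⟨i, _ | _⟩ := x <;> obtain ⟨j, _ | _⟩ := y <;> rw [hs] at hs' <;>
    simp only [Wedge.loopL, Bool.false_eq_true, if_true, if_false] at hs'
  · obtain ⟨rfl, -⟩ := Wedge.loop_inj ⟨by linarith [hr.2], by linarith⟩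
      ⟨by linarith [hr'.2], by linarith⟩ hs'
    rfl
  · have := (Wedge.loop_inj ⟨by linarith [hr.2], by linarith⟩ ⟨h2, hr'.2⟩ hs').2
    linarith [hr.1, hr'.1]
  · have := (Wedge.loop_inj ⟨h1, hr.2⟩ ⟨by linarith [hr'.2], by linarith⟩ hs').2
    linarith [hr.1, hr'.1]
  · obtain ⟨rfl, -⟩ := Wedge.loop_inj ⟨h1, hr.2⟩ ⟨h2, hr'.2⟩ hs'
    rfl

theorem Reads.unique {w w' : List (Letter n)} (h : Reads P b w a) (h' : Reads P b w' a) :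
    w = w' := by
  induction w generalizing a w' with
  | nil =>
    cases w' with
    | nil => rfl
    | cons y w' =>
      obtain ⟨t, ht, -, hc, -⟩ := h'
      exact absurd hc.mem_mid (h t ⟨ht.1, ht.2.le⟩)
  | cons x w ih =>
    obtain ⟨t, ht, h1, hc, hr⟩ := h
    cases w' with
    | nil => exact absurd hc.mem_mid (h' t ⟨ht.1, ht.2.le⟩)
    | cons y w' =>
      obtain ⟨t', ht', h1', hc', hr'⟩ := h'
      obtain rfl : t = t' := by
        rcases lt_trichotomy t t' with hlt | he | hlt
        · exact absurd hc.mem_mid (h1' t ⟨ht.1, hlt⟩)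
        · exact he
        · exact absurd hc'.mem_mid (h1 t' ⟨ht'.1, hlt⟩)
      rw [hc.unique hc', ih hr hr']

theorem Reads.extend {w : List (Letter n)} {c : ℝ} (hac : a ≤ c)
    (h0 : ∀ t ∈ Ioc a c, P t ∉ Wedge.mid n) (h : Reads P b w c) : Reads P b w a := by
  cases w with
  | nil =>
    intro t ht
    rcases le_or_gt t c with h' | h'
    · exact h0 t ⟨ht.1, h'⟩
    · exact h t ⟨h', ht.2⟩
  | cons x w =>
    obtain ⟨t, ht, h1, hc, hr⟩ := h
    refine ⟨t, ⟨hac.trans_lt ht.1, ht.2⟩, fun s hs => ?_, hc, hr⟩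
    rcases le_or_gt s c with h' | h'
    · exact h0 s ⟨hs.1, h'⟩
    · exact h1 s ⟨h', hs.2⟩

theorem Reads.shrink {w : List (Letter n)} {c : ℝ} (hac : a ≤ c)
    (h0 : ∀ t ∈ Ioc a c, P t ∉ Wedge.mid n) (h : Reads P b w a) : Reads P b w c := by
  cases w with
  | nil => exact fun t ht => h t ⟨hac.trans_lt ht.1, ht.2⟩
  | cons x w =>
    obtain ⟨t, ht, h1, hc, hr⟩ := h
    have hct : c < t := by
      by_contra hcon
      exact h0 t ⟨ht.1, not_lt.1 hcon⟩ hc.mem_mid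
    exact ⟨t, ⟨hct, ht.2⟩, fun s hs => h1 s ⟨hac.trans_lt hs.1, hs.2⟩, hc, hr⟩

theorem Reads.append {w w' : List (Letter n)} {c : ℝ} (hac : a ≤ c) (hcb : c ≤ b)
    (h : Reads P c w a) (h' : Reads P b w' c) : Reads P b (w ++ w') a := by
  induction w generalizing a with
  | nil => exact h'.extend hac h
  | cons x w ih =>
    obtain ⟨t, ht, h1, hc, hr⟩ := h
    exact ⟨t, ⟨ht.1, ht.2.trans_le hcb⟩, h1, hc, ih ht.2.le hr⟩

theorem CrossesAt.congr {t : ℝ} {x : Letter n} (hPQ : P =ᶠ[𝓝 t] Q) (h : CrossesAt P t x) :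
    CrossesAt Q t x := by
  refine ⟨hPQ.eq_of_nhds ▸ h.1, ?_, ?_⟩
  · filter_upwards [h.2.1, hPQ.filter_mono nhdsWithin_le_nhds] with s hs hs'
    rwa [← hs']
  · filter_upwards [h.2.2, hPQ.filter_mono nhdsWithin_le_nhds] with s hs hs'
    rwa [← hs']

theorem Reads.congr {w : List (Letter n)} (hPQ : ∀ t ∈ Ioc a b, P t = Q t) (h : Reads P b w a) :
    Reads Q b w a := by
  induction w generalizing a with
  | nil => exact fun t ht => hPQ t ht ▸ h t ht
  | cons x w ih =>
    obtain ⟨t, ht, h1, hc, hr⟩ := h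
    refine ⟨t, ht, fun s hs => hPQ s ⟨hs.1, (hs.2.trans ht.2).le⟩ ▸ h1 s hs, hc.congr ?_,
      ih (fun s hs => hPQ s ⟨ht.1.trans hs.1, hs.2⟩) hr⟩
    filter_upwards [Ioo_mem_nhds ht.1 ht.2] with s hs
    exact hPQ s ⟨hs.1, hs.2.le⟩

theorem Reads.comp {w : List (Letter n)} {φ : ℝ → ℝ} {u v : ℝ} (huv : u ≤ v) (hc : Continuous φ)
    (hm : StrictMonoOn φ (Icc u v)) (h : Reads P (φ v) w (φ u)) :
    Reads (fun t => P (φ t)) v w u := by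
  induction w generalizing u with
  | nil =>
    intro t ht
    exact h _ ⟨hm ⟨le_rfl, huv⟩ (Ioc_subset_Icc_self ht) ht.1,
      hm.monotoneOn (Ioc_subset_Icc_self ht) ⟨huv, le_rfl⟩ ht.2⟩
  | cons x w ih =>
    obtain ⟨t', ht', h1, hcr, hr⟩ := h
    obtain ⟨t, ht, rfl⟩ := intermediate_value_Ioo huv hc.continuousOn ht'
    have hsub : Icc t v ⊆ Icc u v := Icc_subset_Icc_left ht.1.le
    have htm : t ∈ Icc u v := Ioo_subset_Icc_self ht
    refine ⟨t, ht, fun s hs => ?_, ⟨hcr.1, ?_, ?_⟩, ih ht.2.le (hm.mono hsub) hr⟩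
    · have hs' : s ∈ Icc u v := ⟨hs.1.le, (hs.2.trans ht.2).le⟩
      exact h1 _ ⟨hm ⟨le_rfl, huv⟩ hs' hs.1, hm hs' htm hs.2⟩
    · have : Tendsto φ (𝓝[<] t) (𝓝[<] φ t) := by
        refine tendsto_nhdsWithin_iff.2 ⟨(hc.tendsto t).mono_left nhdsWithin_le_nhds, ?_⟩
        filter_upwards [Ioo_mem_nhdsLT ht.1] with s hs
        exact hm ⟨hs.1.le, (hs.2.trans ht.2).le⟩ htm hs.2
      exact this.eventually hcr.2.1
    · have : Tendsto φ (𝓝[>] t) (𝓝[>] φ t) := by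
        refine tendsto_nhdsWithin_iff.2 ⟨(hc.tendsto t).mono_left nhdsWithin_le_nhds, ?_⟩
        filter_upwards [Ioo_mem_nhdsGT ht.2] with s hs
        exact hm htm ⟨(ht.1.trans hs.1).le, hs.2.le⟩ hs.1
      exact this.eventually hcr.2.2

theorem CrossesAt.reverse {t : ℝ} {x : Letter n} (h : CrossesAt P t x) (c : ℝ) :
    CrossesAt (fun s => P (c - s)) (c - t) x.bar := by
  have hlim : Tendsto (fun s => c - s) (𝓝 (c - t)) (𝓝 t) := by
    have : Continuous fun s : ℝ => c - s := by fun_prop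
    simpa using this.tendsto (c - t)
  refine ⟨?_, ?_, ?_⟩
  · simp only [sub_sub_cancel]
    rw [h.1, Wedge.loopL_bar]
    norm_num
  · have : Tendsto (fun s => c - s) (𝓝[<] (c - t)) (𝓝[>] t) := by
      refine tendsto_nhdsWithin_iff.2 ⟨hlim.mono_left nhdsWithin_le_nhds, ?_⟩
      filter_upwards [self_mem_nhdsWithin] with s hs
      have : s < c - t := hs
      show t < c - s
      linarith
    filter_upwards [this.eventually h.2.2] with s hs
    obtain ⟨r, hr, hrs⟩ := hs
    exact ⟨1 - r, ⟨by linarith [hr.2], by linarith [hr.1]⟩, by rw [hrs, Wedge.loopL_bar]; simp⟩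
  · have : Tendsto (fun s => c - s) (𝓝[>] (c - t)) (𝓝[<] t) := by
      refine tendsto_nhdsWithin_iff.2 ⟨hlim.mono_left nhdsWithin_le_nhds, ?_⟩
      filter_upwards [self_mem_nhdsWithin] with s hs
      have : c - t < s := hs
      show c - s < t
      linarith
    filter_upwards [this.eventually h.2.1] with s hs
    obtain ⟨r, hr, hrs⟩ := hs
    exact ⟨1 - r, ⟨by linarith [hr.2], by linarith [hr.1]⟩, by rw [hrs, Wedge.loopL_bar]; simp⟩

theorem CrossesAt.notMem_mid_right {t : ℝ} {x : Letter n} (h : CrossesAt P t x) (htb : t < b) :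
    ∃ q ∈ Ioo t b, ∀ s ∈ Ioc t q, P s ∉ Wedge.mid n := by
  obtain ⟨q, hq, hq'⟩ := mem_nhdsGT_iff_exists_Ioo_subset.1 h.2.2
  obtain ⟨q', h1, h2⟩ := exists_between (lt_min hq htb)
  refine ⟨q', ⟨h1, h2.trans_le (min_le_right _ _)⟩, fun s hs => ?_⟩
  obtain ⟨r, hr, hrs⟩ := hq' ⟨hs.1, hs.2.trans_lt (h2.trans_le (min_le_left _ _))⟩
  rw [hrs, Wedge.loopL_mem_mid ⟨by linarith [hr.1], hr.2⟩]
  exact hr.1.ne'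

theorem Reads.reverse {w : List (Letter n)} (hab : a ≤ b) (h : Reads P b w a)
    (ha : P a ∉ Wedge.mid n) (c : ℝ) :
    Reads (fun s => P (c - s)) (c - a) (barWord w) (c - b) := by
  induction w generalizing a with
  | nil =>
    intro t ht
    rcases ht.2.eq_or_lt with rfl | h'
    · simpa using ha
    · exact h _ ⟨by linarith, by linarith [ht.1]⟩
  | cons x w ih =>
    obtain ⟨t, ht, h1, hcr, hr⟩ := h
    obtain ⟨q, hq, hq'⟩ := hcr.notMem_mid_right ht.2
    rw [barWord_cons]
    refine Reads.append (c := c - q) (by linarith [hq.2]) (by linarith [hq.1, ht.1])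
      (ih hq.2.le (hr.shrink hq.1.le hq') (hq' q ⟨hq.1, le_rfl⟩))
      ⟨c - t, ⟨by linarith [hq.1], by linarith [ht.1]⟩, fun s hs => ?_, hcr.reverse c, fun s hs => ?_⟩
    · exact hq' _ ⟨by linarith [hs.2], by linarith [hs.1]⟩
    · rcases hs.2.eq_or_lt with rfl | h'
      · simpa using ha
      · exact h1 _ ⟨by linarith, by linarith [hs.1]⟩

/-- A path that runs along one letter past its midpoint reads this letter. -/
theorem reads_singleton {x : Letter n} {φ : ℝ → ℝ} (hc : Continuous φ)
    (hm : StrictMonoOn φ (Icc a b)) (hab : a < b) (ha : φ a < 1 / 2) (hb : 1 / 2 < φ b)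
    (ha0 : 0 ≤ φ a) (hb1 : φ b ≤ 1) (h : ∀ t ∈ Icc a b, P t = Wedge.loopL x (φ t)) :
    Reads P b [x] a := by
  obtain ⟨t, ht, htφ⟩ := intermediate_value_Ioo hab.le hc.continuousOn ⟨ha, hb⟩
  have htm := Ioo_subset_Icc_self ht
  have hlo : ∀ s ∈ Ioo a t, φ s ∈ Ioo (0 : ℝ) (1 / 2) ∧ P s = Wedge.loopL x (φ s) := by
    intro s hs
    have hs' : s ∈ Icc a b := ⟨hs.1.le, (hs.2.trans ht.2).le⟩
    exact ⟨⟨ha0.trans_lt (hm ⟨le_rfl, hab.le⟩ hs' hs.1), htφ ▸ hm hs' htm hs.2⟩, h s hs'⟩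
  have hhi : ∀ s ∈ Ioo t b, φ s ∈ Ioo (1 / 2 : ℝ) 1 ∧ P s = Wedge.loopL x (φ s) := by
    intro s hs
    have hs' : s ∈ Icc a b := ⟨(ht.1.trans hs.1).le, hs.2.le⟩
    exact ⟨⟨htφ ▸ hm htm hs' hs.1, (hm hs' ⟨hab.le, le_rfl⟩ hs.2).trans_le hb1⟩, h s hs'⟩
  refine ⟨t, ht, fun s hs => ?_, ⟨by rw [h t htm, htφ], ?_, ?_⟩, fun s hs => ?_⟩
  · obtain ⟨h1, h2⟩ := hlo s hs
    rw [h2, Wedge.loopL_mem_mid ⟨h1.1, by linarith [h1.2]⟩]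
    exact h1.2.ne
  · filter_upwards [Ioo_mem_nhdsLT ht.1] with s hs
    exact ⟨φ s, (hlo s hs).1, (hlo s hs).2⟩
  · filter_upwards [Ioo_mem_nhdsGT ht.2] with s hs
    exact ⟨φ s, (hhi s hs).1, (hhi s hs).2⟩
  · rcases hs.2.eq_or_lt with rfl | h'
    · rw [h s ⟨hab.le, le_rfl⟩]
      rcases hb1.eq_or_lt with h1 | h1
      · rw [h1, Wedge.loopL_one]
        exact fun hmid => Wedge.base_notMem_zone le_rfl
          (Wedge.mid_subset_zone (by norm_num) hmid)
      · rw [Wedge.loopL_mem_mid ⟨by linarith, h1⟩]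
        exact hb.ne'
    · obtain ⟨h1, h2⟩ := hhi s ⟨hs.1, h'⟩
      rw [h2, Wedge.loopL_mem_mid ⟨by linarith [h1.1], h1.2⟩]
      exact h1.1.ne'

theorem reads_wordPath (w : List (Letter n)) : Reads (wordPath w) w.length w 0 := by
  induction w with
  | nil =>
    intro t _ hmid
    exact Wedge.base_notMem_zone le_rfl (Wedge.mid_subset_zone (by norm_num) hmid)
  | cons x w ih =>
    have h0 : (0 : ℝ) ≤ w.length := Nat.cast_nonneg _
    rw [List.length_cons]
    push_cast
    refine Reads.append (w := [x]) (c := 1) zero_le_one (by linarith) ?_ ?_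
    · refine reads_singleton (φ := id) continuous_id (strictMono_id.strictMonoOn _) one_pos
        (by norm_num) (by norm_num) le_rfl le_rfl fun t ht => ?_
      rw [wordPath_cons_of_le _ _ ht.2, clamp_of_mem ht]
      rfl
    · have h := Reads.comp (P := wordPath w) (φ := fun t => t - 1) (u := 1) (v := w.length + 1)
        (w := w) (by linarith) (by fun_prop) (fun s _ t _ hst => by simpa using hst)
        (by simpa using ih)
      exact h.congr fun t ht => (wordPath_cons_of_ge _ _ ht.1.le).symm

/-- A taut path that reads no letter and starts and ends outside the middle part of the circles
stays outside. -/
theorem IsTaut.notMem_zone (h : IsTaut P a b) {e : ℝ} (he : 0 < e) (he2 : e < 1 / 2)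
    (ha : P a ∉ Wedge.zone n e) (hb : P b ∉ Wedge.zone n e)
    (h0 : ∀ t ∈ Ioc a b, P t ∉ Wedge.mid n) {t : ℝ} (ht : t ∈ Icc a b) : P t ∉ Wedge.zone n e := by
  intro htz
  obtain ⟨u, v, x, φ, hau, hut, htv, hvb, hc, hm, hu, hv, hP, -⟩ :=
    h.exists_passage he ht htz ha hb
  have hmem : (1 / 2 : ℝ) ∈ Icc (φ u) (φ v) := by
    rw [hu, hv]
    exact ⟨he2.le, by linarith⟩
  obtain ⟨s, hs, hsφ⟩ := intermediate_value_Icc (hut.trans htv).le hc.continuousOn hmem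
  have hus : u < s := lt_of_le_of_ne hs.1 (by rintro rfl; linarith)
  refine h0 s ⟨hau.trans_lt hus, hs.2.trans hvb⟩ ?_
  rw [hP s hs, hsφ]
  exact (Wedge.loopL_mem_mid (by norm_num)).2 rfl

/-- If a path `R` reads the word `τ x` whenever the taut path `P` passes the letter `x`, and
crosses no midpoint while `P` is close to the base point, then `R` reads the image under `τ` of
the word that `P` reads. -/
theorem Reads.transfer {m : ℕ} [NeZero m] {R : ℝ → Wedge m} {e : ℝ} (he : 0 < e) (he2 : e < 1 / 2)
    (hP : IsTaut P a b) (hab : a ≤ b) {τ : Letter n → List (Letter m)}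
    (h1 : ∀ t ∈ Icc a b, P t ∉ Wedge.zone n e → R t ∉ Wedge.mid m)
    (h2 : ∀ (u v : ℝ) (x : Letter n) (φ : ℝ → ℝ), a ≤ u → u < v → v ≤ b → Continuous φ →
      StrictMonoOn φ (Icc u v) → φ u = e → φ v = 1 - e →
      (∀ s ∈ Icc u v, P s = Wedge.loopL x (φ s)) → Reads R v (τ x) u)
    (ha : P a ∉ Wedge.zone n e) (hb : P b ∉ Wedge.zone n e) {w : List (Letter n)}
    (h : Reads P b w a) : Reads R b (w.flatMap τ) a := by
  induction w generalizing a with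
  | nil =>
    intro t ht
    exact h1 t (Ioc_subset_Icc_self ht) (hP.notMem_zone he he2 ha hb h (Ioc_subset_Icc_self ht))
  | cons x w ih =>
    obtain ⟨t, ht, hbefore, hcr, hr⟩ := h
    obtain ⟨u, v, y, φ, hau, hut, htv, hvb, hc, hm, hu, hv, hPφ, huz, hvz⟩ :=
      hP.exists_passage he (Ioo_subset_Icc_self ht) (Wedge.mid_subset_zone he2 hcr.mem_mid) ha hb
    have huv := hut.trans htv
    have hmu : u ∈ Icc u v := ⟨le_rfl, huv.le⟩
    have hmv : v ∈ Icc u v := ⟨huv.le, le_rfl⟩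
    have hread : Reads P v [y] u :=
      reads_singleton hc hm huv (by linarith) (by linarith) (by linarith) (by linarith) hPφ
    obtain ⟨t', ht', hb', hcr', hafter⟩ := hread
    have htt : t = t' := by
      rcases lt_trichotomy t t' with hlt | he | hlt
      · exact absurd hcr.mem_mid (hb' t ⟨hut, hlt⟩)
      · exact he
      · exact absurd hcr'.mem_mid (hbefore t' ⟨hau.trans_lt ht'.1, hlt⟩)
    subst htt
    obtain rfl := hcr.unique hcr'
    have hr' : Reads P b w v := hr.shrink htv.le hafter
    rw [List.flatMap_cons]
    have hA : Reads R u [] a := fun s hs => by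
      have hs' : s ∈ Icc a u := Ioc_subset_Icc_self hs
      refine h1 s ⟨hs'.1, hs'.2.trans (huv.le.trans hvb)⟩ ?_
      exact (hP.mono le_rfl (huv.le.trans hvb)).notMem_zone he he2 ha huz
        (fun r hr => hbefore r ⟨hr.1, hr.2.trans_lt hut⟩) hs'
    have hB : Reads R v (τ x) u := h2 u v x φ hau huv hvb hc hm hu hv hPφ
    have hC : Reads R b (w.flatMap τ) v := by
      refine ih (hP.mono (hau.trans huv.le) le_rfl) hvb (fun s hs => h1 s ⟨?_, hs.2⟩) ?_ hvz hr'
      · exact (hau.trans huv.le).trans hs.1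
      · intro u' v' x' φ' hu'
        exact h2 u' v' x' φ' ((hau.trans huv.le).trans hu')
    exact (Reads.append (w := []) hau huv.le hA hB).append (hau.trans huv.le) hvb hC

/-- Taut paths that are uniformly close to each other read the same word. -/
theorem Reads.of_close (hP : IsTaut P a b) (hQ : IsTaut Q a b) (hab : a ≤ b)
    (hclose : ∀ t ∈ Icc a b, dist (P t) (Q t) < 1 / 8) (ha : P a ∉ Wedge.zone n (1 / 4))
    (hb : P b ∉ Wedge.zone n (1 / 4)) {w : List (Letter n)} (h : Reads P b w a) :
    Reads Q b w a := by
  have key : Reads Q b (w.flatMap fun x => [x]) a := by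
    refine h.transfer (by norm_num) (by norm_num) hP hab (fun t ht hz hmid => hz ?_) ?_ ha hb
    · exact Wedge.mem_zone_of_dist_mid hmid ((hclose t ht).trans (by norm_num))
    · intro u v x φ hau huv hvb hc hm hu hv hPφ
      have hmu : u ∈ Icc u v := ⟨le_rfl, huv.le⟩
      have hmv : v ∈ Icc u v := ⟨huv.le, le_rfl⟩
      have hφ : ∀ s ∈ Icc u v, φ s ∈ Icc (1 / 4 : ℝ) (3 / 4) := fun s hs => by
        have e1 := hm.monotoneOn hmu hs hs.1
        have e2 := hm.monotoneOn hs hmv hs.2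
        exact ⟨by linarith, by linarith⟩
      have hcl : ∀ s ∈ Icc u v, dist (Wedge.loopL x (φ s)) (Q s) < 1 / 8 := fun s hs => by
        rw [← hPφ s hs]
        exact hclose s ⟨hau.trans hs.1, hs.2.trans hvb⟩
      -- `P` stays in the middle half of the circle, so that `Q` avoids the base point
      obtain ⟨z, φ', hc', hm', hQφ⟩ := hQ.exists_segment hau huv hvb fun s hs hbase => by
        have h1 := (Wedge.dist_lt_iff (by norm_num)).1 (hcl s hs) x.1
        have h2 := hφ s hs
        rw [hbase, Wedge.proj_base, Wedge.loopL, Wedge.proj_loop, if_pos rfl,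
          ← AddCircle.coe_zero] at h1
        split_ifs at h1
        · have h3 := abs_lt.1 (Wedge.abs_sub_lt_of_dist_coe h2 (by simp) h1)
          linarith [h2.1, h3.2]
        · have h3 := abs_lt.1 (Wedge.abs_sub_lt_of_dist_coe
            ⟨by linarith [h2.2], by linarith [h2.1]⟩ (by simp) h1)
          linarith [h2.2, h3.2]
      have hz : ∀ s ∈ Icc u v, (z = x ∧ |φ s - φ' s| < 1 / 8) ∨
          (z = x.bar ∧ |φ s - (1 - φ' s)| < 1 / 8) := fun s hs =>
        Wedge.loopL_close (hφ s hs) (hQφ s hs).1 ((hQφ s hs).2 ▸ hcl s hs)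
      have hbar : x ≠ x.bar := fun h => by
        have := congrArg Prod.snd h
        simp [Letter.bar] at this
      -- if `Q` ran backwards, its parameter would decrease from about `3 / 4` to about `1 / 4`
      have hzx : z = x := by
        rcases hz u hmu with ⟨h', -⟩ | ⟨h', hu'⟩
        · exact h'
        · rcases hz v hmv with ⟨h'', -⟩ | ⟨-, hv'⟩
          · exact h''
          · have := hm' hmu hmv huv
            have e1 := abs_lt.1 hu'
            have e2 := abs_lt.1 hv'
            linarith [e1.1, e1.2, e2.1, e2.2]
      subst hzx
      have hz' : ∀ s ∈ Icc u v, |φ s - φ' s| < 1 / 8 := fun s hs => by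
        rcases hz s hs with ⟨-, h'⟩ | ⟨h', -⟩
        · exact h'
        · exact absurd h' hbar
      have e1 := abs_lt.1 (hz' u hmu)
      have e2 := abs_lt.1 (hz' v hmv)
      exact reads_singleton hc' hm' huv (by linarith [e1.1]) (by linarith [e2.2])
        (hQφ u hmu).1.1.le (hQφ v hmv).1.2.le fun s hs => (hQφ s hs).2
  simpa using key

/-- A taut path reads some word. -/
theorem IsTaut.exists_reads (hP : IsTaut P a b) (hab : a ≤ b) {e : ℝ} (he : 0 < e)
    (he2 : e < 1 / 2) (ha : P a ∉ Wedge.zone n e) (hb : P b ∉ Wedge.zone n e) :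
    ∃ w, Reads P b w a := by
  obtain ⟨η, hη, hunif⟩ := Metric.uniformContinuousOn_iff.1
    (isCompact_Icc.uniformContinuousOn_of_continuous (hP.cont.continuousOn (s := Icc a b)))
    (1 / 2 - e) (by linarith)
  -- each passage takes at least the time `η`
  have main : ∀ N : ℕ, ∀ a' b' : ℝ, a ≤ a' → a' ≤ b' → b' ≤ b → b' - a' ≤ N * η →
      P a' ∉ Wedge.zone n e → P b' ∉ Wedge.zone n e → ∃ w, Reads P b' w a' := by
    intro N
    induction N with
    | zero =>
      intro a' b' h1 h2 h3 h4 _ _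
      refine ⟨[], fun t ht => ?_⟩
      simp only [Nat.cast_zero, zero_mul] at h4
      linarith [ht.1, ht.2]
    | succ N ih =>
      intro a' b' h1 h2 h3 h4 ha' hb'
      by_cases hz : ∃ t ∈ Icc a' b', P t ∈ Wedge.zone n e
      · obtain ⟨t, ht, htz⟩ := hz
        obtain ⟨u, v, x, φ, hau, hut, htv, hvb, hc, hm, hu, hv, hPφ, huz, hvz⟩ :=
          (hP.mono h1 h3).exists_passage he ht htz ha' hb'
        have huv := hut.trans htv
        have hlong : η ≤ v - u := by
          by_contra hcon
          rw [not_le] at hcon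
          have hmem : (1 / 2 : ℝ) ∈ Icc (φ u) (φ v) := by
            rw [hu, hv]
            exact ⟨he2.le, by linarith⟩
          obtain ⟨s, hs, hsφ⟩ := intermediate_value_Icc huv.le hc.continuousOn hmem
          have hd := hunif u ⟨h1.trans hau, (huv.le.trans hvb).trans h3⟩ s
            ⟨(h1.trans hau).trans hs.1, (hs.2.trans hvb).trans h3⟩ (by
              rw [Real.dist_eq, abs_sub_comm, abs_of_nonneg (by linarith [hs.1])]
              linarith [hs.2])
          rw [hPφ u ⟨le_rfl, huv.le⟩, hPφ s hs, hu, hsφ] at hd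
          have hd' := (Wedge.dist_lt_iff (by linarith)).1 hd x.1
          rw [Wedge.loopL, Wedge.loopL, Wedge.proj_loop, Wedge.proj_loop, if_pos rfl,
            if_pos rfl] at hd'
          split_ifs at hd'
          · rw [Wedge.dist_coe_eq (abs_le.2 ⟨by linarith, by linarith⟩)] at hd'
            linarith [(abs_lt.1 hd').1]
          · rw [Wedge.dist_coe_eq (abs_le.2 ⟨by linarith, by linarith⟩)] at hd'
            linarith [(abs_lt.1 hd').2]
        push_cast at h4
        obtain ⟨w₁, hw₁⟩ := ih a' u h1 hau ((huv.le.trans hvb).trans h3)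
          (by linarith) ha' huz
        obtain ⟨w₂, hw₂⟩ := ih v b' ((h1.trans hau).trans huv.le) hvb h3 (by linarith) hvz hb'
        have hmid : Reads P v [x] u :=
          reads_singleton hc hm huv (by linarith) (by linarith) (by linarith) (by linarith) hPφ
        exact ⟨w₁ ++ [x] ++ w₂, (hw₁.append hau huv.le hmid).append (hau.trans huv.le) hvb hw₂⟩
      · refine ⟨[], fun t ht hmid => hz ⟨t, Ioc_subset_Icc_self ht, ?_⟩⟩
        exact Wedge.mid_subset_zone he2 hmid
  obtain ⟨N, hN⟩ := exists_nat_ge ((b - a) / η)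
  exact main N a b le_rfl hab le_rfl ((div_le_iff₀ hη).1 hN) ha hb

end reads

/-! ### Compactness of the inverse limit -/

section compact

set_option linter.unusedSectionVars false

variable {X Y : Type*} [MetricSpace X] [MetricSpace Y]

theorem InverseLimit.isClosed_setOf {f : X → X} (hf : Continuous f) :
    IsClosed {x : ℕ → X | ∀ k, f (x (k + 1)) = x k} := by
  simp only [ofPred_forall]
  exact isClosed_iInter fun k => isClosed_eq (hf.comp (continuous_apply _)) (continuous_apply k)

theorem InverseLimit.compactSpace [CompactSpace X] {f : X → X} (hf : Continuous f) :
    CompactSpace (InverseLimit f) :=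
  isCompact_iff_compactSpace.1 (InverseLimit.isClosed_setOf hf).isCompact

theorem InverseLimit.eq_of_le {f : X → X} {y z : InverseLimit f} {k N : ℕ} (hkN : k ≤ N)
    (h : y.1 N = z.1 N) : y.1 k = z.1 k := by
  obtain ⟨d, rfl⟩ := Nat.exists_eq_add_of_le hkN
  rw [← y.iterate_apply k d, ← z.iterate_apply k d, h]

theorem exists_eq_empty_of_antitone {Z : Type*} [TopologicalSpace Z] [CompactSpace Z]
    {K : ℕ → Set Z} (hK : ∀ j, IsClosed (K j)) (hanti : ∀ j, K (j + 1) ⊆ K j)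
    (h : ⋂ j, K j = ∅) : ∃ j, K j = ∅ := by
  by_contra hcon
  push Not at hcon
  have := IsCompact.nonempty_iInter_of_sequence_nonempty_isCompact_isClosed K hanti hcon
    (hK 0).isCompact hK
  rw [h] at this
  exact this.ne_empty rfl

variable [CompactSpace X] {f : X → X} {g : Y → Y}

/-- Points that agree at a high level have images that are close to each other. -/
theorem InverseLimit.exists_level_dist_lt (hf : Continuous f)
    {h : InverseLimit f → InverseLimit g} (hh : Continuous h) (k : ℕ) {ε : ℝ} (hε : 0 < ε) :
    ∃ N₀, ∀ N ≥ N₀, ∀ y z : InverseLimit f, y.1 N = z.1 N →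
      dist ((h y).1 k) ((h z).1 k) < ε := by
  have := InverseLimit.compactSpace hf
  let K : ℕ → Set (InverseLimit f × InverseLimit f) := fun N =>
    {p | p.1.1 N = p.2.1 N ∧ ε ≤ dist ((h p.1).1 k) ((h p.2).1 k)}
  have hc : Continuous fun y => (h y).1 k := (InverseLimit.continuous_val k).comp hh
  obtain ⟨N₀, hN₀⟩ := exists_eq_empty_of_antitone (K := K)
    (fun N => (isClosed_eq ((InverseLimit.continuous_val N).comp continuous_fst)
      ((InverseLimit.continuous_val N).comp continuous_snd)).inter
      (isClosed_le continuous_const ((hc.comp continuous_fst).dist (hc.comp continuous_snd))))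
    (fun N p hp => ⟨InverseLimit.eq_of_le (Nat.le_succ N) hp.1, hp.2⟩) (by
      rw [eq_empty_iff_forall_notMem]
      intro p hp
      rw [mem_iInter] at hp
      have he : p.1 = p.2 := Subtype.ext (funext fun N => (hp N).1)
      have := (hp 0).2
      rw [he, dist_self] at this
      linarith)
  refine ⟨N₀, fun N hN y z hyz => ?_⟩
  by_contra hcon
  have : (y, z) ∈ K N₀ := ⟨InverseLimit.eq_of_le hN hyz, not_lt.1 hcon⟩
  rw [hN₀] at this
  exact this

end compact

/-! ### Paths in the inverse limit of a linear model -/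

section linMap

variable {n m : ℕ} [NeZero n] [NeZero m]

/-- A word path is injective on intervals on which it avoids the base point, as such an interval
lies within a single letter. -/
theorem injOn_wordPath (w : List (Letter n)) {p q : ℝ}
    (h : ∀ s ∈ Icc p q, wordPath w s ≠ Wedge.base n) : InjOn (wordPath w) (Icc p q) := by
  induction w generalizing p q with
  | nil => exact fun s hs => absurd rfl (h s hs)
  | cons x w ih =>
    rcases lt_or_ge q p with hqp | hpq
    · rw [Icc_eq_empty (not_le.2 hqp)]
      exact injOn_empty _
    have h1 : wordPath (x :: w) 1 = Wedge.base n := by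
      rw [wordPath_cons_of_ge _ _ le_rfl, sub_self, wordPath_of_nonpos _ le_rfl]
    rcases lt_or_ge q 1 with hq | hq
    · have hp : 0 < p := by
        by_contra hcon
        exact h p ⟨le_rfl, hpq⟩ (wordPath_of_nonpos _ (not_lt.1 hcon))
      have hI : ∀ s ∈ Icc p q, s ∈ Ioo (0 : ℝ) 1 := fun s hs =>
        ⟨hp.trans_le hs.1, hs.2.trans_lt hq⟩
      intro s hs t ht hst
      rw [wordPath_cons_of_le _ _ (hI s hs).2.le, wordPath_cons_of_le _ _ (hI t ht).2.le,
        clamp_of_mem (Ioo_subset_Icc_self (hI s hs)),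
        clamp_of_mem (Ioo_subset_Icc_self (hI t ht))] at hst
      exact Wedge.loopL_inj (hI s hs) (hI t ht) hst
    · have hp : 1 ≤ p := by
        by_contra hcon
        exact h 1 ⟨(not_le.1 hcon).le, hq⟩ h1
      have hinj := ih (p := p - 1) (q := q - 1) fun s hs => by
        have := h (s + 1) ⟨by linarith [hs.1], by linarith [hs.2]⟩
        rwa [wordPath_cons_of_ge _ _ (by linarith [hs.1]), add_sub_cancel_right] at this
      intro s hs t ht hst
      rw [wordPath_cons_of_ge _ _ (hp.trans hs.1), wordPath_cons_of_ge _ _ (hp.trans ht.1)] at hst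
      have := hinj ⟨by linarith [hs.1], by linarith [hs.2]⟩
        ⟨by linarith [ht.1], by linarith [ht.2]⟩ hst
      linarith

/-- The linear model is injective on connected sets whose image avoids the base point. -/
theorem injOn_linMap (χ : Substitution n m) {D : Set (Wedge n)} (hD : IsPreconnected D)
    (h : ∀ x ∈ D, linMap χ x ≠ Wedge.base m) : InjOn (linMap χ) D := by
  rcases D.eq_empty_or_nonempty with rfl | hne
  · exact injOn_empty _
  obtain ⟨l, hl⟩ := Wedge.exists_proj_ne_zero_of_isPreconnected hD
    (fun hb => h _ hb (linMap_base χ)) hne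
  set c : Wedge n → ℝ := fun x => Wedge.coord (Wedge.proj l x) with hc
  have hcD : ContinuousOn c D := fun x hx =>
    (ContinuousAt.comp (f := Wedge.proj l) (Wedge.continuousAt_coord (hl x hx))
      (Wedge.continuous_proj l).continuousAt).continuousWithinAt
  have hord := (hD.image c hcD).ordConnected
  have hloop : ∀ x ∈ D, x = Wedge.loop l (c x) := fun x hx => by
    rw [Wedge.loop, Wedge.coe_coord]
    exact Wedge.eq_incl_of_proj_ne (hl x hx)
  have hlen := stretch_pos χ (l, true)
  have key : ∀ x ∈ D, ∀ y ∈ D, c x ≤ c y → linMap χ x = linMap χ y → x = y := by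
    intro x hx y hy hxy heq
    have hcI : ∀ z, c z ∈ Icc (0 : ℝ) 1 := fun z => Ico_subset_Icc_self (Wedge.coord_mem _)
    have hinj := injOn_wordPath (χ.onLetter (l, true)) (p := (χ.onLetter (l, true)).length * c x)
      (q := (χ.onLetter (l, true)).length * c y) fun s hs => by
        have hs' : s / (χ.onLetter (l, true)).length ∈ Icc (c x) (c y) :=
          ⟨by rw [le_div_iff₀ hlen, mul_comm]; exact hs.1,
            by rw [div_le_iff₀ hlen, mul_comm]; exact hs.2⟩
        obtain ⟨z, hz, hzs⟩ := hord.out ⟨x, hx, rfl⟩ ⟨y, hy, rfl⟩ hs'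
        have h1 := h z hz
        rw [hloop z hz, linMap_loop χ l (hcI z), hzs, mul_div_cancel₀ _ hlen.ne'] at h1
        exact h1
    have heq' := heq
    rw [hloop x hx, hloop y hy, linMap_loop χ l (hcI x), linMap_loop χ l (hcI y)] at heq'
    have hle := mul_le_mul_of_nonneg_left hxy hlen.le
    have := mul_left_cancel₀ hlen.ne' (hinj ⟨le_rfl, hle⟩ ⟨hle, le_rfl⟩ heq')
    rw [hloop x hx, hloop y hy, this]
  intro x hx y hy heq
  rcases le_total (c x) (c y) with h' | h'
  · exact key x hx y hy h' heq
  · exact (key y hy x hx h' heq.symm).symm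

variable {χ : Substitution n n}

/-- On a connected set whose projection to level `N` avoids the base point, this projection is
injective: the projections to all higher levels avoid the base point as well, so that the linear
model is injective on each of them. -/
theorem InverseLimit.injOn_val {N : ℕ} {C : Set (InverseLimit (linMap χ))} (hC : IsPreconnected C)
    (h : ∀ z ∈ C, z.1 N ≠ Wedge.base n) : InjOn (fun z : InverseLimit (linMap χ) => z.1 N) C := by
  have hb : ∀ d, ∀ z ∈ C, z.1 (N + d) ≠ Wedge.base n := by
    intro d
    induction d with
    | zero => exact h
    | succ d ih =>
      intro z hz hbase
      refine ih z hz ?_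
      have := z.2 (N + d)
      rw [← this]
      exact (congrArg _ hbase).trans (linMap_base χ)
  intro y hy z hz hyz
  have key : ∀ d, y.1 (N + d) = z.1 (N + d) := by
    intro d
    induction d with
    | zero => exact hyz
    | succ d ih =>
      have hD : IsPreconnected ((fun z : InverseLimit (linMap χ) => z.1 (N + (d + 1))) '' C) :=
        hC.image _ (InverseLimit.continuous_val _).continuousOn
      refine injOn_linMap χ hD ?_ ⟨y, hy, rfl⟩ ⟨z, hz, rfl⟩ ?_
      · rintro - ⟨x, hx, rfl⟩
        exact (x.2 (N + d)).symm ▸ hb d x hx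
      · exact (y.2 (N + d)).trans (ih.trans (z.2 (N + d)).symm)
  exact Subtype.ext (funext fun k => InverseLimit.eq_of_le (Nat.le_add_left k N) (key k))

/-- The projections of an injective path in the inverse limit are taut. -/
theorem InverseLimit.isTaut {γ : ℝ → InverseLimit (linMap χ)} (hγ : Continuous γ) {a b : ℝ}
    (hinj : InjOn γ (Ioo a b)) (N : ℕ) : IsTaut (fun t => (γ t).1 N) a b := by
  have hc : Continuous fun t => (γ t).1 N := (InverseLimit.continuous_val N).comp hγ
  refine ⟨hc, fun t ht hne => ?_⟩
  have hU : {s | (γ s).1 N ≠ Wedge.base n} ∩ Ioo a b ∈ 𝓝 t :=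
    inter_mem ((Wedge.isClosed_base.isOpen_compl.preimage hc).mem_nhds hne) (Ioo_mem_nhds ht.1 ht.2)
  obtain ⟨ε, hε, hball⟩ := Metric.mem_nhds_iff.1 hU
  refine ⟨Metric.ball t ε, Metric.ball_mem_nhds t hε, fun r hr s hs hrs => ?_⟩
  have hC : IsPreconnected (γ '' Metric.ball t ε) :=
    (convex_ball t ε).isPreconnected.image γ hγ.continuousOn
  have := InverseLimit.injOn_val (N := N) hC (by
    rintro - ⟨s, hs, rfl⟩
    exact (hball hs).1) ⟨r, hr, rfl⟩ ⟨s, hs, rfl⟩ hrs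
  exact hinj (hball hr).2 (hball hs).2 this

/-- Every letter occurs in the image of some letter. -/
def Substitution.IsOnto (χ : Substitution n m) : Prop := ∀ x, ∃ y, x ∈ χ.onLetter y

/-- Paths along a letter lift through the linear model to paths along a letter. -/
theorem Substitution.IsOnto.exists_lift (hχ : χ.IsOnto) (x : Letter n) {α : ℝ → ℝ}
    (hα : Continuous α) (hα' : ∀ t, α t ∈ Icc (0 : ℝ) 1) :
    ∃ (y : Letter n) (β : ℝ → ℝ), Continuous β ∧ (∀ t, β t ∈ Icc (0 : ℝ) 1) ∧
      ∀ t, linMap χ (Wedge.loopL y (β t)) = Wedge.loopL x (α t) := by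
  obtain ⟨y, hy⟩ := hχ x
  obtain ⟨j, hj⟩ := List.get_of_mem hy
  have hlen := stretch_pos χ y
  have hβ : ∀ t, ((j : ℕ) + α t) / (χ.onLetter y).length ∈ Icc (0 : ℝ) 1 := by
    intro t
    have h0 : (0 : ℝ) ≤ (j : ℕ) := Nat.cast_nonneg _
    have h1 : ((j : ℕ) : ℝ) + 1 ≤ (χ.onLetter y).length := by exact_mod_cast j.2
    have h2 := hα' t
    refine ⟨div_nonneg (by linarith [h2.1]) hlen.le, ?_⟩
    rw [div_le_one hlen]
    linarith [h2.2]
  refine ⟨y, fun t => ((j : ℕ) + α t) / (χ.onLetter y).length,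
    (continuous_const.add hα).div_const _, hβ, fun t => ?_⟩
  rw [linMap_loopL χ y (hβ t), mul_div_cancel₀ _ hlen.ne', wordPath_get _ j (hα' t), hj]

/-- The inverse limit contains a path that projects at level `k` onto a given letter. -/
theorem InverseLimit.exists_edge (hχ : χ.IsOnto) (k : ℕ) (x : Letter n) :
    ∃ E : ℝ → InverseLimit (linMap χ), Continuous E ∧
      ∀ t, (E t).1 k = Wedge.loopL x (clamp t) := by
  let S := {p : Letter n × (ℝ → ℝ) // Continuous p.2 ∧ ∀ t, p.2 t ∈ Icc (0 : ℝ) 1}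
  have step : ∀ p : S, ∃ q : S, ∀ t,
      linMap χ (Wedge.loopL q.1.1 (q.1.2 t)) = Wedge.loopL p.1.1 (p.1.2 t) := by
    rintro ⟨⟨x, α⟩, hα, hα'⟩
    obtain ⟨y, β, hβ, hβ', h⟩ := hχ.exists_lift x hα hα'
    exact ⟨⟨⟨y, β⟩, hβ, hβ'⟩, h⟩
  choose next hnext using step
  let q : ℕ → S := fun j => Nat.rec ⟨⟨x, clamp⟩, continuous_clamp, clamp_mem⟩ (fun _ => next) j
  have hq : ∀ j t, linMap χ (Wedge.loopL (q (j + 1)).1.1 ((q (j + 1)).1.2 t)) =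
      Wedge.loopL (q j).1.1 ((q j).1.2 t) := fun j t => hnext (q j) t
  have hqj : ∀ j t, (linMap χ)^[j] (Wedge.loopL (q j).1.1 ((q j).1.2 t)) =
      Wedge.loopL x (clamp t) := by
    intro j t
    induction j with
    | zero => rfl
    | succ j ih => rw [Function.iterate_succ_apply, hq, ih]
  refine ⟨fun t => ⟨fun j => (linMap χ)^[k] (Wedge.loopL (q j).1.1 ((q j).1.2 t)), fun j => ?_⟩,
    InverseLimit.continuous_of_val fun j => ?_, fun t => hqj k t⟩
  · show linMap χ ((linMap χ)^[k] _) = _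
    rw [← Function.iterate_succ_apply' (linMap χ), Function.iterate_succ_apply, hq]
  · exact ((continuous_linMap χ).iterate k).comp
      ((Wedge.continuous_loopL _).comp (q j).2.1)

theorem InverseLimit.injOn_edge {E : ℝ → InverseLimit (linMap χ)} {k : ℕ} {x : Letter n}
    (hE : ∀ t, (E t).1 k = Wedge.loopL x (clamp t)) : InjOn E (Ioo 0 1) := by
  intro s hs t ht hst
  have h : (E s).1 k = (E t).1 k := by rw [hst]
  rw [hE, hE, clamp_of_mem (Ioo_subset_Icc_self hs), clamp_of_mem (Ioo_subset_Icc_self ht)] at h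
  exact Wedge.loopL_inj hs ht h

/-- The iterates of the linear model run along the iterates of the substitution. -/
theorem exists_iterate_linMap_loopL (χ : Substitution n n) (d : ℕ) (x : Letter n) :
    ∃ ρ : ℝ → ℝ, Continuous ρ ∧ StrictMonoOn ρ (Icc 0 1) ∧ ρ 0 = 0 ∧
      ρ 1 = (χ.onWord^[d] [x]).length ∧
      ∀ t ∈ Icc (0 : ℝ) 1, (linMap χ)^[d] (Wedge.loopL x t) = wordPath (χ.onWord^[d] [x]) (ρ t) := by
  induction d with
  | zero =>
    refine ⟨id, continuous_id, strictMono_id.strictMonoOn _, rfl, by simp, fun t ht => ?_⟩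
    exact (wordPath_singleton x ht).symm
  | succ d ih =>
    obtain ⟨ρ, hc, hm, h0, h1, h⟩ := ih
    have hmaps : ∀ t ∈ Icc (0 : ℝ) 1, ρ t ∈ Icc (0 : ℝ) (χ.onWord^[d] [x]).length := fun t ht =>
      ⟨h0 ▸ hm.monotoneOn ⟨le_rfl, zero_le_one⟩ ht ht.1,
        h1 ▸ hm.monotoneOn ht ⟨zero_le_one, le_rfl⟩ ht.2⟩
    have hstr : ∀ x, StrictMonoOn (stretch χ x) (Icc 0 1) := fun x s _ t _ hst =>
      mul_lt_mul_of_pos_left hst (stretch_pos χ x)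
    have hst := strictMonoOn_stair (monotone_stretch χ) hstr (χ.onWord^[d] [x])
    refine ⟨fun t => stair (stretch χ) (χ.onWord^[d] [x]) (ρ t),
      (continuous_stair (continuous_stretch χ) _).comp hc,
      fun s hs t ht hst' => hst (hmaps s hs) (hmaps t ht) (hm hs ht hst'), ?_, ?_, fun t ht => ?_⟩
    · simp only [h0]
      exact stair_of_nonpos (stretch_zero χ) _ le_rfl
    · simp only [h1]
      rw [stair_stretch_length, Function.iterate_succ_apply']
    · rw [Function.iterate_succ_apply', h t ht, linMap_wordPath, Function.iterate_succ_apply']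

theorem reads_iterate_linMap_loopL (χ : Substitution n n) (d : ℕ) (x : Letter n) :
    Reads (fun t => (linMap χ)^[d] (Wedge.loopL x (clamp t))) 1 (χ.onWord^[d] [x]) 0 := by
  obtain ⟨ρ, hc, hm, h0, h1, h⟩ := exists_iterate_linMap_loopL χ d x
  have hr := reads_wordPath (χ.onWord^[d] [x])
  rw [← h0, ← h1] at hr
  refine (hr.comp zero_le_one hc hm).congr fun t ht => ?_
  have ht' := Ioc_subset_Icc_self ht
  rw [clamp_of_mem ht', h t ht']

/-- The point of the inverse limit all of whose coordinates are the base point. -/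
def InverseLimit.basePoint (χ : Substitution n n) : InverseLimit (linMap χ) :=
  ⟨fun _ => Wedge.base n, fun _ => linMap_base χ⟩

end linMap

/-! ### A homeomorphism that fixes the base point yields a weak equivalence -/

section transition

variable {n m : ℕ} [NeZero n] [NeZero m] {χ : Substitution n n} {ψ : Substitution m m}

theorem Wedge.base_notMem_closure_zone {e : ℝ} (he : 0 < e) :
    Wedge.base n ∉ closure (Wedge.zone n e) := by
  intro h
  obtain ⟨l, s, hs, h⟩ := Wedge.exists_loop_of_mem_closure_zone he h
  exact Wedge.loop_ne_base ⟨he.trans_le hs.1, hs.2.trans_lt (by linarith)⟩ h.symm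

/-- The points that are close to the base point at a high level form a basis of neighborhoods of
the base point of the inverse limit. -/
theorem InverseLimit.exists_level_mem {U : Set (InverseLimit (linMap χ))} (hU : IsOpen U)
    (hb : InverseLimit.basePoint χ ∈ U) :
    ∃ N₀, ∀ N ≥ N₀, ∃ e, 0 < e ∧ e ≤ 1 / 4 ∧ ∀ y : InverseLimit (linMap χ),
      y.1 N ∉ Wedge.zone n e → y ∈ U := by
  have := InverseLimit.compactSpace (continuous_linMap χ)
  obtain ⟨N₀, hN₀⟩ := exists_eq_empty_of_antitone
    (K := fun N => {y : InverseLimit (linMap χ) | y.1 N = Wedge.base n} ∩ Uᶜ)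
    (fun N => (isClosed_eq (InverseLimit.continuous_val N) continuous_const).inter
      hU.isClosed_compl)
    (fun N y hy => ⟨(InverseLimit.eq_of_le (z := InverseLimit.basePoint χ) (Nat.le_succ N) hy.1),
      hy.2⟩) (by
      rw [eq_empty_iff_forall_notMem]
      intro y hy
      rw [mem_iInter] at hy
      have he : y = InverseLimit.basePoint χ := Subtype.ext (funext fun N => (hy N).1)
      exact (hy 0).2 (he ▸ hb))
  refine ⟨N₀, fun N hN => ?_⟩
  have hpos : ∀ j : ℕ, (0 : ℝ) < 1 / (j + 4) := fun j => by positivity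
  obtain ⟨j, hj⟩ := exists_eq_empty_of_antitone
    (K := fun j : ℕ => {y : InverseLimit (linMap χ) | y.1 N ∈ (Wedge.zone n (1 / (j + 4)))ᶜ} ∩ Uᶜ)
    (fun j => ((Wedge.isOpen_zone (hpos j).le).isClosed_compl.preimage
      (InverseLimit.continuous_val N)).inter hU.isClosed_compl)
    (fun j y hy => ⟨fun hz => hy.1 (Wedge.zone_anti (by
      push_cast
      gcongr
      linarith) hz), hy.2⟩) (by
      rw [eq_empty_iff_forall_notMem]
      intro y hy
      rw [mem_iInter] at hy
      have hyb : y.1 N = Wedge.base n := by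
        by_contra hne
        obtain ⟨i, t, ht, hyt⟩ := Wedge.exists_loop_of_ne_base hne
        obtain ⟨j, hj⟩ := exists_nat_one_div_lt (lt_min ht.1 (sub_pos.2 ht.2))
        have hj' : (1 : ℝ) / (j + 4) ≤ 1 / (j + 1) := by
          gcongr
          norm_num
        have h1 := hj.trans_le (min_le_left _ _)
        have h2 := hj.trans_le (min_le_right _ _)
        exact (hy j).1 ⟨i, t, ⟨by linarith, by linarith⟩, hyt⟩
      have hmem : y ∈ {y : InverseLimit (linMap χ) | y.1 N₀ = Wedge.base n} ∩ Uᶜ :=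
        ⟨InverseLimit.eq_of_le (z := InverseLimit.basePoint χ) hN hyb, (hy 0).2⟩
      rw [hN₀] at hmem
      exact hmem)
  refine ⟨1 / (j + 4), hpos j, ?_, fun y hy => ?_⟩
  · rw [div_le_div_iff₀ (by positivity) (by norm_num)]
    have : (0 : ℝ) ≤ j := Nat.cast_nonneg _
    linarith
  · by_contra hz
    have hmem : y ∈ {y : InverseLimit (linMap χ) | y.1 N ∈ (Wedge.zone n (1 / (j + 4)))ᶜ} ∩ Uᶜ :=
      ⟨hy, hz⟩
    rw [hj] at hmem
    exact hmem

/-- The level `k` of the source of `h` controls the level `N` of the target: points that agree at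
level `k` have images that are close at level `N`, and points whose distance from the base point
at level `k` is at most `e` have images whose distance from it at level `N` is at most `e'`. -/
structure Controls (h : InverseLimit (linMap χ) → InverseLimit (linMap ψ)) (k : ℕ) (e : ℝ)
    (N : ℕ) (e' : ℝ) : Prop where
  close : ∀ y z : InverseLimit (linMap χ), y.1 k = z.1 k → dist ((h y).1 N) ((h z).1 N) < 1 / 8
  near : ∀ y : InverseLimit (linMap χ), y.1 k ∉ Wedge.zone n e → (h y).1 N ∉ Wedge.zone m e'

theorem exists_controls {h : InverseLimit (linMap χ) → InverseLimit (linMap ψ)}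
    (hh : Continuous h) (hb : h (InverseLimit.basePoint χ) = InverseLimit.basePoint ψ) (N : ℕ)
    {e' : ℝ} (he' : 0 < e') : ∃ k e, N < k ∧ 0 < e ∧ e ≤ 1 / 4 ∧ Controls h k e N e' := by
  obtain ⟨k₁, h₁⟩ := InverseLimit.exists_level_dist_lt (continuous_linMap χ) hh N
    (show (0 : ℝ) < 1 / 8 by norm_num)
  obtain ⟨k₂, h₂⟩ := InverseLimit.exists_level_mem
    (isClosed_closure.isOpen_compl.preimage ((InverseLimit.continuous_val N).comp hh))
    (show (h (InverseLimit.basePoint χ)).1 N ∈ (closure (Wedge.zone m e'))ᶜ by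
      rw [hb]
      exact Wedge.base_notMem_closure_zone he')
  obtain ⟨e, he, he4, h₃⟩ := h₂ (max (N + 1) (max k₁ k₂))
    ((le_max_right _ _).trans (le_max_right _ _))
  exact ⟨max (N + 1) (max k₁ k₂), e, Nat.lt_of_succ_le (le_max_left _ _), he, he4,
    ⟨h₁ _ ((le_max_left _ _).trans (le_max_right _ _)),
      fun y hy hz => h₃ y hy (subset_closure hz)⟩⟩

theorem Reads.trim_right {P : ℝ → Wedge n} {a b c : ℝ} {w : List (Letter n)} (hac : a ≤ c)
    (hcb : c ≤ b) (h0 : ∀ t ∈ Icc c b, P t ∉ Wedge.mid n) (h : Reads P b w a) : Reads P c w a := by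
  induction w generalizing a with
  | nil => exact fun t ht => h t ⟨ht.1, ht.2.trans hcb⟩
  | cons x w ih =>
    obtain ⟨t, ht, h1, hcr, hr⟩ := h
    have htc : t < c := by
      by_contra hcon
      exact h0 t ⟨not_lt.1 hcon, ht.2.le⟩ hcr.mem_mid
    exact ⟨t, ⟨ht.1, htc⟩, h1, hcr, ih htc.le hr⟩

/-- The word map `τ` describes `h` between the level `k` of the source and the level `N` of the
target: the image of a path that runs along the letter `x` at level `k` reads `τ x`. -/
def Describes (h : InverseLimit (linMap χ) → InverseLimit (linMap ψ)) (k : ℕ) (e : ℝ)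
    (N : ℕ) (τ : Letter n → List (Letter m)) : Prop :=
  ∀ (x : Letter n) (γ : ℝ → InverseLimit (linMap χ)) (u v : ℝ) (φ : ℝ → ℝ), Continuous γ →
    u < v → InjOn γ (Ioo u v) → Continuous φ → StrictMonoOn φ (Icc u v) → 0 ≤ φ u → φ u ≤ e →
    1 - e ≤ φ v → φ v ≤ 1 → (∀ s ∈ Icc u v, (γ s).1 k = Wedge.loopL x (φ s)) →
    Reads (fun s => (h (γ s)).1 N) v (τ x) u

/-- If the level `k` controls the level `N`, then `h` is described by a word map between these levels:
any two paths that run along the same letter at level `k` have images that are uniformly close at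
level `N` after a change of parameter, and hence read the same word. -/
theorem Controls.exists_describes {h : InverseLimit (linMap χ) → InverseLimit (linMap ψ)}
    {k N : ℕ} {e e' : ℝ} (hc : Controls h k e N e') (hh : Continuous h)
    (hinj : Function.Injective h) (hχ : χ.IsOnto) (he' : 0 < e') (he4' : e' ≤ 1 / 4)
    (he0 : 0 < e) :
    ∃ τ : Letter n → List (Letter m), (∀ x, τ x.bar = barWord (τ x)) ∧ Describes h k e N τ := by
  choose E hEc hE using fun x => InverseLimit.exists_edge hχ k x
  have hmid : ∀ y : InverseLimit (linMap χ), y.1 k ∉ Wedge.zone n e →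
      (h y).1 N ∉ Wedge.mid m := fun y hy hm =>
    hc.near y hy (Wedge.mid_subset_zone (by linarith) hm)
  have hend : ∀ (x : Letter n) t, t ∈ Icc (0 : ℝ) 1 → (t ≤ e ∨ 1 - e ≤ t) →
      Wedge.loopL x t ∉ Wedge.zone n e := by
    intro x t ht ht' hz
    rcases ht.1.eq_or_lt with rfl | h0
    · rw [Wedge.loopL_zero] at hz
      exact Wedge.base_notMem_zone he0.le hz
    rcases ht.2.eq_or_lt with rfl | h1
    · rw [Wedge.loopL_one] at hz
      exact Wedge.base_notMem_zone he0.le hz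
    rw [Wedge.loopL_mem_zone he0.le ⟨h0, h1⟩] at hz
    rcases ht' with ht' | ht'
    · exact absurd hz.1 (not_lt.2 ht')
    · exact absurd hz.2 (not_lt.2 ht')
  have hEI : ∀ x t, t ∈ Icc (0 : ℝ) 1 → (E x t).1 k = Wedge.loopL x t := fun x t ht => by
    rw [hE, clamp_of_mem ht]
  have htaut : ∀ x, IsTaut (fun t => (h (E x t)).1 N) 0 1 := fun x =>
    InverseLimit.isTaut (γ := fun t => h (E x t)) (hh.comp (hEc x))
      (hinj.comp_injOn (InverseLimit.injOn_edge (hE x))) N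
  have hnear : ∀ x t, t ∈ Icc (0 : ℝ) 1 → (t ≤ e ∨ 1 - e ≤ t) →
      (E x t).1 k ∉ Wedge.zone n e := fun x t ht ht' => by
    rw [hEI x t ht]
    exact hend x t ht ht'
  choose τ hτ using fun x => (htaut x).exists_reads zero_le_one he' (by linarith)
    (hc.near _ (hnear x 0 (by simp) (Or.inl he0.le)))
    (hc.near _ (hnear x 1 (by simp) (Or.inr (by linarith))))
  have hdesc : Describes h k e N τ := by
    intro x γ u v φ hγ huv hγi hφ hm hu0 hue hve hv1 hγφ
    have hmu : u ∈ Icc u v := ⟨le_rfl, huv.le⟩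
    have hmv : v ∈ Icc u v := ⟨huv.le, le_rfl⟩
    have hφI : ∀ s ∈ Icc u v, φ s ∈ Icc (0 : ℝ) 1 := fun s hs =>
      ⟨hu0.trans (hm.monotoneOn hmu hs hs.1), (hm.monotoneOn hs hmv hs.2).trans hv1⟩
    have hφuv : φ u < φ v := hm hmu hmv huv
    have h1 : Reads (fun t => (h (E x t)).1 N) 1 (τ x) (φ u) :=
      (hτ x).shrink hu0 fun t ht => hmid _
        (hnear x t ⟨ht.1.le, ht.2.trans (hφI u hmu).2⟩ (Or.inl (ht.2.trans hue)))
    have h2 : Reads (fun t => (h (E x t)).1 N) (φ v) (τ x) (φ u) :=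
      h1.trim_right hφuv.le hv1 fun t ht => hmid _
        (hnear x t ⟨(hφI v hmv).1.trans ht.1, ht.2⟩ (Or.inr (hve.trans ht.1)))
    have h3 := h2.comp huv.le hφ hm
    have hEφ : ∀ s ∈ Icc u v, (E x (φ s)).1 k = (γ s).1 k := fun s hs => by
      rw [hγφ s hs, hEI x _ (hφI s hs)]
    refine h3.of_close (InverseLimit.isTaut (γ := fun s => h (E x (φ s)))
      (hh.comp ((hEc x).comp hφ)) (hinj.comp_injOn ?_) N)
      (InverseLimit.isTaut (γ := fun s => h (γ s)) (hh.comp hγ) (hinj.comp_injOn hγi) N) huv.le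
      (fun s hs => hc.close _ _ (hEφ s hs)) (fun hz => ?_) fun hz => ?_
    · intro s hs t ht hst
      have hs' := Ioo_subset_Icc_self hs
      have ht' := Ioo_subset_Icc_self ht
      have hI : ∀ s ∈ Ioo u v, φ s ∈ Ioo (0 : ℝ) 1 := fun s hs =>
        ⟨hu0.trans_lt (hm hmu (Ioo_subset_Icc_self hs) hs.1),
          (hm (Ioo_subset_Icc_self hs) hmv hs.2).trans_le hv1⟩
      exact hm.injOn hs' ht' (InverseLimit.injOn_edge (hE x) (hI s hs) (hI t ht) hst)
    · exact hc.near _ (hnear x _ (hφI u hmu) (Or.inl hue)) (Wedge.zone_anti he4' hz)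
    · exact hc.near _ (hnear x _ (hφI v hmv) (Or.inr hve)) (Wedge.zone_anti he4' hz)
  refine ⟨τ, fun x => ?_, hdesc⟩
  have hr := (hτ x).reverse zero_le_one
    (hmid _ (hnear x 0 (by simp) (Or.inl he0.le))) 1
  rw [sub_zero, sub_self] at hr
  refine Reads.unique ?_ hr
  refine hdesc x.bar (fun s => E x (1 - s)) 0 1 id ((hEc x).comp (by fun_prop)) one_pos ?_
    continuous_id (strictMono_id.strictMonoOn _) le_rfl he0.le (by simp [he0.le]) le_rfl
    fun s hs => ?_
  · intro s hs t ht hst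
    have := InverseLimit.injOn_edge (hE x) (x₁ := 1 - s) (x₂ := 1 - t)
      ⟨by linarith [hs.2], by linarith [hs.1]⟩ ⟨by linarith [ht.2], by linarith [ht.1]⟩ hst
    linarith
  · rw [hEI x _ ⟨by linarith [hs.2], by linarith [hs.1]⟩, Wedge.loopL_bar]
    rfl

/-- Word maps that describe `h` and its inverse compose to a power of the substitution. -/
theorem Describes.flatMap {h : InverseLimit (linMap χ) → InverseLimit (linMap ψ)}
    {h' : InverseLimit (linMap ψ) → InverseLimit (linMap χ)} (hh : Continuous h)
    (hh' : Function.LeftInverse h' h) (hχ : χ.IsOnto) {k₀ k N : ℕ} {e₀ e e₁ : ℝ}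
    {σ : Letter m → List (Letter n)} {τ : Letter n → List (Letter m)}
    (he₀4 : e₀ ≤ 1 / 4) (he₁ : 0 < e₁) (he₁4 : e₁ ≤ 1 / 4) (he : 0 < e) (hk : k₀ ≤ k)
    (hc : Controls h k e N e₁) (hτ : Describes h k e N τ)
    (hc' : Controls h' N e₁ k₀ e₀) (hσ : Describes h' N e₁ k₀ σ) (x : Letter n) :
    (τ x).flatMap σ = χ.onWord^[k - k₀] [x] := by
  obtain ⟨E, hEc, hE⟩ := InverseLimit.exists_edge hχ k x
  have hinj := hh'.injective
  have hEi := InverseLimit.injOn_edge hE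
  have hEb : ∀ t, (t = 0 ∨ t = 1) → (E t).1 k ∉ Wedge.zone n e := by
    rintro t (rfl | rfl)
    · rw [hE, clamp_of_le le_rfl, Wedge.loopL_zero]
      exact Wedge.base_notMem_zone he.le
    · rw [hE, clamp_of_ge le_rfl, Wedge.loopL_one]
      exact Wedge.base_notMem_zone he.le
  have h1 : Reads (fun s => (h (E s)).1 N) 1 (τ x) 0 :=
    hτ x E 0 1 id hEc one_pos hEi continuous_id (strictMono_id.strictMonoOn _) le_rfl he.le
      (by simp [he.le]) le_rfl fun s hs => by
        rw [hE, clamp_of_mem hs]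
        rfl
  have h2 : Reads (fun s => (h' (h (E s))).1 k₀) 1 ((τ x).flatMap σ) 0 := by
    refine h1.transfer he₁ (by linarith) (InverseLimit.isTaut (γ := fun s => h (E s))
      (hh.comp hEc) (hinj.comp_injOn hEi) N) zero_le_one
      (fun t _ hz hm => hc'.near _ hz (Wedge.mid_subset_zone (by linarith) hm)) ?_
      (hc.near _ (hEb 0 (Or.inl rfl))) (hc.near _ (hEb 1 (Or.inr rfl)))
    intro u v y φ hu huv hv hφ hm hφu hφv hP
    exact hσ y (fun s => h (E s)) u v φ (hh.comp hEc) huv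
      ((hinj.comp_injOn hEi).mono (Ioo_subset_Ioo hu hv)) hφ hm (by linarith) hφu.le hφv.ge
      (by linarith) hP
  refine h2.unique ((reads_iterate_linMap_loopL χ (k - k₀) x).congr fun t _ => ?_)
  rw [hh', ← hE, ← (E t).iterate_apply k₀ (k - k₀), Nat.add_sub_cancel' hk]

/-- A homeomorphism of the inverse limits of linear models that maps base point to base point
yields a weak equivalence of the substitutions. -/
theorem weaklyEquivalent_of_homeomorph (hχ : χ.IsOnto) (hψ : ψ.IsOnto)
    (h : InverseLimit (linMap χ) ≃ₜ InverseLimit (linMap ψ))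
    (hb : h (InverseLimit.basePoint χ) = InverseLimit.basePoint ψ) : χ.WeaklyEquivalent ψ := by
  have hb' : h.symm (InverseLimit.basePoint ψ) = InverseLimit.basePoint χ := by
    rw [← hb, h.symm_apply_apply]
  let S := {p : ℕ × ℝ // 0 < p.2 ∧ p.2 ≤ 1 / 4}
  have stepB : ∀ p : S, ∃ q : S, p.1.1 < q.1.1 ∧
      Controls h.symm q.1.1 q.1.2 p.1.1 p.1.2 := by
    rintro ⟨⟨k, e⟩, he, he4⟩
    obtain ⟨N, e', hlt, he', he4', hc⟩ := exists_controls h.symm.continuous hb' k he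
    exact ⟨⟨⟨N, e'⟩, he', he4'⟩, hlt, hc⟩
  have stepA : ∀ p : S, ∃ q : S, p.1.1 < q.1.1 ∧ Controls h q.1.1 q.1.2 p.1.1 p.1.2 := by
    rintro ⟨⟨k, e⟩, he, he4⟩
    obtain ⟨N, e', hlt, he', he4', hc⟩ := exists_controls h.continuous hb k he
    exact ⟨⟨⟨N, e'⟩, he', he4'⟩, hlt, hc⟩
  choose nextB hB using stepB
  choose nextA hA using stepA
  -- levels of the two limits in turn, each controlling the preceding one
  let a : ℕ → S := fun i =>
    Nat.rec ⟨⟨0, 1 / 4⟩, by norm_num, le_rfl⟩ (fun _ p => nextA (nextB p)) i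
  let b : ℕ → S := fun i => nextB (a i)
  have hba : ∀ i, (a i).1.1 < (b i).1.1 ∧
      Controls h.symm (b i).1.1 (b i).1.2 (a i).1.1 (a i).1.2 := fun i => hB (a i)
  have hab : ∀ i, (b i).1.1 < (a (i + 1)).1.1 ∧
      Controls h (a (i + 1)).1.1 (a (i + 1)).1.2 (b i).1.1 (b i).1.2 := fun i => hA (b i)
  choose σ hσbar hσ using fun i => (hba i).2.exists_describes h.symm.continuous h.symm.injective hψ
    (a i).2.1 (a i).2.2 (b i).2.1
  choose τ hτbar hτ using fun i => (hab i).2.exists_describes h.continuous h.injective hχ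
    (b i).2.1 (b i).2.2 (a (i + 1)).2.1
  have hστ : ∀ i x, (τ i x).flatMap (σ i) = χ.onWord^[(a (i + 1)).1.1 - (a i).1.1] [x] :=
    fun i x => Describes.flatMap h.continuous h.symm_apply_apply hχ (a i).2.2 (b i).2.1 (b i).2.2
      (a (i + 1)).2.1 ((hba i).1.trans (hab i).1).le (hab i).2 (hτ i) (hba i).2 (hσ i) x
  have hτσ : ∀ i x, (σ (i + 1) x).flatMap (τ i) =
      ψ.onWord^[(b (i + 1)).1.1 - (b i).1.1] [x] :=
    fun i x => Describes.flatMap h.symm.continuous h.apply_symm_apply hψ (b i).2.2 (a (i + 1)).2.1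
      (a (i + 1)).2.2 (b (i + 1)).2.1 ((hab i).1.trans (hba (i + 1)).1).le (hba (i + 1)).2
      (hσ (i + 1)) (hab i).2 (hτ i) x
  have hτne : ∀ i x, τ i x ≠ [] := by
    intro i x hnil
    have := hστ i x
    rw [hnil, ← Substitution.onWord_iter] at this
    exact Substitution.onWord_ne_nil _ (List.cons_ne_nil x []) this.symm
  have hσne : ∀ i x, σ (i + 1) x ≠ [] := by
    intro i x hnil
    have := hτσ i x
    rw [hnil, ← Substitution.onWord_iter] at this
    exact Substitution.onWord_ne_nil _ (List.cons_ne_nil x []) this.symm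
  have hword : ∀ {p q : ℕ} (A : Letter p → List (Letter q)) (B : Letter q → List (Letter p))
      (D : Substitution p p), (∀ x, (A x).flatMap B = D.onLetter x) →
      ∀ w : List (Letter p), (w.flatMap A).flatMap B = D.onWord w := by
    intro p q A B D hAB w
    rw [List.flatMap_assoc]
    exact congrArg (fun F => w.flatMap F) (funext hAB)
  -- the indices are shifted by one, since `σ 0` is not known to take nonempty values
  refine ⟨fun i => (a (i + 2)).1.1 - (a (i + 1)).1.1, fun i => (b (i + 2)).1.1 - (b (i + 1)).1.1,
    fun i => ⟨σ (i + 1), hσne i, hσbar (i + 1)⟩, fun i => ⟨τ (i + 1), hτne (i + 1), hτbar (i + 1)⟩,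
    fun i => Nat.sub_pos_of_lt ((hba (i + 1)).1.trans (hab (i + 1)).1),
    fun i => Nat.sub_pos_of_lt ((hab (i + 1)).1.trans (hba (i + 2)).1), fun i w => ?_, fun i w => ?_⟩
  · rw [← Substitution.onWord_iter]
    refine hword (τ (i + 1)) (σ (i + 1)) _ (fun x => ?_) w
    rw [hστ, ← Substitution.onWord_iter, Substitution.onWord_singleton]
  · rw [← Substitution.onWord_iter]
    refine hword (σ (i + 2)) (τ (i + 1)) _ (fun x => ?_) w
    rw [hτσ, ← Substitution.onWord_iter, Substitution.onWord_singleton]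

end transition

/-! ### Iterates of a substitution on edge germs -/

section germs

variable {n : ℕ} {χ : Substitution n n}

theorem exists_mem_of_wordPath_ne_base [NeZero n] (w : List (Letter n)) {s : ℝ}
    (h : wordPath w s ≠ Wedge.base n) :
    ∃ y ∈ w, ∃ r ∈ Ioo (0 : ℝ) 1, wordPath w s = Wedge.loopL y r := by
  induction w generalizing s with
  | nil => exact absurd rfl h
  | cons x w ih =>
    rcases le_total s 1 with hs | hs
    · rw [wordPath_cons_of_le _ _ hs] at h ⊢
      refine ⟨x, List.mem_cons_self, clamp s, ⟨lt_of_le_of_ne (clamp_mem s).1 fun h0 => h ?_,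
        lt_of_le_of_ne (clamp_mem s).2 fun h1 => h ?_⟩, rfl⟩
      · rw [← h0, Wedge.loopL_zero]
      · rw [h1, Wedge.loopL_one]
    · rw [wordPath_cons_of_ge _ _ hs] at h ⊢
      obtain ⟨y, hy, r, hr, h'⟩ := ih h
      exact ⟨y, List.mem_cons_of_mem _ hy, r, hr, h'⟩

theorem Substitution.isOnto_of_surjective [NeZero n] (h : Function.Surjective (linMap χ)) :
    χ.IsOnto := by
  have hhalf : (1 / 2 : ℝ) ∈ Ioo (0 : ℝ) 1 := by norm_num
  intro x
  obtain ⟨z, hz⟩ := h (Wedge.loop x.1 (1 / 2))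
  obtain ⟨i, t, ht, rfl⟩ := Wedge.exists_loop z
  rw [linMap_loop χ i (Ico_subset_Icc_self ht)] at hz
  obtain ⟨y, hy, r, hr, h'⟩ := exists_mem_of_wordPath_ne_base _
    (hz ▸ Wedge.loop_ne_base hhalf)
  have h1 := (Wedge.loopL_eq_loop hr hhalf (h'.symm.trans hz)).1
  by_cases hyx : y = x
  · exact ⟨(i, true), hyx ▸ hy⟩
  · have hbar : x = y.bar := by
      refine Prod.ext h1.symm ?_
      have h2 : y.2 ≠ x.2 := fun h2 => hyx (Prod.ext h1 h2)
      show x.2 = !y.2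
      revert h2
      cases x.2 <;> cases y.2 <;> simp
    refine ⟨Letter.bar (i, true), ?_⟩
    rw [χ.map_bar, barWord, List.mem_reverse, hbar]
    exact List.mem_map_of_mem hy

theorem Substitution.exists_iterate_onWord_eq_cons (χ : Substitution n n) (k : ℕ) (x : Letter n) :
    ∃ w, χ.onWord^[k] [x] = χ.germMap^[k] x :: w := by
  induction k with
  | zero => exact ⟨[], rfl⟩
  | succ k ih =>
    obtain ⟨w, hw⟩ := ih
    rw [Function.iterate_succ_apply', Function.iterate_succ_apply', hw, onWord_cons]
    refine ⟨(χ.onLetter (χ.germMap^[k] x)).tail ++ χ.onWord w, ?_⟩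
    rw [← List.cons_append, germMap, List.cons_head_tail]

theorem Substitution.range_iterate_germMap_anti (χ : Substitution n n) (k : ℕ) :
    range χ.germMap^[k + 1] ⊆ range χ.germMap^[k] := by
  rintro - ⟨x, rfl⟩
  exact ⟨χ.germMap x, rfl⟩

theorem Substitution.eventualRange_nonempty [NeZero n] (χ : Substitution n n) :
    χ.eventualRange.Nonempty := by
  by_contra hcon
  obtain ⟨k, hk⟩ := exists_eq_empty_of_antitone (fun k => isClosed_discrete (range χ.germMap^[k]))
    χ.range_iterate_germMap_anti (not_nonempty_iff_eq_empty.1 hcon)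
  exact (range_nonempty χ.germMap^[k]).ne_empty hk

/-- The action on edge germs maps the eventual range onto itself. -/
theorem Substitution.exists_mem_eventualRange_germMap_eq {r : Letter n}
    (hr : r ∈ χ.eventualRange) : ∃ x ∈ χ.eventualRange, χ.germMap x = r := by
  by_contra hcon
  obtain ⟨k, hk⟩ := exists_eq_empty_of_antitone
    (K := fun k => range χ.germMap^[k] ∩ χ.germMap ⁻¹' {r})
    (fun k => isClosed_discrete _)
    (fun k => inter_subset_inter_left _ (χ.range_iterate_germMap_anti k)) (by
      rw [eq_empty_iff_forall_notMem]
      intro x hx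
      rw [mem_iInter] at hx
      exact hcon ⟨x, mem_iInter.2 fun k => (hx k).1, (hx 0).2⟩)
  obtain ⟨x, hx⟩ := mem_iInter.1 hr (k + 1)
  rw [Function.iterate_succ_apply'] at hx
  have hmem : χ.germMap^[k] x ∈ range χ.germMap^[k] ∩ χ.germMap ⁻¹' {r} := ⟨⟨x, rfl⟩, hx⟩
  rw [hk] at hmem
  exact hmem

theorem Substitution.exists_iterate_germMap_eq {r : Letter n} (hr : χ.eventualRange = {r}) :
    ∃ k, ∀ x, χ.germMap^[k] x = r := by
  obtain ⟨k, hk⟩ := exists_eq_empty_of_antitone (K := fun k => range χ.germMap^[k] ∩ {r}ᶜ)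
    (fun k => isClosed_discrete _)
    (fun k => inter_subset_inter_left _ (χ.range_iterate_germMap_anti k)) (by
      rw [eq_empty_iff_forall_notMem]
      intro x hx
      rw [mem_iInter] at hx
      have : x ∈ χ.eventualRange := mem_iInter.2 fun k => (hx k).1
      rw [hr] at this
      exact (hx 0).2 this)
  refine ⟨k, fun x => ?_⟩
  by_contra hne
  have hmem : χ.germMap^[k] x ∈ range χ.germMap^[k] ∩ {r}ᶜ := ⟨⟨x, rfl⟩, hne⟩
  rw [hk] at hmem
  exact hmem

theorem Letter.bar_ne (x : Letter n) : x.bar ≠ x := by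
  intro h
  have := congrArg Prod.snd h
  simp [Letter.bar] at this

theorem Substitution.iterate_onWord_append (χ : Substitution n n) (k : ℕ)
    (v w : List (Letter n)) :
    χ.onWord^[k] (v ++ w) = χ.onWord^[k] v ++ χ.onWord^[k] w := by
  rw [← onWord_iter, ← onWord_iter, ← onWord_iter, onWord_append]

theorem Substitution.iterate_onWord_bar (χ : Substitution n n) (k : ℕ) (x : Letter n) :
    χ.onWord^[k] [x.bar] = barWord (χ.onWord^[k] [x]) := by
  rw [← onWord_iter, ← onWord_iter, ← onWord_barWord]
  rfl

/-- If a single edge germ survives, then all the words `χ ^ k (x)` start with the same letter `r`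
and, by the symmetry under the bar, end with `r̄`, so that two consecutive ones form a fold. -/
theorem Substitution.folds_of_eventualRange_eq_singleton [NeZero n] {r : Letter n}
    (hr : χ.eventualRange = {r}) : χ.Folds := by
  obtain ⟨k, hk⟩ := Substitution.exists_iterate_germMap_eq hr
  have hstart : ∀ x, ∃ w, χ.onWord^[k] [x] = r :: w := fun x => by
    obtain ⟨w, hw⟩ := χ.exists_iterate_onWord_eq_cons k x
    exact ⟨w, hk x ▸ hw⟩
  have hend : ∀ x, ∃ w, χ.onWord^[k] [x] = w ++ [r.bar] := fun x => by
    obtain ⟨w, hw⟩ := hstart x.bar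
    refine ⟨barWord w, ?_⟩
    rw [← x.bar_bar, iterate_onWord_bar, hw, barWord_cons]
  have hk0 : 1 ≤ k := by
    rw [Nat.one_le_iff_ne_zero]
    rintro rfl
    exact r.bar_ne ((hk r.bar : r.bar = r))
  obtain ⟨w, hw⟩ := hstart (0, true)
  obtain ⟨w', hw'⟩ := hend (0, true)
  obtain ⟨y, w'', rfl⟩ : ∃ y w'', w = y :: w'' := by
    cases w with
    | cons y w'' => exact ⟨y, w'', rfl⟩
    | nil =>
      exfalso
      rw [hw] at hw'
      have h1 : r = r.bar := by
        have := congrArg List.getLast? hw'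
        simpa using this
      exact r.bar_ne h1.symm
  obtain ⟨u, hu⟩ := hend r
  obtain ⟨u', hu'⟩ := hstart y
  have hinf : [r.bar, r] <:+: χ.onWord^[k + k] [(0, true)] := by
    refine ⟨u, u' ++ χ.onWord^[k] w'', ?_⟩
    have hsplit : r :: y :: w'' = [r] ++ ([y] ++ w'') := rfl
    rw [Function.iterate_add_apply, hw, hsplit, iterate_onWord_append, iterate_onWord_append, hu,
      hu']
    simp
  refine ⟨0, r.1, k + k, by lia, ?_⟩
  obtain ⟨i, _ | _⟩ := r
  · exact Or.inl hinf
  · exact Or.inr hinf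

end germs

/-! ### Three surviving germs pin down the base point -/

section star

theorem Wedge.eq_of_loopL_eq {n : ℕ} {x y : Letter n} {s t : ℝ} (hs : s ∈ Ioo (0 : ℝ) (1 / 2))
    (ht : t ∈ Ioo (0 : ℝ) (1 / 2)) (h : Wedge.loopL x s = Wedge.loopL y t) : x = y := by
  obtain ⟨i, a⟩ := x
  obtain ⟨j, b⟩ := y
  obtain ⟨s0, s1⟩ := hs
  obtain ⟨t0, t1⟩ := ht
  cases a <;> cases b <;> simp only [Wedge.loopL, if_true, Bool.false_eq_true, if_false] at h <;>
    obtain ⟨h1, h2⟩ := Wedge.loop_inj ⟨by linarith, by linarith⟩ ⟨by linarith, by linarith⟩ h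
  · rw [h1]
  · linarith
  · linarith
  · rw [h1]

variable {n m : ℕ} [NeZero n] [NeZero m] {χ : Substitution n n} {ψ : Substitution m m}

theorem wordPath_eq_loopL_head {w : List (Letter n)} (hw : w ≠ []) {s : ℝ}
    (hs : s ∈ Icc (0 : ℝ) 1) : wordPath w s = Wedge.loopL (w.head hw) s := by
  cases w with
  | nil => exact absurd rfl hw
  | cons x w => rw [wordPath_cons_of_le _ _ hs.2, clamp_of_mem hs, List.head_cons]

/-- A germ in the eventual range is the germ of a path in the inverse limit that starts at the
base point. -/
theorem InverseLimit.exists_path_of_mem_eventualRange {r : Letter n}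
    (hr : r ∈ χ.eventualRange) : ∃ γ : ℝ → InverseLimit (linMap χ), Continuous γ ∧
      γ 0 = InverseLimit.basePoint χ ∧ ∀ t, (γ t).1 0 = Wedge.loopL r (clamp t) := by
  choose next hnext using fun x : χ.eventualRange =>
    Substitution.exists_mem_eventualRange_germMap_eq x.2
  let q : ℕ → χ.eventualRange := fun k =>
    Nat.rec ⟨r, hr⟩ (fun _ x => ⟨next x, (hnext x).1⟩) k
  have hq : ∀ k, χ.germMap (q (k + 1)).1 = (q k).1 := fun k => (hnext (q k)).2
  -- at level `k` the path runs along the `k`-th letter of the thread with speed `1 / Λ k`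
  let Λ : ℕ → ℝ := fun k =>
    Nat.rec 1 (fun k a => a * (χ.onLetter (q (k + 1)).1).length) k
  have hΛ : ∀ k, Λ (k + 1) = Λ k * (χ.onLetter (q (k + 1)).1).length := fun k => rfl
  have hΛ1 : ∀ k, 1 ≤ Λ k := by
    intro k
    induction k with
    | zero => exact le_rfl
    | succ k ih =>
      rw [hΛ]
      refine one_le_mul_of_one_le_of_one_le ih ?_
      exact_mod_cast List.length_pos_of_ne_nil (χ.ne_nil (q (k + 1)).1)
  have hmem : ∀ t k, clamp t / Λ k ∈ Icc (0 : ℝ) 1 := fun t k =>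
    ⟨div_nonneg (clamp_mem t).1 (zero_le_one.trans (hΛ1 k)),
      div_le_one_of_le₀ ((clamp_mem t).2.trans (hΛ1 k)) (zero_le_one.trans (hΛ1 k))⟩
  refine ⟨fun t => ⟨fun k => Wedge.loopL (q k).1 (clamp t / Λ k), fun k => ?_⟩,
    InverseLimit.continuous_of_val fun k => (Wedge.continuous_loopL _).comp
      (continuous_clamp.div_const _), Subtype.ext (funext fun k => ?_), fun t => ?_⟩
  · show linMap χ (Wedge.loopL (q (k + 1)).1 (clamp t / Λ (k + 1))) = _
    rw [linMap_loopL χ _ (hmem t (k + 1))]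
    have hlen := stretch_pos χ (q (k + 1)).1
    have e : ((χ.onLetter (q (k + 1)).1).length : ℝ) * (clamp t / Λ (k + 1)) = clamp t / Λ k := by
      have := (zero_lt_one.trans_le (hΛ1 k)).ne'
      have := hlen.ne'
      rw [hΛ]
      field_simp
    rw [e, wordPath_eq_loopL_head (χ.ne_nil _) (hmem t k)]
    exact congrArg (fun x => Wedge.loopL x _) (hq k)
  · show Wedge.loopL (q k).1 (clamp 0 / Λ k) = Wedge.base n
    rw [clamp_of_le le_rfl, zero_div, Wedge.loopL_zero]
  · show Wedge.loopL r (clamp t / 1) = _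
    rw [div_one]

/-- Two paths on the line that start at the same point and are disjoint otherwise end on opposite
sides of it. -/
theorem mul_neg_of_disjoint_paths {c c' : ℝ → ℝ} {η : ℝ} (hη : 0 < η)
    (hc : ContinuousOn c (Icc 0 η)) (hc' : ContinuousOn c' (Icc 0 η)) (h0 : c 0 = c' 0)
    (h : ∀ t ∈ Ioc 0 η, ∀ t' ∈ Ioc 0 η, c t ≠ c' t') (h1 : c η ≠ c 0) (h2 : c' η ≠ c 0) :
    (c η - c 0) * (c' η - c 0) < 0 := by
  have hm : η ∈ Ioc 0 η := ⟨hη, le_rfl⟩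
  have pull : ∀ {d : ℝ → ℝ} {v : ℝ}, d 0 = c 0 → v ≠ c 0 → v ∈ d '' Icc 0 η →
      ∃ t ∈ Ioc 0 η, d t = v := by
    rintro d v hd hv ⟨t, ht, rfl⟩
    exact ⟨t, ⟨lt_of_le_of_ne ht.1 fun h => hv (by rw [← h, hd]), ht.2⟩, rfl⟩
  rcases lt_or_gt_of_ne h1 with a | a <;> rcases lt_or_gt_of_ne h2 with b | b
  · exfalso
    rcases le_total (c η) (c' η) with hle | hle
    · obtain ⟨t, ht, e⟩ := pull rfl h2 (intermediate_value_Icc' hη.le hc ⟨hle, b.le⟩)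
      exact h t ht η hm e
    · obtain ⟨t, ht, e⟩ := pull h0.symm h1 (intermediate_value_Icc' hη.le hc' ⟨hle, h0 ▸ a.le⟩)
      exact h η hm t ht e.symm
  · exact mul_neg_of_neg_of_pos (sub_neg.2 a) (sub_pos.2 b)
  · exact mul_neg_of_pos_of_neg (sub_pos.2 a) (sub_neg.2 b)
  · exfalso
    rcases le_total (c η) (c' η) with hle | hle
    · obtain ⟨t, ht, e⟩ := pull h0.symm h1 (intermediate_value_Icc hη.le hc' ⟨h0 ▸ a.le, hle⟩)
      exact h η hm t ht e.symm
    · obtain ⟨t, ht, e⟩ := pull rfl h2 (intermediate_value_Icc hη.le hc ⟨b.le, hle⟩)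
      exact h t ht η hm e

/-- Points of the inverse limit of a linear model other than the base point are not the center of
a triod, whereas three germs in the eventual range make the base point the center of one. -/
theorem InverseLimit.map_basePoint_of_two_lt (hR : 2 < χ.eventualRange.ncard)
    {h : InverseLimit (linMap χ) → InverseLimit (linMap ψ)} (hh : Continuous h)
    (hi : Function.Injective h) : h (InverseLimit.basePoint χ) = InverseLimit.basePoint ψ := by
  by_contra hne
  obtain ⟨N, hN⟩ : ∃ N, (h (InverseLimit.basePoint χ)).1 N ≠ Wedge.base m := by
    by_contra hcon
    push Not at hcon
    exact hne (Subtype.ext (funext hcon))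
  obtain ⟨l, hl⟩ := Wedge.exists_proj_ne hN
  have : Nonempty (InverseLimit (linMap χ)) := ⟨InverseLimit.basePoint χ⟩
  choose! γ hγ hγ0 hγl using fun r (hr : r ∈ χ.eventualRange) =>
    InverseLimit.exists_path_of_mem_eventualRange hr
  have hev : ∀ r ∈ χ.eventualRange, ∀ᶠ t in 𝓝 (0 : ℝ), Wedge.proj l ((h (γ r t)).1 N) ≠ 0 := by
    intro r hr
    have hc : Continuous fun t => Wedge.proj l ((h (γ r t)).1 N) :=
      (Wedge.continuous_proj l).comp
        ((InverseLimit.continuous_val N).comp (hh.comp (hγ r hr)))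
    refine hc.continuousAt.eventually_ne ?_
    rw [hγ0 r hr]
    exact hl
  obtain ⟨ε, hε, hball⟩ := Metric.eventually_nhds_iff.1
    ((Set.toFinite χ.eventualRange).eventually_all.2 hev)
  obtain ⟨η, hη, hηε⟩ := exists_between (lt_min hε (show (0 : ℝ) < 1 / 2 by norm_num))
  have hη2 : η < 1 / 2 := hηε.trans_le (min_le_right _ _)
  have hproj : ∀ r ∈ χ.eventualRange, ∀ t ∈ Icc 0 η, Wedge.proj l ((h (γ r t)).1 N) ≠ 0 := by
    intro r hr t ht
    refine hball ?_ r hr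
    rw [Real.dist_eq, sub_zero, abs_of_nonneg ht.1]
    exact ht.2.trans_lt (hηε.trans_le (min_le_left _ _))
  let c : Letter n → ℝ → ℝ := fun r t => Wedge.coord (Wedge.proj l ((h (γ r t)).1 N))
  have hc : ∀ r ∈ χ.eventualRange, ContinuousOn (c r) (Icc 0 η) := fun r hr t ht =>
    (ContinuousAt.comp (f := fun t => Wedge.proj l ((h (γ r t)).1 N))
      (Wedge.continuousAt_coord (hproj r hr t ht)) ((Wedge.continuous_proj l).comp
        ((InverseLimit.continuous_val N).comp (hh.comp (hγ r hr)))).continuousAt).continuousWithinAt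
  -- near `h` of the base point, the coordinate `c` separates the points of the triod
  have hinj : ∀ r ∈ χ.eventualRange, ∀ r' ∈ χ.eventualRange, ∀ t ∈ Icc 0 η, ∀ t' ∈ Icc 0 η,
      c r t = c r' t' → Wedge.loopL r t = Wedge.loopL r' t' := by
    intro r hr r' hr' t ht t' ht' hcc
    have hz : (0 : ℝ) ∈ Icc 0 η := ⟨le_rfl, hη.le⟩
    have hpre : ∀ r ∈ χ.eventualRange, IsPreconnected ((fun t => h (γ r t)) '' Icc 0 η) :=
      fun r hr => isPreconnected_Icc.image _ (hh.comp (hγ r hr)).continuousOn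
    have hC := IsPreconnected.union (h (InverseLimit.basePoint χ))
      (by rw [← hγ0 r hr]; exact ⟨0, hz, rfl⟩) (by rw [← hγ0 r' hr']; exact ⟨0, hz, rfl⟩)
      (hpre r hr) (hpre r' hr')
    have hval : (h (γ r t)).1 N = (h (γ r' t')).1 N := by
      rw [Wedge.eq_incl_of_proj_ne (hproj r hr t ht),
        Wedge.eq_incl_of_proj_ne (hproj r' hr' t' ht'), ← Wedge.coe_coord (Wedge.proj l _),
        ← Wedge.coe_coord (Wedge.proj l ((h (γ r' t')).1 N))]
      exact congrArg (fun s : ℝ => Wedge.incl l (s : UnitAddCircle)) hcc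
    have hb : ∀ r ∈ χ.eventualRange, ∀ t ∈ Icc 0 η, (h (γ r t)).1 N ≠ Wedge.base m :=
      fun r hr t ht hb => hproj r hr t ht (by rw [hb, Wedge.proj_base])
    have heq := InverseLimit.injOn_val (N := N) hC (by
      rintro - (⟨s, hs, rfl⟩ | ⟨s, hs, rfl⟩)
      · exact hb r hr s hs
      · exact hb r' hr' s hs) (Or.inl ⟨t, ht, rfl⟩) (Or.inr ⟨t', ht', rfl⟩) hval
    have h0 := congrArg (fun z : InverseLimit (linMap χ) => z.1 0) (hi heq)
    have h0' : (γ r t).1 0 = (γ r' t').1 0 := h0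
    rw [hγl r hr, hγl r' hr', clamp_of_mem ⟨ht.1, by linarith [ht.2]⟩,
      clamp_of_mem ⟨ht'.1, by linarith [ht'.2]⟩] at h0'
    exact h0'
  have hc0 : ∀ r ∈ χ.eventualRange, ∀ r' ∈ χ.eventualRange, c r 0 = c r' 0 := by
    intro r hr r' hr'
    simp only [c]
    rw [hγ0 r hr, hγ0 r' hr']
  have hη0 : ∀ r ∈ χ.eventualRange, c r η ≠ c r 0 := by
    intro r hr hcr
    have := hinj r hr r hr η ⟨hη.le, le_rfl⟩ 0 ⟨le_rfl, hη.le⟩ hcr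
    rw [Wedge.loopL_zero] at this
    exact Wedge.loopL_ne_base ⟨hη, by linarith⟩ this
  have hneg : ∀ r ∈ χ.eventualRange, ∀ r' ∈ χ.eventualRange, r ≠ r' →
      (c r η - c r 0) * (c r' η - c r 0) < 0 := by
    intro r hr r' hr' hrr
    refine mul_neg_of_disjoint_paths hη (hc r hr) (hc r' hr') (hc0 r hr r' hr') ?_ (hη0 r hr) ?_
    · intro t ht t' ht' hcc
      exact hrr (Wedge.eq_of_loopL_eq ⟨ht.1, ht.2.trans_lt hη2⟩ ⟨ht'.1, ht'.2.trans_lt hη2⟩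
        (hinj r hr r' hr' t (Ioc_subset_Icc_self ht) t' (Ioc_subset_Icc_self ht') hcc))
    · rw [hc0 r hr r' hr']
      exact hη0 r' hr'
  -- three nonzero numbers cannot have pairwise opposite signs
  obtain ⟨r₁, r₂, r₃, m₁, m₂, m₃, h12, h13, h23⟩ := (two_lt_ncard_iff (toFinite _)).1 hR
  have p := hneg r₁ m₁ r₂ m₂ h12
  have q := hneg r₁ m₁ r₃ m₃ h13
  have s := hneg r₂ m₂ r₃ m₃ h23
  rw [← hc0 r₁ m₁ r₂ m₂] at s
  nlinarith [mul_pos_of_neg_of_neg p q, sq_nonneg (c r₁ η - c r₁ 0)]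

end star

/-! ### Folds pin down the base point -/

section fold

variable {n m : ℕ} [NeZero n] [NeZero m] {χ : Substitution n n} {ψ : Substitution m m}

theorem Wedge.proj_loopL_of_ne {n : ℕ} {x : Letter n} {l : Fin n} (h : x.1 ≠ l) (r : ℝ) :
    Wedge.proj l (Wedge.loopL x r) = 0 := by
  rw [Wedge.loopL, Wedge.proj_loop, if_neg h]

/-- While a taut path avoids the base point, the coordinate of an intermediate point lies between
the coordinates of the ends. -/
theorem IsTaut.exists_coord_between {P : ℝ → Wedge n} {a b t₁ t₀ t₂ : ℝ} (h : IsTaut P a b)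
    (ha : a ≤ t₁) (h1 : t₁ < t₀) (h2 : t₀ < t₂) (hb : t₂ ≤ b)
    (hne : ∀ t ∈ Icc t₁ t₂, P t ≠ Wedge.base n) :
    ∃ l, (∀ l', Wedge.proj l' (P t₁) ≠ 0 ∨ Wedge.proj l' (P t₀) ≠ 0 → l' = l) ∧
      (Wedge.coord (Wedge.proj l (P t₀)) - Wedge.coord (Wedge.proj l (P t₁))) *
        (Wedge.coord (Wedge.proj l (P t₀)) - Wedge.coord (Wedge.proj l (P t₂))) ≤ 0 := by
  obtain ⟨x, φ, -, hm, hφ⟩ := h.exists_segment ha (h1.trans h2) hb hne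
  have m1 : t₁ ∈ Icc t₁ t₂ := ⟨le_rfl, (h1.trans h2).le⟩
  have m0 : t₀ ∈ Icc t₁ t₂ := ⟨h1.le, h2.le⟩
  have m2 : t₂ ∈ Icc t₁ t₂ := ⟨(h1.trans h2).le, le_rfl⟩
  have hl : ∀ t ∈ Icc t₁ t₂, ∀ l', Wedge.proj l' (P t) ≠ 0 → l' = x.1 := by
    intro t ht l' hl'
    by_contra hcon
    rw [(hφ t ht).2] at hl'
    exact hl' (Wedge.proj_loopL_of_ne (Ne.symm hcon) _)
  refine ⟨x.1, fun l' h' => h'.elim (hl _ m1 l') (hl _ m0 l'), ?_⟩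
  have hcoord : ∀ t ∈ Icc t₁ t₂, Wedge.coord (Wedge.proj x.1 (P t)) =
      if x.2 = true then φ t else 1 - φ t := by
    intro t ht
    obtain ⟨h3, h4⟩ := hφ t ht
    rw [h4, Wedge.loopL, Wedge.proj_loop, if_pos rfl, Wedge.coord_coe]
    split_ifs
    · exact Ioo_subset_Ico_self h3
    · exact ⟨by linarith [h3.2], by linarith [h3.1]⟩
  rw [hcoord _ m1, hcoord _ m0, hcoord _ m2]
  have e1 := hm m1 m0 h1
  have e2 := hm m0 m2 h2
  split_ifs <;> nlinarith

/-- At a fold of `χ ^ p`, followed by `j` further steps: the inverse limit contains a short arc,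
near the base point at level `k`, that is folded in half at level `k + j`, where its middle is at
the base point, whereas its ends stay away from the base point at level `k`. -/
theorem InverseLimit.exists_folded_path (hχ : χ.IsOnto) {p : ℕ} {x y : Letter n}
    (hf : [y.bar, y] <:+: χ.onWord^[p] [x]) (k j : ℕ) {e : ℝ} (he : 0 < e) (he4 : e ≤ 1 / 4) :
    ∃ (E : ℝ → InverseLimit (linMap χ)) (t₁ t₀ t₂ : ℝ), Continuous E ∧ InjOn E (Ioo 0 1) ∧
      0 ≤ t₁ ∧ t₁ < t₀ ∧ t₀ < t₂ ∧ t₂ ≤ 1 ∧ (E t₁).1 (k + j) = (E t₂).1 (k + j) ∧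
      (E t₀).1 (k + j) = Wedge.base n ∧ (∃ g, (E t₁).1 k = Wedge.loopL g e) ∧
      ∀ t ∈ Icc t₁ t₂, (E t).1 k ∉ Wedge.zone n e := by
  obtain ⟨E, hE, hEx⟩ := InverseLimit.exists_edge hχ (k + j + p) x
  obtain ⟨ρ, hρc, hρm, hρ0, hρ1, hρ⟩ := exists_iterate_linMap_loopL χ p x
  obtain ⟨σ, hσc, hσm, hσ0, hσ1, hσ⟩ := exists_iterate_linMap_loopL χ j y
  obtain ⟨u, v, huv⟩ := hf
  set W := χ.onWord^[p] [x] with hW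
  have hV : χ.onWord^[j] [y] ≠ [] := by
    rw [← Substitution.onWord_iter]
    exact Substitution.onWord_ne_nil _ (List.cons_ne_nil _ _)
  have hVlen : (1 : ℝ) ≤ (χ.onWord^[j] [y]).length := by
    exact_mod_cast List.length_pos_of_ne_nil hV
  -- the distance from the fold at level `k + j` that corresponds to the distance `e` at level `k`
  obtain ⟨s, hs, hse⟩ : ∃ s ∈ Ioo (0 : ℝ) 1, σ s = e := by
    obtain ⟨s, hs, hse⟩ := intermediate_value_Icc zero_le_one hσc.continuousOn
      (show e ∈ Icc (σ 0) (σ 1) by rw [hσ0, hσ1]; exact ⟨he.le, by linarith⟩)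
    refine ⟨s, ⟨lt_of_le_of_ne hs.1 ?_, lt_of_le_of_ne hs.2 ?_⟩, hse⟩
    · rintro rfl
      linarith
    · rintro rfl
      linarith
  have hhead : ∀ r ∈ Icc (0 : ℝ) s, σ r ∈ Icc 0 e ∧ (linMap χ)^[j] (Wedge.loopL y r) =
      Wedge.loopL ((χ.onWord^[j] [y]).head hV) (σ r) := by
    intro r hr
    have hr1 : r ∈ Icc (0 : ℝ) 1 := ⟨hr.1, hr.2.trans hs.2.le⟩
    have hσr : σ r ∈ Icc 0 e :=
      ⟨hσ0 ▸ hσm.monotoneOn ⟨le_rfl, zero_le_one⟩ hr1 hr.1,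
        hse ▸ hσm.monotoneOn hr1 (Ioo_subset_Icc_self hs) hr.2⟩
    refine ⟨hσr, ?_⟩
    rw [hσ r hr1, wordPath_eq_loopL_head hV ⟨hσr.1, by linarith [hσr.2]⟩]
  have hlen : ((u.length : ℝ) + 1) + 1 ≤ W.length := by
    have := congrArg List.length huv
    simp only [List.length_append, List.length_cons, List.length_nil] at this
    rw [← this]
    push_cast
    have : (0 : ℝ) ≤ v.length := Nat.cast_nonneg _
    linarith
  have hu0 : (0 : ℝ) ≤ u.length := Nat.cast_nonneg _
  have htime : ∀ r ∈ Ioo (0 : ℝ) W.length, ∃ t ∈ Ioo (0 : ℝ) 1, ρ t = r := by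
    intro r hr
    obtain ⟨t, ht, htr⟩ := intermediate_value_Icc zero_le_one hρc.continuousOn
      (show r ∈ Icc (ρ 0) (ρ 1) by rw [hρ0, hρ1]; exact Ioo_subset_Icc_self hr)
    refine ⟨t, ⟨lt_of_le_of_ne ht.1 ?_, lt_of_le_of_ne ht.2 ?_⟩, htr⟩
    · rintro rfl
      exact hr.1.ne (hρ0.symm.trans htr)
    · rintro rfl
      exact hr.2.ne (htr.symm.trans hρ1)
  have hE1 : ∀ t ∈ Icc (0 : ℝ) 1, (E t).1 (k + j) = wordPath W (ρ t) := by
    intro t ht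
    rw [← hρ t ht, ← (E t).iterate_apply (k + j) p, hEx, clamp_of_mem ht]
  have hpath : ∀ d ∈ Icc (-s) s, wordPath W ((u.length + 1) + d) = Wedge.loopL y |d| := by
    intro d hd
    have e1 : (u.length : ℝ) + 1 + d - u.length = 1 + d := by ring
    rw [← huv, List.append_assoc, wordPath_append_of_ge _ _ (by linarith [hd.1, hs.2]), e1]
    rcases le_total d 0 with h0 | h0
    · have hmem : 1 + d ∈ Icc (0 : ℝ) 1 := ⟨by linarith [hd.1, hs.2], by linarith⟩
      rw [List.cons_append, wordPath_cons_of_le _ _ hmem.2, clamp_of_mem hmem, Wedge.loopL_bar,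
        abs_of_nonpos h0]
      congr 1
      ring
    · have hmem : d ∈ Icc (0 : ℝ) 1 := ⟨h0, hd.2.trans hs.2.le⟩
      rw [List.cons_append, wordPath_cons_of_ge _ _ (by linarith), add_sub_cancel_left,
        List.cons_append, wordPath_cons_of_le _ _ hmem.2, clamp_of_mem hmem, abs_of_nonneg h0]
  obtain ⟨t₁, ht₁, e₁⟩ := htime (u.length + 1 + -s) ⟨by linarith [hs.2], by linarith [hs.1]⟩
  obtain ⟨t₀, ht₀, e₀⟩ := htime (u.length + 1 + 0) ⟨by linarith, by linarith⟩
  obtain ⟨t₂, ht₂, e₂⟩ := htime (u.length + 1 + s) ⟨by linarith [hs.1], by linarith [hs.2]⟩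
  have m₁ := Ioo_subset_Icc_self ht₁
  have m₀ := Ioo_subset_Icc_self ht₀
  have m₂ := Ioo_subset_Icc_self ht₂
  have hlevel : ∀ t ∈ Icc (0 : ℝ) 1, ∀ d ∈ Icc (-s) s, ρ t = u.length + 1 + d →
      (E t).1 (k + j) = Wedge.loopL y |d| := by
    intro t ht d hd hρd
    rw [hE1 t ht, hρd, hpath d hd]
  have hs0 := hs.1.le
  have d₁ := hlevel t₁ m₁ (-s) ⟨le_rfl, by linarith⟩ e₁
  have d₀ := hlevel t₀ m₀ 0 ⟨by linarith, hs0⟩ e₀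
  have d₂ := hlevel t₂ m₂ s ⟨by linarith, le_rfl⟩ e₂
  rw [abs_neg, abs_of_nonneg hs0] at d₁
  rw [abs_of_nonneg hs0] at d₂
  rw [abs_zero, Wedge.loopL_zero] at d₀
  refine ⟨E, t₁, t₀, t₂, hE, InverseLimit.injOn_edge hEx, m₁.1,
    (hρm.lt_iff_lt m₁ m₀).1 (by linarith [hs.1]), (hρm.lt_iff_lt m₀ m₂).1 (by linarith [hs.1]),
    m₂.2, d₁.trans d₂.symm, d₀, ⟨(χ.onWord^[j] [y]).head hV, ?_⟩, fun t ht => ?_⟩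
  · rw [← (E t₁).iterate_apply k j, d₁, (hhead s ⟨hs0, le_rfl⟩).2, hse]
  · have htI : t ∈ Icc (0 : ℝ) 1 := ⟨m₁.1.trans ht.1, ht.2.trans m₂.2⟩
    have hd : ρ t - (u.length + 1) ∈ Icc (-s) s :=
      ⟨by linarith [hρm.monotoneOn m₁ htI ht.1], by linarith [hρm.monotoneOn htI m₂ ht.2]⟩
    obtain ⟨hσd, hd'⟩ := hhead |ρ t - (u.length + 1)| ⟨abs_nonneg _, abs_le.2 hd⟩
    rw [← (E t).iterate_apply k j, hlevel t htI _ hd (by ring), hd']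
    rcases hσd.1.eq_or_lt with h0 | h0
    · rw [← h0, Wedge.loopL_zero]
      exact Wedge.base_notMem_zone he.le
    · rw [Wedge.loopL_mem_zone he.le ⟨h0, by linarith [hσd.2]⟩]
      exact fun hcon => hcon.1.not_ge hσd.2

/-- Near a point of the inverse limit other than the base point, an arc cannot be folded onto
itself in the limit. At the base point of a folding pattern this happens. -/
theorem InverseLimit.map_basePoint_of_folds (hχ : χ.IsOnto) (hf : χ.Folds)
    {h : InverseLimit (linMap χ) → InverseLimit (linMap ψ)} (hh : Continuous h)
    (hi : Function.Injective h) : h (InverseLimit.basePoint χ) = InverseLimit.basePoint ψ := by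
  by_contra hne
  obtain ⟨N, hN⟩ : ∃ N, (h (InverseLimit.basePoint χ)).1 N ≠ Wedge.base m := by
    by_contra hcon
    push Not at hcon
    exact hne (Subtype.ext (funext hcon))
  obtain ⟨x, y, q, hq⟩ : ∃ (x y : Letter n) (q : ℕ), [y.bar, y] <:+: χ.onWord^[q] [x] := by
    obtain ⟨i, l, q, -, h' | h'⟩ := hf
    · exact ⟨(i, true), (l, false), q, h'⟩
    · exact ⟨(i, true), (l, true), q, h'⟩
  have hcval : ∀ M, Continuous fun z => (h z).1 M := fun M => (InverseLimit.continuous_val M).comp hh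
  obtain ⟨k, hk⟩ := InverseLimit.exists_level_mem
    (Wedge.isClosed_base.isOpen_compl.preimage (hcval N)) hN
  obtain ⟨e, he, he4, hU⟩ := hk k le_rfl
  choose E t₁ t₀ t₂ hE hinj h0 h10 h02 h1 h12 hb hg hz using
    fun j => InverseLimit.exists_folded_path hχ hq k j he he4
  have := InverseLimit.compactSpace (continuous_linMap χ)
  -- limits along a fixed ultrafilter exist by compactness
  let F : Ultrafilter ℕ := hyperfilter ℕ
  have hF : (F : Filter ℕ) ≤ atTop := by
    rw [← Nat.cofinite_eq_atTop]
    exact hyperfilter_le_cofinite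
  have hlim : ∀ s : ℕ → InverseLimit (linMap χ), ∃ z, Tendsto s F (𝓝 z) := fun s =>
    ⟨_, (F.map s).le_nhds_lim⟩
  have hlim_eq : ∀ {s s' : ℕ → InverseLimit (linMap χ)} {z z' : InverseLimit (linMap χ)},
      Tendsto s F (𝓝 z) → Tendsto s' F (𝓝 z') → (∀ j, (s j).1 (k + j) = (s' j).1 (k + j)) →
      z = z' := by
    intro s s' z z' hs hs' hss
    refine Subtype.ext (funext fun l => ?_)
    refine tendsto_nhds_unique_of_eventuallyEq
      (((InverseLimit.continuous_val l).tendsto z).comp hs)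
      (((InverseLimit.continuous_val l).tendsto z').comp hs') ?_
    filter_upwards [hF (eventually_ge_atTop l)] with j hj
    exact InverseLimit.eq_of_le (by lia) (hss j)
  obtain ⟨z, hz1⟩ := hlim fun j => E j (t₁ j)
  obtain ⟨z', hz2⟩ := hlim fun j => E j (t₂ j)
  obtain rfl := hlim_eq hz1 hz2 h12
  obtain ⟨b, hz0⟩ := hlim fun j => E j (t₀ j)
  obtain rfl : b = InverseLimit.basePoint χ := hlim_eq hz0 tendsto_const_nhds hb
  -- the ends of the arcs do not approach the base point
  obtain ⟨g, hzg⟩ : ∃ g : Letter n, z.1 k = Wedge.loopL g e := by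
    have hcl : IsClosed (range fun g : Letter n => Wedge.loopL g e) := (finite_range _).isClosed
    obtain ⟨g, hg'⟩ := hcl.mem_of_tendsto (((InverseLimit.continuous_val k).tendsto z).comp hz1)
      (Eventually.of_forall fun j => by
        obtain ⟨g, hg'⟩ := hg j
        exact ⟨g, hg'.symm⟩)
    exact ⟨g, hg'.symm⟩
  have heI : e ∈ Ioo (0 : ℝ) 1 := ⟨he, by linarith⟩
  have hzU : (h z).1 N ≠ Wedge.base m := hU z (by
    rw [hzg, Wedge.loopL_mem_zone he.le heI]
    exact fun hcon => lt_irrefl e hcon.1)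
  have hzb : z ≠ InverseLimit.basePoint χ := by
    rintro rfl
    exact Wedge.loopL_ne_base heI hzg.symm
  refine hzb (hi (Subtype.ext (funext fun M => ?_)))
  suffices key : ∀ M, N ≤ M → (h z).1 M = (h (InverseLimit.basePoint χ)).1 M from
    InverseLimit.eq_of_le (le_max_right N M) (key _ (le_max_left N M))
  intro M hM
  have hup : ∀ w : InverseLimit (linMap ψ), w.1 N ≠ Wedge.base m → w.1 M ≠ Wedge.base m :=
    fun w hw hw' => hw (InverseLimit.eq_of_le (z := InverseLimit.basePoint ψ) hM hw')
  obtain ⟨l₁, hl₁⟩ := Wedge.exists_proj_ne (hup _ hzU)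
  obtain ⟨l₀, hl₀⟩ := Wedge.exists_proj_ne (hup _ hN)
  choose l hl hprod using fun j => (InverseLimit.isTaut (hh.comp (hE j))
    (hi.comp_injOn (hinj j)) M).exists_coord_between (h0 j) (h10 j) (h02 j) (h1 j)
      fun t ht => hup _ (hU _ (hz j t ht))
  have hT : ∀ {s : ℕ → InverseLimit (linMap χ)} {w} (i : Fin m), Tendsto s F (𝓝 w) →
      Tendsto (fun j => Wedge.proj i ((h (s j)).1 M)) F (𝓝 (Wedge.proj i ((h w).1 M))) :=
    fun i hs => (((Wedge.continuous_proj i).comp (hcval M)).tendsto _).comp hs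
  have ev1 : ∀ᶠ j in (F : Filter ℕ), l₁ = l j :=
    ((hT l₁ hz1).eventually_ne hl₁).mono fun j hj => hl j l₁ (Or.inl hj)
  have ev0 : ∀ᶠ j in (F : Filter ℕ), l₀ = l j :=
    ((hT l₀ hz0).eventually_ne hl₀).mono fun j hj => hl j l₀ (Or.inr hj)
  obtain rfl : l₁ = l₀ := by
    obtain ⟨j, hj1, hj0⟩ := (ev1.and ev0).exists
    exact hj1.trans hj0.symm
  have hC : ∀ {s : ℕ → InverseLimit (linMap χ)} {w}, Tendsto s F (𝓝 w) →
      Wedge.proj l₁ ((h w).1 M) ≠ 0 →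
      Tendsto (fun j => Wedge.coord (Wedge.proj l₁ ((h (s j)).1 M))) F
        (𝓝 (Wedge.coord (Wedge.proj l₁ ((h w).1 M)))) :=
    fun hs hw => (Wedge.continuousAt_coord hw).tendsto.comp (hT l₁ hs)
  have hle := le_of_tendsto (((hC hz0 hl₀).sub (hC hz1 hl₁)).mul ((hC hz0 hl₀).sub (hC hz2 hl₁)))
    (show ∀ᶠ j in (F : Filter ℕ), _ ≤ (0 : ℝ) from ev1.mono fun j hj => by
      have := hprod j
      rw [← hj] at this
      exact this)
  -- in the limit, `hle` says that a square is nonpositive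
  have hsq : Wedge.coord (Wedge.proj l₁ ((h (InverseLimit.basePoint χ)).1 M)) =
      Wedge.coord (Wedge.proj l₁ ((h z).1 M)) :=
    sub_eq_zero.1 (mul_self_eq_zero.1 (le_antisymm hle (mul_self_nonneg _)))
  rw [Wedge.eq_incl_of_proj_ne hl₁, Wedge.eq_incl_of_proj_ne hl₀, ← Wedge.coe_coord
    (Wedge.proj l₁ ((h z).1 M)), ← hsq, Wedge.coe_coord]

end fold

/-- An injective continuous map of inverse limits maps the base point to the base point if the
latter is distinguished in the domain. -/
theorem InverseLimit.map_basePoint {n m : ℕ} [NeZero n] [NeZero m] {χ : Substitution n n}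
    {ψ : Substitution m m} (hχ : χ.IsOnto) (hd : χ.Folds ∨ χ.eventualRange.ncard ≠ 2)
    {h : InverseLimit (linMap χ) → InverseLimit (linMap ψ)} (hh : Continuous h)
    (hi : Function.Injective h) : h (InverseLimit.basePoint χ) = InverseLimit.basePoint ψ := by
  by_cases hf : χ.Folds
  · exact InverseLimit.map_basePoint_of_folds hχ hf hh hi
  refine InverseLimit.map_basePoint_of_two_lt ?_ hh hi
  have h2 := hd.resolve_left hf
  have h0 : 0 < χ.eventualRange.ncard := (ncard_pos (toFinite _)).2 χ.eventualRange_nonempty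
  have h1 : χ.eventualRange.ncard ≠ 1 := fun h1 => by
    obtain ⟨r, hr⟩ := ncard_eq_one.1 h1
    exact hf (Substitution.folds_of_eventualRange_eq_singleton hr)
  lia

/-! ### The linear model of a map in the class -/

theorem MemM.factorsThrough_chi {n m : ℕ} [NeZero n] [NeZero m] {f : Wedge n → Wedge m}
    (hf : MemM f) : FactorsThrough f hf.chi :=
  FollowsPattern.factorsThrough hf.existsUnique_followsPattern.choose_spec.1

theorem MemM.isOnto_chi {n : ℕ} [NeZero n] {f : Wedge n → Wedge n} (hf : MemM f) :
    hf.chi.IsOnto := by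
  obtain ⟨μ, -, h⟩ := hf.factorsThrough_chi
  have hs := hf.surjective
  rw [h] at hs
  exact Substitution.isOnto_of_surjective hs.of_comp

theorem theorem1p16 (n m : ℕ) [NeZero n] [NeZero m]
    (f : Wedge n → Wedge n) (g : Wedge m → Wedge m) (hf : MemM f) (hg : MemM g)
    (hfb : hf.IsDistinguished) (hgb : hg.IsDistinguished) :
    Nonempty (InverseLimit f ≃ₜ InverseLimit g) ↔
      Substitution.WeaklyEquivalent hf.chi hg.chi := by
  refine ⟨fun ⟨h⟩ => ?_,
    nonempty_homeomorph_of_weaklyEquivalent hf.factorsThrough_chi hg.factorsThrough_chi⟩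
  obtain ⟨a⟩ := FactorsThrough.seqLimit_homeomorph fun _ : ℕ => hf.factorsThrough_chi
  obtain ⟨b⟩ := FactorsThrough.seqLimit_homeomorph fun _ : ℕ => hg.factorsThrough_chi
  let h' : InverseLimit (linMap hf.chi) ≃ₜ InverseLimit (linMap hg.chi) := (a.symm.trans h).trans b
  exact weaklyEquivalent_of_homeomorph hf.isOnto_chi hg.isOnto_chi h'
    (InverseLimit.map_basePoint hf.isOnto_chi hfb h'.continuous h'.injective)
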